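/- Let $G$ be a linear algebraic group over $\mathbb{R}$ (a smooth affine group scheme of finite type) acting on a smooth $\mathbb{R}$-scheme $X$. For an $\mathbb{R}$-scheme $S$ let $[G\backslash X](S)$ be the groupoid of spans $S\xleftarrow{p}P\xrightarrow{f}X$, where $p$ is an étale-locally trivial $G$-torsor and $f$ is $G$-equivariant; morphisms are $G$-equivariant isomorphisms over $S$ compatible with the maps to $X$. Topologize $[G\backslash X](\mathbb{R})$ and $[G\backslash X](\mathbb{C})$ by means of the analytic topology on complex points: the space of objects is the disjoint union, over all torsors $P$, of the sets $\mathrm{Map}_G(P,X)$ of equivariant maps, with the topology of pointwise convergence on the complex points of $P$ (equivalently, the subspace topology from $X(\mathbb{C})$ under $f\mapsto f(y)$ for any $y\in P(\mathbb{C})$); the space of morphisms is the disjoint union, over all pairs $(P,Q)$, of the corresponding subspaces of $\mathrm{Iso}(P,Q)\times\mathrm{Map}_G(P,X)\times\mathrm{Map}_G(Q,X)$, where $\mathrm{Iso}(P,Q)$ also carries the topology of pointwise convergence on complex points. The group ${\rm C}_2=\mathrm{Gal}(\mathbb{C}/\mathbb{R})$ acts on $[G\backslash X](\mathbb{C})$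 by pullback along $\operatorname{Spec}\gamma$, i.e. $F(\gamma)(P,p,f)=(P,\operatorname{Spec}(\gamma)^{-1}\circ p,f)$. Let $[G\backslash X](\mathbb{C})^{{\rm hC}_2}$ be the fixed-point groupoid: its objects are objects $x$ with isomorphisms $\varphi_\gamma\colon x\to F(\gamma)(x)$ for $\gamma\in{\rm C}_2$ such that $\varphi_{\gamma\delta}=\eta_{\gamma,\delta}\circ F(\gamma)(\varphi_\delta)\circ\varphi_\gamma$, where $\eta_{\gamma,\delta}\colon F(\gamma)F(\delta)\cong F(\gamma\delta)$ is the canonical comparison; its morphisms are the morphisms commuting with the $\varphi_\gamma$; objects and morphisms carry the subspace topologies. Then $[G\backslash X](\mathbb{R})$, $[G\backslash X](\mathbb{C})$ and $[G\backslash X](\mathbb{C})^{{\rm hC}_2}$ are topological groupoids, the ${\rm C}_2$-action is continuous, and the complexification functor $$[G\backslash X](\mathbb{R})\longrightarrow[G\backslash X](\mathbb{C})^{{\rm hC}_2},\qquad (P,f)\mapsto\bigl(\operatorname{Spec}\mathbb{C}\times_{\operatorname{Spec}\mathbb{R}}P\to P\xrightarrow{f}X,\ (\operatorname{Spec}(\gamma)\times\mathrm{id}_P)_{\gamma}\bigr)$$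 is an equivalence of topological groupoids. That is, this functor $\Phi\colon\mathcal{C}\to\mathcal{D}$ is continuous on objects and on morphisms, it is an equivalence of categories, the canonical map $\mathrm{Mor}\,\mathcal{C}\to(\mathrm{Ob}\,\mathcal{C}\times\mathrm{Ob}\,\mathcal{C})\times_{\mathrm{Ob}\,\mathcal{D}\times\mathrm{Ob}\,\mathcal{D}}\mathrm{Mor}\,\mathcal{D}$ is a homeomorphism, and the map $\mathrm{Ob}\,\mathcal{C}\times_{\mathrm{Ob}\,\mathcal{D}}\mathrm{Mor}\,\mathcal{D}\to\mathrm{Ob}\,\mathcal{D}$, $(c,\Phi(c)\to d)\mapsto d$, is surjective and has a continuous local section through every point of its source. -/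

import Mathlib

open CategoryTheory Limits MonoidalCategory CartesianMonoidalCategory AlgebraicGeometry

namespace RealStack

noncomputable section

/-! ## Group actions on categories and homotopy fixed points -/

/-- A (left, pseudo-functorial) action of a group `Γ` on a category `C`: functors `F γ`, coherent
natural isomorphisms `F γ ∘ F δ ≅ F (γ δ)`, and a compatible isomorphism `id ≅ F 1`. -/
structure GroupAction (Γ : Type*) [Group Γ] (C : Type*) [Category C] where
  /-- the functor by which a group element acts -/
  F : Γ → C ⥤ C
  /-- the comparison `F γ (F δ x) ≅ F (γ δ) x` -/
  η : ∀ γ δ : Γ, F δ ⋙ F γ ≅ F (γ * δ)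
  /-- the comparison `x ≅ F 1 x` -/
  ε : 𝟭 C ≅ F 1
  assoc : ∀ (γ δ θ : Γ) (x : C),
    (η γ δ).hom.app ((F θ).obj x) ≫ (η (γ * δ) θ).hom.app x =
      (F γ).map ((η δ θ).hom.app x) ≫ (η γ (δ * θ)).hom.app x ≫
        eqToHom (by rw [mul_assoc])
  one_left : ∀ (γ : Γ) (x : C),
    ε.hom.app ((F γ).obj x) ≫ (η 1 γ).hom.app x = eqToHom (by rw [one_mul]; rfl)
  one_right : ∀ (γ : Γ) (x : C),
    (F γ).map (ε.hom.app x) ≫ (η γ 1).hom.app x = eqToHom (by rw [mul_one]; rfl)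

/-- An object of the fixed-point category `C^{hΓ}`: an object `x` with isomorphisms
`φ γ : x ≅ F γ x` such that `φ (γ δ) = η γ δ ∘ F γ (φ δ) ∘ φ γ`. -/
structure HFix {Γ : Type*} [Group Γ] {C : Type*} [Category C] (A : GroupAction Γ C) where
  /-- the underlying object -/
  obj : C
  /-- the homotopy fixed point datum -/
  φ : ∀ γ : Γ, obj ≅ (A.F γ).obj obj
  cocycle : ∀ γ δ : Γ,
    (φ (γ * δ)).hom = (φ γ).hom ≫ (A.F γ).map (φ δ).hom ≫ (A.η γ δ).hom.app obj

namespace HFix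

variable {Γ : Type*} [Group Γ] {C : Type*} [Groupoid C] {A : GroupAction Γ C}

/-- Morphisms of homotopy fixed points: morphisms of the underlying objects commuting with the
homotopy fixed point data. -/
@[ext]
structure Hom (x y : HFix A) where
  /-- the underlying morphism -/
  hom : x.obj ⟶ y.obj
  comm : ∀ γ : Γ, (x.φ γ).hom ≫ (A.F γ).map hom = hom ≫ (y.φ γ).hom

instance : Category (HFix A) where
  Hom := Hom
  id x := ⟨𝟙 _, by simp⟩
  comp f g := ⟨f.hom ≫ g.hom, fun γ => by
    rw [Functor.map_comp, ← Category.assoc, f.comm, Category.assoc, g.comm, Category.assoc]⟩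
  id_comp f := Hom.ext (Category.id_comp _)
  comp_id f := Hom.ext (Category.comp_id _)
  assoc f g h := Hom.ext (Category.assoc _ _ _)

/-- The fixed-point category of an action on a groupoid is a groupoid. -/
instance : Groupoid (HFix A) where
  inv f := ⟨Groupoid.inv f.hom, fun γ => by
    have h := f.comm γ
    rw [← cancel_epi f.hom, ← Category.assoc, ← h, Category.assoc, ← Functor.map_comp]
    simp⟩
  inv_comp f := Hom.ext (Groupoid.inv_comp _)
  comp_inv f := Hom.ext (Groupoid.comp_inv _)

variable (A) in
/-- The forgetful functor `C^{hΓ} ⥤ C`. -/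
def forget : HFix A ⥤ C where
  obj x := x.obj
  map f := f.hom

/-- The objects of `C^{hΓ}` carry the subspace topology from `Ob C × (Mor C)^Γ`. -/
instance [TopologicalSpace C] [TopologicalSpace (Arrow C)] : TopologicalSpace (HFix A) :=
  TopologicalSpace.induced
    (fun x => ((x.obj, fun γ => Arrow.mk (x.φ γ).hom) : C × (Γ → Arrow C))) inferInstance

/-- The morphisms of `C^{hΓ}` carry the subspace topology from
`Ob C^{hΓ} × Ob C^{hΓ} × Mor C` (source, target, underlying morphism). -/
instance [TopologicalSpace C] [TopologicalSpace (Arrow C)] : TopologicalSpace (Arrow (HFix A)) :=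
  TopologicalSpace.induced
    (fun a => ((a.left, a.right, (forget A).mapArrow.obj a) : HFix A × HFix A × Arrow C))
    inferInstance

end HFix

/-! ## Topological groupoids and their equivalences -/

/-- A groupoid with topologies on its objects and on its morphisms is a topological groupoid if
source, target, identities, inversion and composition are continuous. -/
structure IsTopologicalGroupoid (C : Type*) [Groupoid C] [TopologicalSpace C]
    [TopologicalSpace (Arrow C)] : Prop where
  continuous_source : Continuous (fun a : Arrow C => (a.left : C))
  continuous_target : Continuous (fun a : Arrow C => (a.right : C))
  continuous_id : Continuous (fun x : C => Arrow.mk (𝟙 x))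
  continuous_inv : Continuous (fun a : Arrow C => Arrow.mk (Groupoid.inv a.hom))
  continuous_comp : Continuous
    (fun p : {p : Arrow C × Arrow C // (p.1.right : C) = p.2.left} =>
      Arrow.mk (p.1.1.hom ≫ eqToHom p.2 ≫ p.1.2.hom))

/-- A group action on a topological groupoid is continuous if every group element acts by a
continuous functor and the comparison isomorphisms are continuous. -/
structure GroupAction.IsContinuous {Γ : Type*} [Group Γ] {C : Type*} [Groupoid C]
    [TopologicalSpace C] [TopologicalSpace (Arrow C)] (A : GroupAction Γ C) : Prop where
  continuous_obj : ∀ γ, Continuous (A.F γ).obj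
  continuous_map : ∀ γ, Continuous (A.F γ).mapArrow.obj
  continuous_comparison : ∀ γ δ, Continuous (fun x : C => Arrow.mk ((A.η γ δ).hom.app x))
  continuous_unit : Continuous (fun x : C => Arrow.mk (A.ε.hom.app x))

/-- A map is a topological submersion if it has a continuous local section through every point of
its source (in particular it is open, and if it is surjective it admits local sections
everywhere). -/
def IsTopologicalSubmersion {Y Z : Type*} [TopologicalSpace Y] [TopologicalSpace Z]
    (f : Y → Z) : Prop :=
  ∀ y : Y, ∃ (U : Set Z) (hU : f y ∈ U) (s : U → Y), IsOpen U ∧ Continuous s ∧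
    (∀ z : U, f (s z) = z) ∧ s ⟨f y, hU⟩ = y

/-- Equivalences of topological groupoids (also called essential, weak or Morita equivalences):
continuous functors `F : C ⥤ D` that are equivalences of categories, such that `Mor C` is
homeomorphic to the fibre product `(Ob C × Ob C) ×_{Ob D × Ob D} Mor D`, and such that the
target map `Ob C ×_{Ob D} Mor D → Ob D`, `(x, F x → d) ↦ d`, is a surjective topological
submersion. -/
structure IsTopologicalEquivalence {C D : Type*} [Groupoid C] [TopologicalSpace C]
    [TopologicalSpace (Arrow C)] [Groupoid D] [TopologicalSpace D] [TopologicalSpace (Arrow D)]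
    (F : C ⥤ D) : Prop where
  continuous_obj : Continuous F.obj
  continuous_map : Continuous F.mapArrow.obj
  isEquivalence : F.IsEquivalence
  isHomeomorph : IsHomeomorph
    (fun a : Arrow C =>
      (⟨((a.left, a.right), F.mapArrow.obj a), rfl, rfl⟩ :
        {z : (C × C) × Arrow D // F.obj z.1.1 = z.2.left ∧ F.obj z.1.2 = z.2.right}))
  surjective : Function.Surjective
    (fun z : {z : C × Arrow D // F.obj z.1 = z.2.left} => (z.1.2.right : D))
  isSubmersion : IsTopologicalSubmersion
    (fun z : {z : C × Arrow D // F.obj z.1 = z.2.left} => (z.1.2.right : D))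

/-! ## Real schemes and their complex points -/

/-- The category of schemes over `Spec ℝ`. -/
abbrev SchR : Type 1 := Over (Spec (CommRingCat.of ℝ))

/-- `Spec ℝ`. -/
def specR : SchR := Over.mk (𝟙 (Spec (CommRingCat.of ℝ)))

/-- `Spec ℂ`, as a scheme over `ℝ`. -/
def specC : SchR := Over.mk (Spec.map (CommRingCat.ofHom (algebraMap ℝ ℂ)))

/-- The structure morphism `Spec ℂ ⟶ Spec ℝ`. -/
def specCToR : specC ⟶ specR := Over.homMk specC.hom (Category.comp_id _)

/-- The Galois group `C₂ = Gal(ℂ/ℝ)`, generated by complex conjugation. -/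
abbrev C2 : Type := ℂ ≃ₐ[ℝ] ℂ

/-- The morphism `Spec γ : Spec ℂ ⟶ Spec ℂ` over `ℝ` for `γ` in the Galois group. -/
def specGal (γ : C2) : specC ⟶ specC :=
  Over.homMk (Spec.map (CommRingCat.ofHom (γ : ℂ →+* ℂ))) (by
    change Spec.map _ ≫ Spec.map _ = Spec.map _
    rw [← Spec.map_comp, ← CommRingCat.ofHom_comp]
    congr 2
    ext r
    exact γ.commutes r)

lemma specGal_one : specGal 1 = 𝟙 specC := by
  ext : 1
  exact Spec.map_id _

lemma specGal_mul (γ δ : C2) : specGal (γ * δ) = specGal γ ≫ specGal δ := by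
  ext : 1
  change Spec.map _ = Spec.map _ ≫ Spec.map _
  rw [← Spec.map_comp]
  rfl

lemma specGal_inv_comp (γ : C2) : specGal γ⁻¹ ≫ specGal γ = 𝟙 specC := by
  rw [← specGal_mul, inv_mul_cancel, specGal_one]

lemma specGal_comp_inv (γ : C2) : specGal γ ≫ specGal γ⁻¹ = 𝟙 specC := by
  rw [← specGal_mul, mul_inv_cancel, specGal_one]

instance isIso_specGal (γ : C2) : IsIso (specGal γ) :=
  ⟨specGal γ⁻¹, specGal_comp_inv γ, specGal_inv_comp γ⟩

lemma specGal_comp (γ : C2) : specGal γ ≫ specCToR = specCToR := by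
  ext : 1
  exact Over.w (specGal γ)

/-- The set `X(ℂ)` of complex points of a real scheme `X`. -/
def ComplexPoints (X : SchR) : Type := specC ⟶ X

/-- The analytic topology on `X(ℂ)`: it is generated by the sets of points `x` lying in an affine
open `j : Spec A ↪ X` with `a(x) ∈ V`, for `a ∈ A` and `V ⊆ ℂ` open. -/
instance (X : SchR) : TopologicalSpace (ComplexPoints X) :=
  TopologicalSpace.generateFrom
    {W | ∃ (A : CommRingCat.{0}) (j : Spec A ⟶ X.left) (a : A) (V : Set ℂ),
      IsOpenImmersion j ∧ IsOpen V ∧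
      W = {x | ∃ φ : A ⟶ CommRingCat.of ℂ, Spec.map φ ≫ j = x.left ∧ φ.hom a ∈ V}}

/-- The topology on the set of morphisms `Y ⟶ Z` of real schemes given by pointwise convergence on
complex points: the coarsest one for which evaluation `Y(ℂ) ∋ y ↦ f(y) ∈ Z(ℂ)` is continuous in
`f` for every `y`. -/
@[reducible] def pointwiseTopology (Y Z : SchR) : TopologicalSpace (Y ⟶ Z) :=
  ⨅ y : ComplexPoints Y,
    TopologicalSpace.induced (fun f => (y ≫ f : specC ⟶ Z)) (inferInstanceAs
      (TopologicalSpace (ComplexPoints Z)))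

/-! ## Torsors and quotient stacks -/

section General

variable {C : Type*} [Category C] [CartesianMonoidalCategory C]

lemma isPullback_whiskerLeft_snd (G : C) {Y Z : C} (f : Y ⟶ Z) :
    IsPullback (G ◁ f) (snd G Y) (snd G Z) f := by
  refine ⟨⟨by simp⟩, ⟨PullbackCone.IsLimit.mk _ (fun s => lift (s.fst ≫ fst G Z) s.snd) ?_ ?_ ?_⟩⟩
  · intro s
    ext
    · simp
    · simpa using s.condition.symm
  · intro s
    simp
  · intro s m h₁ h₂
    ext
    · simp [← h₁]
    · simp [← h₂]

/-- The action morphism `G × P ⟶ P`, `(g, x) ↦ g · x`. -/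
abbrev act (G P : C) [MonObj G] [ModObj G P] : G ⊗ P ⟶ P := ModObj.smul (M := G) (X := P)

lemma one_act (G P : C) [MonObj G] [ModObj G P] :
    MonObj.one (X := G) ▷ P ≫ act G P = (λ_ P).hom := ModObj.one_smul (M := G) P

lemma mul_act (G P : C) [MonObj G] [ModObj G P] :
    MonObj.mul (X := G) ▷ P ≫ act G P = (α_ G G P).hom ≫ G ◁ act G P ≫ act G P :=
  ModObj.mul_smul (M := G) P

variable [HasPullbacks C] (G : C) [GrpObj G]

/-- The morphism `G × (T ×_S P) ⟶ T ×_S P`, `(g, (t, x)) ↦ (t, g · x)`. -/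
def pullbackAct {P S T : C} [ModObj G P] (p : P ⟶ S) (u : T ⟶ S)
    (h : act G P ≫ p = snd G P ≫ p) : G ⊗ pullback u p ⟶ pullback u p :=
  pullback.lift (snd G _ ≫ pullback.fst u p) (G ◁ pullback.snd u p ≫ act G P) (by
    rw [Category.assoc, Category.assoc, h, whiskerLeft_snd_assoc, pullback.condition])

@[simp]
lemma pullbackAct_fst {P S T : C} [ModObj G P] (p : P ⟶ S) (u : T ⟶ S)
    (h : act G P ≫ p = snd G P ≫ p) :
    pullbackAct G p u h ≫ pullback.fst u p = snd G _ ≫ pullback.fst u p :=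
  pullback.lift_fst _ _ _

@[simp]
lemma pullbackAct_fst_assoc {P S T : C} [ModObj G P] (p : P ⟶ S) (u : T ⟶ S)
    (h : act G P ≫ p = snd G P ≫ p)
    {Z : C} (k : T ⟶ Z) :
    pullbackAct G p u h ≫ pullback.fst u p ≫ k = snd G _ ≫ pullback.fst u p ≫ k := by
  simpa only [Category.assoc] using congrArg (· ≫ k) (pullbackAct_fst G p u h)

@[simp]
lemma pullbackAct_snd {P S T : C} [ModObj G P] (p : P ⟶ S) (u : T ⟶ S)
    (h : act G P ≫ p = snd G P ≫ p) :
    pullbackAct G p u h ≫ pullback.snd u p = G ◁ pullback.snd u p ≫ act G P :=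
  pullback.lift_snd _ _ _

@[simp]
lemma pullbackAct_snd_assoc {P S T : C} [ModObj G P] (p : P ⟶ S) (u : T ⟶ S)
    (h : act G P ≫ p = snd G P ≫ p)
    {Z : C} (k : P ⟶ Z) :
    pullbackAct G p u h ≫ pullback.snd u p ≫ k = G ◁ pullback.snd u p ≫ act G P ≫ k := by
  simpa only [Category.assoc] using congrArg (· ≫ k) (pullbackAct_snd G p u h)

/-- The action of `G` on `T ×_S P` through the second factor. -/
@[reducible] def pullbackAction {P S T : C} [ModObj G P] (p : P ⟶ S) (u : T ⟶ S)
    (h : act G P ≫ p = snd G P ≫ p) : ModObj G (pullback u p) where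
  smul := pullbackAct G p u h
  one_smul := by
    change MonObj.one (X := G) ▷ _ ≫ pullbackAct G p u h = (λ_ _).hom
    apply pullback.hom_ext
    · simp [leftUnitor_hom]
    · rw [Category.assoc, pullbackAct_snd, ← whisker_exchange_assoc, one_act]
      simp
  mul_smul := by
    change MonObj.mul (X := G) ▷ _ ≫ pullbackAct G p u h =
      (α_ G G _).hom ≫ G ◁ pullbackAct G p u h ≫ pullbackAct G p u h
    apply pullback.hom_ext
    · simp
    · rw [Category.assoc, pullbackAct_snd, ← whisker_exchange_assoc, mul_act,
        Category.assoc, Category.assoc, pullbackAct_snd, ← whiskerLeft_comp_assoc,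
        pullbackAct_snd]
      simp

end General

section Pullback

variable {C : Type*} [Category C] [HasPullbacks C]

/-- The morphism `T ×_S P ⟶ T ×_S Q` induced by a morphism `P ⟶ Q` over `S`. -/
def pullbackMap {P Q S T : C} {p : P ⟶ S} {q : Q ⟶ S} (u : T ⟶ S) (f : P ⟶ Q) (h : f ≫ q = p) :
    pullback u p ⟶ pullback u q :=
  pullback.lift (pullback.fst u p) (pullback.snd u p ≫ f) (by
    rw [Category.assoc, h, pullback.condition])

@[simp]
lemma pullbackMap_fst {P Q S T : C} {p : P ⟶ S} {q : Q ⟶ S} (u : T ⟶ S) (f : P ⟶ Q)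
    (h : f ≫ q = p) : pullbackMap u f h ≫ pullback.fst u q = pullback.fst u p :=
  pullback.lift_fst _ _ _

@[simp]
lemma pullbackMap_fst_assoc {P Q S T Z : C} {p : P ⟶ S} {q : Q ⟶ S} (u : T ⟶ S) (f : P ⟶ Q)
    (h : f ≫ q = p) (k : T ⟶ Z) :
    pullbackMap u f h ≫ pullback.fst u q ≫ k = pullback.fst u p ≫ k := by
  rw [← Category.assoc, pullbackMap_fst]

@[simp]
lemma pullbackMap_snd {P Q S T : C} {p : P ⟶ S} {q : Q ⟶ S} (u : T ⟶ S) (f : P ⟶ Q)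
    (h : f ≫ q = p) : pullbackMap u f h ≫ pullback.snd u q = pullback.snd u p ≫ f :=
  pullback.lift_snd _ _ _

@[simp]
lemma pullbackMap_snd_assoc {P Q S T Z : C} {p : P ⟶ S} {q : Q ⟶ S} (u : T ⟶ S) (f : P ⟶ Q)
    (h : f ≫ q = p) (k : Q ⟶ Z) :
    pullbackMap u f h ≫ pullback.snd u q ≫ k = pullback.snd u p ≫ f ≫ k := by
  rw [← Category.assoc, pullbackMap_snd, Category.assoc]

/-- The isomorphism `T ×_S P ≅ T ×_S Q` induced by an isomorphism `P ≅ Q` over `S`. -/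
def pullbackMapIso {P Q S T : C} {p : P ⟶ S} {q : Q ⟶ S} (u : T ⟶ S) (e : P ≅ Q)
    (h : e.hom ≫ q = p) : pullback u p ≅ pullback u q where
  hom := pullbackMap u e.hom h
  inv := pullbackMap u e.inv (by rw [Iso.inv_comp_eq, h])
  hom_inv_id := by apply pullback.hom_ext <;> simp
  inv_hom_id := by apply pullback.hom_ext <;> simp

lemma pullbackMap_eq_id {P S T : C} {p : P ⟶ S} (u : T ⟶ S) (h : 𝟙 P ≫ p = p) :
    pullbackMap u (𝟙 P) h = 𝟙 (pullback u p) := by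
  apply pullback.hom_ext <;> simp

lemma pullbackMap_comp {P Q R S T : C} {p : P ⟶ S} {q : Q ⟶ S} {r : R ⟶ S} (u : T ⟶ S)
    (f : P ⟶ Q) (g : Q ⟶ R) (hf : f ≫ q = p) (hg : g ≫ r = q) (hfg : (f ≫ g) ≫ r = p) :
    pullbackMap u (f ≫ g) hfg = pullbackMap u f hf ≫ pullbackMap u g hg := by
  apply pullback.hom_ext <;> simp

/-- The morphism `(t, x) ↦ (s t, x)` of `T ×_S P` for a morphism `s : T ⟶ T` over `S`. -/
def pullbackEnd {P S T : C} (p : P ⟶ S) (u : T ⟶ S) (s : T ⟶ T) (h : s ≫ u = u) :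
    pullback u p ⟶ pullback u p :=
  pullback.lift (pullback.fst u p ≫ s) (pullback.snd u p) (by
    rw [Category.assoc, h, pullback.condition])

@[simp]
lemma pullbackEnd_fst {P S T : C} (p : P ⟶ S) (u : T ⟶ S) (s : T ⟶ T) (h : s ≫ u = u) :
    pullbackEnd p u s h ≫ pullback.fst u p = pullback.fst u p ≫ s :=
  pullback.lift_fst _ _ _

@[simp]
lemma pullbackEnd_fst_assoc {P S T Z : C} (p : P ⟶ S) (u : T ⟶ S) (s : T ⟶ T) (h : s ≫ u = u)
    (k : T ⟶ Z) :
    pullbackEnd p u s h ≫ pullback.fst u p ≫ k = pullback.fst u p ≫ s ≫ k := by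
  rw [← Category.assoc, pullbackEnd_fst, Category.assoc]

@[simp]
lemma pullbackEnd_snd {P S T : C} (p : P ⟶ S) (u : T ⟶ S) (s : T ⟶ T) (h : s ≫ u = u) :
    pullbackEnd p u s h ≫ pullback.snd u p = pullback.snd u p :=
  pullback.lift_snd _ _ _

@[simp]
lemma pullbackEnd_snd_assoc {P S T Z : C} (p : P ⟶ S) (u : T ⟶ S) (s : T ⟶ T) (h : s ≫ u = u)
    (k : P ⟶ Z) :
    pullbackEnd p u s h ≫ pullback.snd u p ≫ k = pullback.snd u p ≫ k := by
  rw [← Category.assoc, pullbackEnd_snd]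

lemma pullbackEnd_comp {P S T : C} (p : P ⟶ S) (u : T ⟶ S) (s s' s'' : T ⟶ T) (h : s ≫ u = u)
    (h' : s' ≫ u = u) (h'' : s'' ≫ u = u) (e : s ≫ s' = s'') :
    pullbackEnd p u s h ≫ pullbackEnd p u s' h' = pullbackEnd p u s'' h'' := by
  subst e
  apply pullback.hom_ext <;> simp

/-- The automorphism `(t, x) ↦ (s t, x)` of `T ×_S P` for an automorphism `s` of `T` over `S`. -/
def pullbackAut {P S T : C} (p : P ⟶ S) (u : T ⟶ S) (s : T ⟶ T) (s' : T ⟶ T) (h : s ≫ u = u)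
    (h' : s' ≫ u = u) (e : s ≫ s' = 𝟙 T) (e' : s' ≫ s = 𝟙 T) : pullback u p ≅ pullback u p where
  hom := pullbackEnd p u s h
  inv := pullbackEnd p u s' h'
  hom_inv_id := by apply pullback.hom_ext <;> simp [e]
  inv_hom_id := by apply pullback.hom_ext <;> simp [e']

lemma pullbackEnd_fst_inv {P S T : C} (p : P ⟶ S) (u : T ⟶ S) (s : T ⟶ T) (s' : T ⟶ T)
    (h : s ≫ u = u) (e : s ≫ s' = 𝟙 T) :
    pullbackEnd p u s h ≫ pullback.fst u p ≫ s' = pullback.fst u p := by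
  simp [e]

lemma pullbackEnd_map {P Q S T : C} {p : P ⟶ S} {q : Q ⟶ S} (u : T ⟶ S) (s : T ⟶ T)
    (h : s ≫ u = u) (f : P ⟶ Q) (hf : f ≫ q = p) :
    pullbackEnd p u s h ≫ pullbackMap u f hf = pullbackMap u f hf ≫ pullbackEnd q u s h := by
  apply pullback.hom_ext <;> simp

lemma comp_eq_of_eq {C : Type*} [Category C] {P Q S T : C} {p : P ⟶ S} {q : Q ⟶ S} (e : P ⟶ Q) (h : e ≫ q = p)
    (s : S ⟶ T) : e ≫ q ≫ s = p ≫ s := by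
  rw [← Category.assoc, h]

end Pullback

section Equivariance

variable {C : Type*} [Category C] [CartesianMonoidalCategory C] [HasPullbacks C]
  (G : C) [GrpObj G]

lemma pullbackMap_equivariant {P Q S T : C} [ModObj G P] [ModObj G Q] {p : P ⟶ S} {q : Q ⟶ S}
    (u : T ⟶ S) (hp : act G P ≫ p = snd G P ≫ p) (hq : act G Q ≫ q = snd G Q ≫ q)
    (f : P ⟶ Q) (h : f ≫ q = p) (hf : act G P ≫ f = G ◁ f ≫ act G Q) :
    pullbackAct G p u hp ≫ pullbackMap u f h = G ◁ pullbackMap u f h ≫ pullbackAct G q u hq := by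
  apply pullback.hom_ext
  · simp
  · simp only [Category.assoc, pullbackMap_snd, pullbackAct_snd, pullbackAct_snd_assoc, hf,
      ← whiskerLeft_comp_assoc]

lemma pullbackAct_snd_comp {P S T X : C} [ModObj G P] [ModObj G X] (p : P ⟶ S) (u : T ⟶ S)
    (h : act G P ≫ p = snd G P ≫ p) (f : P ⟶ X) (hf : act G P ≫ f = G ◁ f ≫ act G X) :
    pullbackAct G p u h ≫ pullback.snd u p ≫ f = G ◁ (pullback.snd u p ≫ f) ≫ act G X := by
  rw [pullbackAct_snd_assoc, hf]
  simp

lemma act_comp_id {C : Type*} [Category C] [CartesianMonoidalCategory C] (G : C) [GrpObj G]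
    (P : C) [ModObj G P] : act G P ≫ 𝟙 P = G ◁ 𝟙 P ≫ act G P := by
  simp

lemma pullbackEnd_equivariant {P S T : C} [ModObj G P] (p : P ⟶ S) (u : T ⟶ S) (s : T ⟶ T)
    (h : s ≫ u = u) (hp : act G P ≫ p = snd G P ≫ p) :
    pullbackAct G p u hp ≫ pullbackEnd p u s h =
      G ◁ pullbackEnd p u s h ≫ pullbackAct G p u hp := by
  apply pullback.hom_ext
  · simp
  · simp only [Category.assoc, pullbackEnd_snd, pullbackAct_snd, ← whiskerLeft_comp_assoc]

end Equivariance

variable (G : SchR) [GrpObj G] (X : SchR) [ModObj G X]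

/-- An étale-locally trivial `G`-torsor `p : P ⟶ S` over a real scheme `S`: a scheme `P` with
`G`-action such that `(g, x) ↦ (g · x, x)` is an isomorphism `G × P ≅ P ×_S P` over `S`, and such
that there are an étale covering `u : S' ⟶ S` and a `G`-equivariant isomorphism
`G × S' ≅ P ×_S S'` over `S'`, where `G` acts by left multiplication on the left-hand side. -/
structure Torsor (S : SchR) : Type 1 where
  /-- the total space -/
  P : SchR
  /-- the action of `G` on the total space -/
  [action : ModObj G P]
  /-- the projection to the base -/
  p : P ⟶ S
  isPullback_act : IsPullback (act G P) (snd G P) p p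
  locally_trivial : ∃ (S' : SchR) (u : S' ⟶ S) (t : G ⊗ S' ⟶ P),
    Etale u.left ∧ Surjective u.left ∧
    MonObj.mul (X := G) ▷ S' ≫ t = (α_ G G S').hom ≫ G ◁ t ≫ act G P ∧
    IsPullback t (snd G S') p u

attribute [instance] Torsor.action

variable {G}

namespace Torsor

/-- Isomorphisms of `G`-torsors over `S`: `G`-equivariant isomorphisms over `S`. -/
@[ext]
structure Hom {S : SchR} (P Q : Torsor G S) where
  /-- the underlying isomorphism of total spaces -/
  iso : P.P ≅ Q.P
  equivariant : act G P.P ≫ iso.hom = G ◁ iso.hom ≫ act G Q.P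
  comp_p : iso.hom ≫ Q.p = P.p

/-- The topology of pointwise convergence on complex points. -/
instance {S : SchR} (P Q : Torsor G S) : TopologicalSpace (Hom P Q) :=
  TopologicalSpace.induced (fun φ => φ.iso.hom) (pointwiseTopology P.P Q.P)

/-- The base change `T ×_S P ⟶ T` of a torsor `P ⟶ S` along `u : T ⟶ S`. -/
def baseChange {S T : SchR} (u : T ⟶ S) (P : Torsor G S) : Torsor G T :=
  letI := pullbackAction G P.p u P.isPullback_act.w
  { P := pullback u P.p
    p := pullback.fst u P.p
    isPullback_act := by
      have h := (isPullback_whiskerLeft_snd G (pullback.snd u P.p)).paste_horiz P.isPullback_act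
      rw [← pullbackAct_snd G P.p u P.isPullback_act.w, ← pullback.condition] at h
      exact IsPullback.of_right h
        (pullbackAct_fst G P.p u P.isPullback_act.w)
        (IsPullback.of_hasPullback u P.p).flip
    locally_trivial := by
      obtain ⟨S', v, t, hv₁, hv₂, ht, hP⟩ := P.locally_trivial
      have hsq := (IsPullback.of_hasPullback u v).map (Over.forget _)
      let t' : G ⊗ pullback u v ⟶ pullback u P.p :=
        pullback.lift (snd G _ ≫ pullback.fst u v) (G ◁ pullback.snd u v ≫ t) (by
          rw [Category.assoc, Category.assoc, hP.w, whiskerLeft_snd_assoc, pullback.condition])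
      have ht'₁ : t' ≫ pullback.fst u P.p = snd G _ ≫ pullback.fst u v := pullback.lift_fst _ _ _
      have ht'₂ : t' ≫ pullback.snd u P.p = G ◁ pullback.snd u v ≫ t := pullback.lift_snd _ _ _
      refine ⟨pullback u v, pullback.fst u v, t',
        MorphismProperty.of_isPullback hsq.flip hv₁,
        MorphismProperty.of_isPullback (P := @Surjective) hsq.flip hv₂, ?_, ?_⟩
      · change _ = _ ≫ _ ≫ pullbackAct G P.p u P.isPullback_act.w
        apply pullback.hom_ext
        · simp [ht'₁]
        · rw [Category.assoc, ht'₂, ← whisker_exchange_assoc, ht]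
          simp only [Category.assoc, pullbackAct_snd]
          rw [← whiskerLeft_comp_assoc, ht'₂]
          simp
      · have h := (isPullback_whiskerLeft_snd G (pullback.snd u v)).paste_horiz hP
        rw [← ht'₂, ← pullback.condition] at h
        exact IsPullback.of_right h ht'₁ (IsPullback.of_hasPullback u P.p).flip }

/-- The torsor over `T` obtained by composing the structure morphism of a torsor over `S` with an
isomorphism `s : S ⟶ T`; the total space and the action do not change. -/
def postcomp {S T : SchR} (s : S ⟶ T) [IsIso s] (P : Torsor G S) : Torsor G T where
  P := P.P
  p := P.p ≫ s
  isPullback_act :=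
    P.isPullback_act.of_iso (Iso.refl _) (Iso.refl _) (Iso.refl _) (asIso s)
      (by simp) (by simp) (by simp) (by simp)
  locally_trivial := by
    obtain ⟨S', v, t, hv₁, hv₂, ht, hP⟩ := P.locally_trivial
    have : IsIso s.left := inferInstanceAs (IsIso ((Over.forget _).map s))
    refine ⟨S', v ≫ s, t, ?_, ?_, ht, ?_⟩
    · exact (inferInstance : Etale (v.left ≫ s.left))
    · exact (inferInstance : Surjective (v.left ≫ s.left))
    · exact hP.of_iso (Iso.refl _) (Iso.refl _) (Iso.refl _) (asIso s)
        (by simp) (by simp) (by simp) (by simp)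

/-- The torsor `γ . P` for `γ` in the Galois group: the same scheme with the same action, and with
structure morphism `P ⟶ Spec ℂ` composed with the inverse of `Spec γ`. -/
def twist (γ : C2) (P : Torsor G specC) : Torsor G specC := P.postcomp (specGal γ⁻¹)

lemma twist_p (γ : C2) (P : Torsor G specC) : (twist γ P).p = P.p ≫ specGal γ⁻¹ := rfl

lemma twist_mul_p (γ δ : C2) (P : Torsor G specC) :
    𝟙 P.P ≫ (twist (γ * δ) P).p = (twist γ (twist δ P)).p := by
  rw [twist_p, twist_p, twist_p, mul_inv_rev, specGal_mul]
  exact (Category.id_comp _).trans (Category.assoc _ _ _).symm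

lemma twist_one_p (P : Torsor G specC) : 𝟙 P.P ≫ (twist 1 P).p = P.p := by
  rw [twist_p, inv_one, specGal_one]
  exact (Category.id_comp _).trans (Category.comp_id _)

/-- The twisted torsor `γ . P` is the pullback of `P` along `Spec γ`. -/
lemma twist_isPullback (γ : C2) (P : Torsor G specC) :
    IsPullback (𝟙 P.P) (twist γ P).p P.p (specGal γ) := by
  refine IsPullback.of_horiz_isIso ⟨?_⟩
  rw [twist_p, Category.assoc, specGal_inv_comp, Category.comp_id]
  exact Category.id_comp _

end Torsor

variable (G)

/-- The set of `G`-equivariant morphisms `P ⟶ X`. -/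
def EquivariantMap (P X : SchR) [ModObj G P] [ModObj G X] : Type :=
  {f : P ⟶ X // act G P ≫ f = G ◁ f ≫ act G X}

/-- The topology of pointwise convergence on complex points. If `P` is a torsor over `Spec ℝ` or
`Spec ℂ`, then `f ↦ f(y)` is injective on equivariant maps for every `y ∈ P(ℂ)`, and this is the
subspace topology from `X(ℂ)`. -/
instance (P X : SchR) [ModObj G P] [ModObj G X] : TopologicalSpace (EquivariantMap G P X) :=
  TopologicalSpace.induced (fun f => f.1) (pointwiseTopology P X)

/-- The objects of the groupoid `[G\X](S)`: spans `S ⟵ P ⟶ X` of a `G`-torsor `P` over `S` and a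
`G`-equivariant morphism `P ⟶ X`. -/
structure Points (S : SchR) : Type 1 where
  /-- the torsor -/
  torsor : Torsor G S
  /-- the equivariant morphism to `X` -/
  map : torsor.P ⟶ X
  equivariant : act G torsor.P ≫ map = G ◁ map ≫ act G X

variable {G X}

namespace Points

variable {S : SchR}

/-- The equivariant morphism to `X`, as an element of the set of equivariant morphisms. -/
def equivariantMap (x : Points G X S) : EquivariantMap G x.torsor.P X := ⟨x.map, x.equivariant⟩

/-- The space of objects of `[G\X](S)` is the disjoint union, over all torsors `P`, of the spaces
of equivariant maps `P ⟶ X`. -/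
instance : TopologicalSpace (Points G X S) :=
  TopologicalSpace.induced
    (fun x => (⟨x.torsor, x.equivariantMap⟩ : Σ P : Torsor G S, EquivariantMap G P.P X))
    inferInstance

/-- Morphisms in `[G\X](S)`: `G`-equivariant isomorphisms over `S` commuting with the maps
to `X`. -/
@[ext]
structure Hom (x y : Points G X S) where
  /-- the underlying isomorphism of torsors -/
  toHom : Torsor.Hom x.torsor y.torsor
  comm : toHom.iso.hom ≫ y.map = x.map

instance : Category (Points G X S) where
  Hom := Hom
  id x := ⟨⟨Iso.refl _, by simp, by simp⟩, by simp⟩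
  comp f g := ⟨⟨f.toHom.iso ≪≫ g.toHom.iso, by
      simp only [Iso.trans_hom]
      rw [← Category.assoc, f.toHom.equivariant, Category.assoc, g.toHom.equivariant]
      simp, by
      simp [g.toHom.comp_p, f.toHom.comp_p]⟩, by
      simp [g.comm, f.comm]⟩
  id_comp f := Hom.ext (Torsor.Hom.ext (Iso.ext (Category.id_comp _)))
  comp_id f := Hom.ext (Torsor.Hom.ext (Iso.ext (Category.comp_id _)))
  assoc f g h := Hom.ext (Torsor.Hom.ext (Iso.ext (Category.assoc _ _ _)))

/-- The underlying isomorphism of torsors of a morphism in `[G\X](S)`. -/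
def torsorIso {x y : Points G X S} (f : x ⟶ y) : Torsor.Hom x.torsor y.torsor := Hom.toHom f

/-- The underlying morphism of total spaces of a morphism in `[G\X](S)`. -/
def total {x y : Points G X S} (f : x ⟶ y) : x.torsor.P ⟶ y.torsor.P := (torsorIso f).iso.hom

lemma total_comp_map {x y : Points G X S} (f : x ⟶ y) : total f ≫ y.map = x.map := Hom.comm f

lemma hom_ext {x y : Points G X S} {f g : x ⟶ y} (h : total f = total g) : f = g :=
  Hom.ext (Torsor.Hom.ext (Iso.ext h))

@[simp] lemma total_id (x : Points G X S) : total (𝟙 x) = 𝟙 x.torsor.P := rfl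

@[simp] lemma total_comp {x y z : Points G X S} (f : x ⟶ y) (g : y ⟶ z) :
    total (f ≫ g) = total f ≫ total g := rfl

instance : Groupoid (Points G X S) where
  inv f := ⟨⟨(torsorIso f).iso.symm, by
      have h := (torsorIso f).equivariant
      rw [Iso.symm_hom, Iso.comp_inv_eq, Category.assoc, h, ← whiskerLeft_comp_assoc]
      simp, by
      rw [Iso.symm_hom, Iso.inv_comp_eq, (torsorIso f).comp_p]⟩, by
      rw [Iso.symm_hom, Iso.inv_comp_eq]
      exact (total_comp_map f).symm⟩
  inv_comp f := Hom.ext (Torsor.Hom.ext (Iso.ext (Iso.inv_hom_id _)))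
  comp_inv f := Hom.ext (Torsor.Hom.ext (Iso.ext (Iso.hom_inv_id _)))

/-- The space of morphisms of `[G\X](S)` is the disjoint union, over pairs of torsors `(P, Q)`, of
subspaces of `Iso(P, Q) × Map_G(P, X) × Map_G(Q, X)`. -/
instance : TopologicalSpace (Arrow (Points G X S)) :=
  TopologicalSpace.induced
    (fun a => (⟨(a.left.torsor, a.right.torsor),
        (torsorIso a.hom, a.left.equivariantMap, a.right.equivariantMap)⟩ :
      Σ PQ : Torsor G S × Torsor G S,
        Torsor.Hom PQ.1 PQ.2 × EquivariantMap G PQ.1.P X × EquivariantMap G PQ.2.P X))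
    inferInstance

/-- The restriction functor `[G\X](S) ⥤ [G\X](T)` along `u : T ⟶ S`, sending `S ⟵ P ⟶ X` to
`T ⟵ T ×_S P ⟶ P ⟶ X`. -/
def restrict {S T : SchR} (u : T ⟶ S) : Points G X S ⥤ Points G X T where
  obj x :=
    { torsor := x.torsor.baseChange u
      map := pullback.snd u x.torsor.p ≫ x.map
      equivariant := pullbackAct_snd_comp G _ u x.torsor.isPullback_act.w x.map x.equivariant }
  map {x _} f :=
    ⟨⟨pullbackMapIso u (torsorIso f).iso (torsorIso f).comp_p,
      pullbackMap_equivariant G u _ _ _ (torsorIso f).comp_p (torsorIso f).equivariant,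
      pullbackMap_fst _ _ (torsorIso f).comp_p⟩,
      (pullbackMap_snd_assoc u _ (torsorIso f).comp_p _).trans
        (congrArg (pullback.snd u x.torsor.p ≫ ·) (total_comp_map f))⟩
  map_id x := hom_ext (pullbackMap_eq_id u (torsorIso (𝟙 x)).comp_p)
  map_comp f g := hom_ext (pullbackMap_comp u _ _ (torsorIso f).comp_p (torsorIso g).comp_p
    (torsorIso (f ≫ g)).comp_p)

/-- The functor by which `γ` in the Galois group acts on `[G\X](ℂ)`, sending
`Spec ℂ ⟵ P ⟶ X` to `Spec ℂ ⟵ γ . P ⟶ X`; this is the pullback along `Spec γ`. -/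
def twist (γ : C2) : Points G X specC ⥤ Points G X specC where
  obj x := ⟨x.torsor.twist γ, x.map, x.equivariant⟩
  map {x y} f := ⟨⟨(torsorIso f).iso, (torsorIso f).equivariant, by
    exact comp_eq_of_eq _ (torsorIso f).comp_p (specGal γ⁻¹)⟩, total_comp_map f⟩
  map_id x := hom_ext rfl
  map_comp f g := hom_ext rfl

lemma total_twist_map (γ : C2) {x y : Points G X specC} (f : x ⟶ y) :
    total ((twist γ).map f) = total f := rfl

/-- The isomorphism in `[G\X](S)` given by an isomorphism of total spaces. -/
def mkIso {x y : Points G X S} (e : x.torsor.P ≅ y.torsor.P)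
    (h₁ : act G x.torsor.P ≫ e.hom = G ◁ e.hom ≫ act G y.torsor.P)
    (h₂ : e.hom ≫ y.torsor.p = x.torsor.p) (h₃ : e.hom ≫ y.map = x.map) : x ≅ y :=
  (Groupoid.isoEquivHom x y).symm ⟨⟨e, h₁, h₂⟩, h₃⟩

lemma total_mkIso {x y : Points G X S} (e : x.torsor.P ≅ y.torsor.P)
    (h₁ : act G x.torsor.P ≫ e.hom = G ◁ e.hom ≫ act G y.torsor.P)
    (h₂ : e.hom ≫ y.torsor.p = x.torsor.p) (h₃ : e.hom ≫ y.map = x.map) :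
    total (mkIso e h₁ h₂ h₃).hom = e.hom := rfl

/-- The comparison `γ . (δ . x) ≅ (γ δ) . x`, given by the identity of the total space. -/
def twistMul (γ δ : C2) (x : Points G X specC) :
    (twist γ).obj ((twist δ).obj x) ≅ (twist (γ * δ)).obj x :=
  mkIso (Iso.refl x.torsor.P) (act_comp_id G x.torsor.P)
    (Torsor.twist_mul_p γ δ x.torsor) (Category.id_comp x.map)

/-- The comparison `x ≅ 1 . x`, given by the identity of the total space. -/
def twistOne (x : Points G X specC) : x ≅ (twist 1).obj x :=
  mkIso (Iso.refl x.torsor.P) (act_comp_id G x.torsor.P)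
    (Torsor.twist_one_p x.torsor) (Category.id_comp x.map)

lemma total_eqToHom {γ δ : C2} (h : γ = δ) (x : Points G X specC)
    (h' : (twist γ).obj x = (twist δ).obj x) : total (eqToHom h') = 𝟙 x.torsor.P := by
  subst h
  exact congrArg total (eqToHom_refl _ h')

lemma twistMul_naturality (γ δ : C2) {x y : Points G X specC} (f : x ⟶ y) :
    (twist γ).map ((twist δ).map f) ≫ (twistMul γ δ y).hom =
      (twistMul γ δ x).hom ≫ (twist (γ * δ)).map f := by
  apply hom_ext
  change total f ≫ 𝟙 y.torsor.P = 𝟙 x.torsor.P ≫ total f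
  rw [Category.comp_id, Category.id_comp]

lemma twistOne_naturality {x y : Points G X specC} (f : x ⟶ y) :
    f ≫ (twistOne y).hom = (twistOne x).hom ≫ (twist 1).map f := by
  apply hom_ext
  change total f ≫ 𝟙 y.torsor.P = 𝟙 x.torsor.P ≫ total f
  rw [Category.comp_id, Category.id_comp]

lemma twistMul_assoc (γ δ θ : C2) (x : Points G X specC)
    (h : (twist (γ * (δ * θ))).obj x = (twist (γ * δ * θ)).obj x) :
    (twistMul γ δ ((twist θ).obj x)).hom ≫ (twistMul (γ * δ) θ x).hom =
      (twist γ).map (twistMul δ θ x).hom ≫ (twistMul γ (δ * θ) x).hom ≫ eqToHom h := by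
  apply hom_ext
  have e := total_eqToHom (mul_assoc γ δ θ).symm x h
  rw [total_comp, total_comp, total_comp, e]
  change 𝟙 x.torsor.P ≫ 𝟙 x.torsor.P = 𝟙 x.torsor.P ≫ 𝟙 x.torsor.P ≫ 𝟙 x.torsor.P
  simp only [Category.comp_id]

lemma twist_one_left (γ : C2) (x : Points G X specC)
    (h : (twist γ).obj x = (twist (1 * γ)).obj x) :
    (twistOne ((twist γ).obj x)).hom ≫ (twistMul 1 γ x).hom = eqToHom h := by
  apply hom_ext
  have e := total_eqToHom (one_mul γ).symm x h
  rw [total_comp, e]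
  change 𝟙 x.torsor.P ≫ 𝟙 x.torsor.P = 𝟙 x.torsor.P
  simp only [Category.comp_id]

lemma twist_one_right (γ : C2) (x : Points G X specC)
    (h : (twist γ).obj x = (twist (γ * 1)).obj x) :
    (twist γ).map (twistOne x).hom ≫ (twistMul γ 1 x).hom = eqToHom h := by
  apply hom_ext
  have e := total_eqToHom (mul_one γ).symm x h
  rw [total_comp, e]
  change 𝟙 x.torsor.P ≫ 𝟙 x.torsor.P = 𝟙 x.torsor.P
  simp only [Category.comp_id]

variable (G X) in
/-- The action of `C₂ = Gal(ℂ/ℝ)` on the complex points `[G\X](ℂ)` by complex conjugation. -/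
def galoisAction : GroupAction C2 (Points G X specC) where
  F := twist
  η γ δ := NatIso.ofComponents (twistMul γ δ) (twistMul_naturality γ δ)
  ε := NatIso.ofComponents twistOne twistOne_naturality
  assoc γ δ θ x := twistMul_assoc γ δ θ x _
  one_left γ x := twist_one_left γ x _
  one_right γ x := twist_one_right γ x _

/-- The canonical isomorphism `P_ℂ ≅ γ . P_ℂ` for a torsor `P` over `Spec ℝ` (and an equivariant map
`P ⟶ X`), where `P_ℂ = Spec ℂ ×_{Spec ℝ} P`: it is given by `Spec γ × id`. -/
def conj (γ : C2) (x : Points G X specR) :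
    (restrict specCToR).obj x ≅ (twist γ).obj ((restrict specCToR).obj x) :=
  mkIso (pullbackAut x.torsor.p specCToR (specGal γ) (specGal γ⁻¹) (specGal_comp γ)
      (specGal_comp γ⁻¹) (specGal_comp_inv γ) (specGal_inv_comp γ))
    (pullbackEnd_equivariant G _ _ _ (specGal_comp γ) x.torsor.isPullback_act.w)
    (pullbackEnd_fst_inv _ _ _ _ (specGal_comp γ) (specGal_comp_inv γ))
    (pullbackEnd_snd_assoc _ _ _ (specGal_comp γ) _)

lemma total_conj (γ : C2) (x : Points G X specR) :
    total (conj γ x).hom = pullbackEnd x.torsor.p specCToR (specGal γ) (specGal_comp γ) := rfl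

variable (G X) in
/-- The complexification functor `[G\X](ℝ) ⥤ [G\X](ℂ)^{hC₂}`: it sends `(P, f)` to its restriction
`(P_ℂ, P_ℂ ⟶ P ⟶ X)` along `Spec ℂ ⟶ Spec ℝ`, with the homotopy fixed point datum given by complex
conjugation on `P_ℂ`. -/
def complexification : Points G X specR ⥤ HFix (galoisAction G X) where
  obj x :=
    { obj := (restrict specCToR).obj x
      φ := fun γ => conj γ x
      cocycle := fun γ δ => hom_ext (by
        change pullbackEnd _ _ _ (specGal_comp (γ * δ)) =
          pullbackEnd _ _ _ (specGal_comp γ) ≫ pullbackEnd _ _ _ (specGal_comp δ) ≫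
            𝟙 (pullback specCToR x.torsor.p)
        rw [Category.comp_id, pullbackEnd_comp _ _ _ _ _ _ _ _ (specGal_mul γ δ).symm]) }
  map f := ⟨(restrict specCToR).map f, fun γ =>
    hom_ext (pullbackEnd_map specCToR (specGal γ) (specGal_comp γ) _ (torsorIso f).comp_p)⟩
  map_id x := HFix.Hom.ext ((restrict specCToR).map_id x)
  map_comp f g := HFix.Hom.ext ((restrict specCToR).map_comp f g)

/-- The complexification functor lifts the restriction functor `[G\X](ℝ) ⥤ [G\X](ℂ)`. -/
lemma complexification_forget :
    complexification G X ⋙ HFix.forget (galoisAction G X) = restrict specCToR := rfl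

end Points

end

end RealStack

/-!
Complex points are handled through affine charts. A family of complex points is continuous exactly
when its coordinates in charts are, and more generally one may ask that the coordinates belong to any
ring of germs in which functions that do not vanish are invertible (`IsGermClass`, `Reg`). Such
families are preserved by morphisms of schemes and by fibre products over an affine base. It follows
that `G(ℂ)` is a topological group acting continuously on `X(ℂ)`; since an equivariant map out of a
torsor is determined by one value, families of equivariant maps that converge pointwise can be
composed and inverted continuously (`Torsor.continuous_eval`). Because the spaces of objects and
morphisms are disjoint unions over torsors, a continuous family of either is locally given by fixed
torsors and continuous families of maps (`Points.exists_local_ofMap`, `Points.exists_local_ofHom`),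
which gives the topological groupoids and the continuity of the action.

The complexification functor is an equivalence of categories by Galois descent. The morphism
`P_ℂ ⟶ P` is étale and surjective, hence an effective epimorphism, and two points of `P_ℂ` over the
same point of `P` are locally equal or conjugate; so a morphism out of `P_ℂ` descends if and only if
it is invariant under conjugation (`exists_descent`). Torsors over `Spec ℂ` are trivial because `ℂ` is
separably closed, so they are affine, and a semilinear involution on an affine scheme descends it to
the spectrum of the ring of invariants (`exists_descent_of_isAffine`, `Torsor.exists_descent`).
Every complex point of `P` lifts to `P_ℂ`, so a family of maps is continuous if and only if its
complexification is; this makes the space of morphisms of the real points a fibre product.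

It remains to find local sections (`Points.isTopologicalSubmersion_target`). Fix a real torsor `P` and
an isomorphism `α₀` from `P_ℂ` to the torsor `Q` of a homotopy fixed point. Near this homotopy fixed
point the torsor `Q` does not change, and its involution varies continuously. The automorphism `z` of
`P_ℂ` that compares the varying involution with complex conjugation is close to `1` and satisfies
`σ(z) z = 1`, where `σ` is conjugation by complex conjugation. By the inverse function theorem,
applied in the local coordinates that smoothness provides, elements of `Aut(P_ℂ) ≅ G(ℂ)` near `1` have
a unique square root near `1`, and it varies continuously (`Torsor.hasLocalSqrt_hom`). If `z = h²`,
then `σ(h)` and `h⁻¹` are both square roots of `z⁻¹`, so that `σ(h) = h⁻¹` and `z = σ(h)⁻¹ h` is a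
coboundary (`HasLocalSqrt.exists_coboundary`). Composing `h` with `α₀` gives an isomorphism that is
compatible with the involutions, and the equivariant map to `X` then descends to `P`.
-/

open Topology Filter

namespace RealStack

noncomputable section

/-! ### Complex points in affine charts -/

/-- The map `X(ℂ) → Y(ℂ)` induced by a morphism `X ⟶ Y`. -/
def ComplexPoints.map {X Y : SchR} (f : X ⟶ Y) (x : ComplexPoints X) : ComplexPoints Y :=
  CategoryStruct.comp (obj := SchR) (X := specC) x f

/-- The map `X(ℂ) → X(ℂ)` induced by an `ℝ`-endomorphism of `Spec ℂ`. -/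
def ComplexPoints.precomp {X : SchR} (s : specC ⟶ specC) (x : ComplexPoints X) :
    ComplexPoints X :=
  CategoryStruct.comp (obj := SchR) (X := specC) (Z := X) s x

/-- The morphism of schemes `Spec ℂ ⟶ X` underlying a complex point of `X`. -/
def ComplexPoints.toScheme {X : SchR} (x : ComplexPoints X) : Spec (CommRingCat.of ℂ) ⟶ X.left :=
  let f : specC ⟶ X := x
  f.left

/-- The underlying point of a complex point. -/
def ComplexPoints.pt {X : SchR} (x : ComplexPoints X) : X.left :=
  x.toScheme (IsLocalRing.closedPoint (CommRingCat.of ℂ))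

/-- The complex point `x` lies in the affine chart `j`. -/
def Lies {X : SchR} {A : CommRingCat.{0}} (j : Spec A ⟶ X.left) (x : ComplexPoints X) : Prop :=
  ∃ φ : A ⟶ CommRingCat.of ℂ, Spec.map φ ≫ j = x.toScheme

open Classical in
/-- The value `a(x)` of a function `a` on an affine chart `j` at a complex point `x`; by convention
it is zero if `x` does not lie in the chart. -/
def value {X : SchR} {A : CommRingCat.{0}} (j : Spec A ⟶ X.left) (a : A) (x : ComplexPoints X) :
    ℂ :=
  if h : Lies j x then h.choose.hom a else 0

section Charts

variable {X Y : SchR} {A B : CommRingCat.{0}} (j : Spec A ⟶ X.left) [IsOpenImmersion j]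

lemma value_eq {φ : A ⟶ CommRingCat.of ℂ} {x : ComplexPoints X} (h : Spec.map φ ≫ j = x.toScheme)
    (a : A) : value j a x = φ.hom a := by
  have h' : Lies j x := ⟨φ, h⟩
  have e : h'.choose = φ := by
    apply Spec.map_injective
    rw [← cancel_mono j, h, h'.choose_spec]
  rw [value, dif_pos h', e]

lemma Lies.exists_hom {x : ComplexPoints X} (h : Lies j x) :
    ∃ φ : A ⟶ CommRingCat.of ℂ, Spec.map φ ≫ j = x.toScheme ∧ ∀ a, value j a x = φ.hom a :=
  let ⟨φ, hφ⟩ := h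
  ⟨φ, hφ, value_eq j hφ⟩

lemma value_add {x : ComplexPoints X} (h : Lies j x) (a b : A) :
    value j (a + b) x = value j a x + value j b x := by
  obtain ⟨φ, -, h⟩ := h.exists_hom
  simp [h]

lemma value_mul {x : ComplexPoints X} (h : Lies j x) (a b : A) :
    value j (a * b) x = value j a x * value j b x := by
  obtain ⟨φ, -, h⟩ := h.exists_hom
  simp [h]

lemma ComplexPoints.toScheme_apply (x : ComplexPoints X) (p : Spec (CommRingCat.of ℂ)) :
    x.toScheme p = x.pt := by
  have : Subsingleton (Spec (CommRingCat.of ℂ)) := inferInstanceAs (Subsingleton (PrimeSpectrum ℂ))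
  exact congrArg _ (Subsingleton.elim _ _)

lemma lies_iff (x : ComplexPoints X) : Lies j x ↔ x.pt ∈ Set.range j := by
  constructor
  · rintro ⟨φ, h⟩
    refine ⟨Spec.map φ (IsLocalRing.closedPoint (CommRingCat.of ℂ)), ?_⟩
    rw [ComplexPoints.pt, ← h]
    rfl
  · intro h
    have hr : Set.range x.toScheme ⊆ Set.range j := by
      rintro _ ⟨p, rfl⟩
      rwa [x.toScheme_apply p]
    refine ⟨Spec.preimage (IsOpenImmersion.lift j x.toScheme hr), ?_⟩
    rw [Spec.map_preimage, IsOpenImmersion.lift_fac]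

/-- Every complex point lies in an affine chart inside a prescribed open neighbourhood. -/
lemma exists_chart_le (x : ComplexPoints X) (U : X.left.Opens) (hU : x.pt ∈ U) :
    ∃ (A : CommRingCat.{0}) (j : Spec A ⟶ X.left), IsOpenImmersion j ∧ Lies j x ∧
      Set.range j ⊆ U := by
  obtain ⟨_, ⟨V, hV, rfl⟩, hxV, hVU⟩ :=
    X.left.isBasis_affineOpens.exists_subset_of_mem_open hU U.isOpen
  have hV' : IsAffineOpen V := hV
  refine ⟨Γ(X.left, V), hV'.fromSpec, inferInstance, ?_, ?_⟩
  · rw [lies_iff, hV'.range_fromSpec]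
    exact hxV
  · rw [hV'.range_fromSpec]
    exact hVU

lemma exists_chart (x : ComplexPoints X) :
    ∃ (A : CommRingCat.{0}) (j : Spec A ⟶ X.left), IsOpenImmersion j ∧ Lies j x :=
  let ⟨A, j, hj, hx, _⟩ := exists_chart_le x ⊤ trivial
  ⟨A, j, hj, hx⟩

/-- A point of `Spec A` at which `f` does not vanish has values on `A_f`. -/
lemma exists_away_hom {f : A} (χ : A ⟶ CommRingCat.of ℂ) (hf : χ.hom f ≠ 0) :
    ∃ ψ : CommRingCat.of (Localization.Away f) ⟶ CommRingCat.of ℂ,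
      CommRingCat.ofHom (algebraMap A (Localization.Away f)) ≫ ψ = χ := by
  refine ⟨CommRingCat.ofHom (IsLocalization.Away.lift f (g := χ.hom) hf.isUnit), ?_⟩
  apply CommRingCat.hom_ext
  exact IsLocalization.Away.lift_comp f hf.isUnit

/-- Around a common point of two charts there is a basic open subset of the first that is contained
in the second. -/
lemma exists_basicOpen_subset (j' : Spec B ⟶ X.left) [IsOpenImmersion j'] {x : ComplexPoints X}
    (h : Lies j x) (h' : Lies j' x) :
    ∃ (f : A) (θ : B ⟶ CommRingCat.of (Localization.Away f)), value j f x ≠ 0 ∧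
      Spec.map θ ≫ j' =
        Spec.map (CommRingCat.ofHom (algebraMap A (Localization.Away f))) ≫ j := by
  obtain ⟨φ, hφ, hφv⟩ := h.exists_hom
  have hmem : Spec.map φ (IsLocalRing.closedPoint (CommRingCat.of ℂ)) ∈ j ⁻¹ᵁ j'.opensRange := by
    have := (lies_iff j' x).1 h'
    rw [ComplexPoints.pt, ← hφ] at this
    exact this
  obtain ⟨_, ⟨_, ⟨f, rfl⟩, rfl⟩, hf, hfU⟩ :=
    PrimeSpectrum.isBasis_basic_opens.exists_subset_of_mem_open hmem (j ⁻¹ᵁ j'.opensRange).isOpen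
  let i : Spec (.of (Localization.Away f)) ⟶ Spec A :=
    Spec.map (CommRingCat.ofHom (algebraMap A (Localization.Away f)))
  have hr : Set.range (i ≫ j) ⊆ Set.range j' := by
    rintro _ ⟨p, rfl⟩
    apply hfU
    change PrimeSpectrum.comap (algebraMap A (Localization.Away f)) p ∈
      (PrimeSpectrum.basicOpen f : Set (PrimeSpectrum A))
    rw [← PrimeSpectrum.localization_away_comap_range (Localization.Away f) f]
    exact ⟨p, rfl⟩
  refine ⟨f, Spec.preimage (IsOpenImmersion.lift j' (i ≫ j) hr), ?_, ?_⟩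
  · rw [hφv]
    intro h0
    apply hf
    change φ.hom f ∈ IsLocalRing.maximalIdeal (CommRingCat.of ℂ)
    rw [h0]
    exact zero_mem _
  · rw [Spec.map_preimage, IsOpenImmersion.lift_fac]

/-- Change of charts: near a common point, a function on the chart `j'` is a quotient `b / f ^ n` of
functions on the chart `j`. -/
lemma exists_value_eq_of_lies (j' : Spec B ⟶ X.left) [IsOpenImmersion j'] {x : ComplexPoints X}
    (h : Lies j x) (h' : Lies j' x) :
    ∃ f : A, value j f x ≠ 0 ∧ (∀ y, Lies j y → value j f y ≠ 0 → Lies j' y) ∧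
      ∀ a' : B, ∃ (b : A) (n : ℕ), ∀ y, Lies j y → value j f y ≠ 0 →
        value j' a' y = value j b y * ((value j f y) ^ n)⁻¹ := by
  obtain ⟨f, θ, hf, hθ⟩ := exists_basicOpen_subset j j' h h'
  have key : ∀ y, Lies j y → value j f y ≠ 0 → ∃ ψ : CommRingCat.of (Localization.Away f) ⟶
      CommRingCat.of ℂ, Spec.map (θ ≫ ψ) ≫ j' = y.toScheme ∧
        ∀ a, ψ.hom (algebraMap A (Localization.Away f) a) = value j a y := by
    intro y hy hyf
    obtain ⟨χ, hχ, hχv⟩ := hy.exists_hom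
    rw [hχv] at hyf
    obtain ⟨ψ, hψ⟩ := exists_away_hom χ hyf
    refine ⟨ψ, ?_, ?_⟩
    · rw [Spec.map_comp, Category.assoc, hθ, ← Category.assoc, ← Spec.map_comp, hψ, hχ]
    · intro a
      rw [hχv, ← hψ]
      rfl
  refine ⟨f, hf, fun y hy hyf => ?_, fun a' => ?_⟩
  · obtain ⟨ψ, hψ, -⟩ := key y hy hyf
    exact ⟨_, hψ⟩
  · obtain ⟨n, b, hb⟩ := IsLocalization.Away.surj f (θ.hom a')
    refine ⟨b, n, fun y hy hyf => ?_⟩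
    obtain ⟨ψ, hψ, hψv⟩ := key y hy hyf
    have e := congrArg ψ.hom hb
    rw [map_mul, map_pow, hψv, hψv] at e
    rw [value_eq j' hψ, eq_mul_inv_iff_mul_eq₀ (pow_ne_zero _ hyf), ← e]
    rfl

end Charts

lemma isPullback_left {W X Y S : SchR} {fst : W ⟶ X} {snd : W ⟶ Y} {f : X ⟶ S} {g : Y ⟶ S}
    (h : IsPullback fst snd f g) : IsPullback fst.left snd.left f.left g.left :=
  h.map (Over.forget _)

/-! ### Families of complex points -/

/-- A class of germs of complex valued functions at a point, such as that of the continuous or that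
of the continuously differentiable functions: a ring of germs of continuous functions in which the
germs that do not vanish at the point are invertible. -/
structure IsGermClass {Z : Type*} [TopologicalSpace Z] (z₀ : Z) (D : (Z → ℂ) → Prop) : Prop where
  continuousAt : ∀ {u}, D u → ContinuousAt u z₀
  const : ∀ c, D (fun _ => c)
  add : ∀ {u v}, D u → D v → D (fun z => u z + v z)
  mul : ∀ {u v}, D u → D v → D (fun z => u z * v z)
  inv : ∀ {u}, D u → u z₀ ≠ 0 → D (fun z => (u z)⁻¹)
  congr : ∀ {u v}, D u → u =ᶠ[𝓝 z₀] v → D v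

lemma isGermClass_continuousAt {Z : Type*} [TopologicalSpace Z] (z₀ : Z) :
    IsGermClass z₀ (fun u : Z → ℂ => ContinuousAt u z₀) where
  continuousAt h := h
  const _ := continuousAt_const
  add h h' := h.add h'
  mul h h' := h.mul h'
  inv h h' := h.inv₀ h'
  congr h h' := h.congr h'

lemma IsGermClass.pow {Z : Type*} [TopologicalSpace Z] {z₀ : Z} {D : (Z → ℂ) → Prop}
    (hD : IsGermClass z₀ D) {u : Z → ℂ} (hu : D u) (n : ℕ) : D (fun z => u z ^ n) := by
  induction n with
  | zero => simpa using hD.const 1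
  | succ n ih => simpa [pow_succ] using hD.mul ih hu

/-- The family `F` of complex points belongs to the germ class `D` at `z₀`: for every affine chart
around `F z₀` it stays in the chart near `z₀`, and its coordinates belong to `D`. -/
def Reg {Z : Type*} [TopologicalSpace Z] (z₀ : Z) (D : (Z → ℂ) → Prop) {X : SchR}
    (F : Z → ComplexPoints X) : Prop :=
  ∀ (A : CommRingCat.{0}) (j : Spec A ⟶ X.left) (_ : IsOpenImmersion j), Lies j (F z₀) →
    (∀ᶠ z in 𝓝 z₀, Lies j (F z)) ∧ ∀ a, D (fun z => value j a (F z))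

section Reg

variable {Z : Type*} [TopologicalSpace Z] {z₀ : Z} {D : (Z → ℂ) → Prop} (hD : IsGermClass z₀ D)
  {X Y W S : SchR}

include hD

/-- It suffices to consider a single chart. -/
lemma reg_of_chart {F : Z → ComplexPoints X} {A : CommRingCat.{0}} (j : Spec A ⟶ X.left)
    [IsOpenImmersion j] (h : ∀ᶠ z in 𝓝 z₀, Lies j (F z))
    (hF : ∀ a, D (fun z => value j a (F z))) : Reg z₀ D F := by
  intro B j' _ h'
  obtain ⟨f, hf₀, hf, hb⟩ := exists_value_eq_of_lies j j' h.self_of_nhds h'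
  have hne : ∀ᶠ z in 𝓝 z₀, value j f (F z) ≠ 0 := (hD.continuousAt (hF f)).eventually_ne hf₀
  refine ⟨?_, fun a' => ?_⟩
  · filter_upwards [h, hne] with z hz hz' using hf _ hz hz'
  · obtain ⟨b, n, hbn⟩ := hb a'
    refine hD.congr (hD.mul (hF b) (hD.inv (hD.pow (hF f) n) (pow_ne_zero _ hf₀))) ?_
    filter_upwards [h, hne] with z hz hz' using (hbn _ hz hz').symm

lemma Reg.comp_hom {F : Z → ComplexPoints X} (hF : Reg z₀ D F) (f : X ⟶ Y) :
    Reg z₀ D (fun z => (F z).map f) := by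
  obtain ⟨B, jY, _, hY⟩ := exists_chart ((F z₀).map f)
  obtain ⟨A, jX, _, hX, hle⟩ := exists_chart_le (F z₀) (f.left ⁻¹ᵁ jY.opensRange)
    ((lies_iff jY _).1 hY)
  have hr : Set.range (jX ≫ f.left) ⊆ Set.range jY := by
    rintro _ ⟨p, rfl⟩
    exact hle ⟨p, rfl⟩
  let θ := Spec.preimage (IsOpenImmersion.lift jY (jX ≫ f.left) hr)
  have hθ : Spec.map θ ≫ jY = jX ≫ f.left := by
    rw [Spec.map_preimage, IsOpenImmersion.lift_fac]
  have key : ∀ (x : ComplexPoints X) (φ : A ⟶ CommRingCat.of ℂ), Spec.map φ ≫ jX = x.toScheme →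
      Spec.map (θ ≫ φ) ≫ jY = (x.map f).toScheme := by
    intro x φ h
    rw [Spec.map_comp, Category.assoc, hθ, ← Category.assoc, h]
    rfl
  obtain ⟨hev, hv⟩ := hF A jX inferInstance hX
  refine reg_of_chart hD jY ?_ fun b => ?_
  · filter_upwards [hev] with z ⟨φ, hφ⟩ using ⟨_, key _ φ hφ⟩
  · refine hD.congr (hv (θ.hom b)) ?_
    filter_upwards [hev] with z ⟨φ, hφ⟩
    rw [value_eq jX hφ, value_eq jY (key _ φ hφ)]
    rfl

/-- A family of complex points of a fibre product over an affine scheme belongs to a germ class if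
both of its components do. -/
lemma Reg.of_isPullback {fst : W ⟶ X} {snd : W ⟶ Y} {f : X ⟶ S} {g : Y ⟶ S} [IsAffine S.left]
    (h : IsPullback fst snd f g) {F : Z → ComplexPoints W}
    (hX : Reg z₀ D (fun z => (F z).map fst))
    (hY : Reg z₀ D (fun z => (F z).map snd)) :
    Reg z₀ D F := by
  have hp := isPullback_left h
  obtain ⟨A, jA, _, hA⟩ := exists_chart ((F z₀).map fst)
  obtain ⟨B, jB, _, hB⟩ := exists_chart ((F z₀).map snd)
  let C := Γ(S.left, ⊤)
  let e : S.left ≅ Spec C := S.left.isoSpec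
  let α : C ⟶ A := Spec.preimage (jA ≫ f.left ≫ e.hom)
  let β : C ⟶ B := Spec.preimage (jB ≫ g.left ≫ e.hom)
  have hα : Spec.map α = jA ≫ f.left ≫ e.hom := Spec.map_preimage _
  have hβ : Spec.map β = jB ≫ g.left ≫ e.hom := Spec.map_preimage _
  have hpo := (IsPushout.of_hasPushout α β)
  have hT := isPullback_SpecMap_of_isPushout _ _ _ _ hpo
  let T := pushout α β
  let a : A ⟶ T := pushout.inl α β
  let b : B ⟶ T := pushout.inr α β
  have hw : (Spec.map a ≫ jA) ≫ f.left = (Spec.map b ≫ jB) ≫ g.left := by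
    rw [← cancel_mono e.hom]
    simp only [Category.assoc]
    rw [← hα, ← hβ]
    exact hT.w
  let j : Spec T ⟶ W.left := hp.lift (Spec.map a ≫ jA) (Spec.map b ≫ jB) hw
  have hj₁ : j ≫ fst.left = Spec.map a ≫ jA := hp.lift_fst _ _ _
  have hj₂ : j ≫ snd.left = Spec.map b ≫ jB := hp.lift_snd _ _ _
  have hjo : IsOpenImmersion j := by
    have hα' : Spec.map α ≫ e.inv = jA ≫ f.left := by rw [hα]; simp
    have hβ' : Spec.map β ≫ e.inv = jB ≫ g.left := by rw [hβ]; simp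
    let m := pullback.map (Spec.map α) (Spec.map β) f.left g.left jA jB e.inv hα' hβ'
    have hm : IsOpenImmersion m := inferInstance
    have hm₁ : m ≫ pullback.fst _ _ = pullback.fst _ _ ≫ jA := pullback.lift_fst _ _ _
    have hm₂ : m ≫ pullback.snd _ _ = pullback.snd _ _ ≫ jB := pullback.lift_snd _ _ _
    have e' : j = (hT.isoPullback.hom ≫ m) ≫ hp.isoPullback.inv := by
      apply hp.hom_ext
      · rw [Category.assoc, Category.assoc, hp.isoPullback_inv_fst, hm₁,
          hT.isoPullback_hom_fst_assoc, hj₁]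
      · rw [Category.assoc, Category.assoc, hp.isoPullback_inv_snd, hm₂,
          hT.isoPullback_hom_snd_assoc, hj₂]
    rw [e']
    infer_instance
  have key : ∀ (w : ComplexPoints W) (φ : A ⟶ CommRingCat.of ℂ) (ψ : B ⟶ CommRingCat.of ℂ),
      Spec.map φ ≫ jA = (w.map fst).toScheme →
      Spec.map ψ ≫ jB = (w.map snd).toScheme →
      ∃ χ : T ⟶ CommRingCat.of ℂ, a ≫ χ = φ ∧ b ≫ χ = ψ ∧ Spec.map χ ≫ j = w.toScheme := by
    intro w φ ψ hφ hψ
    have hw' : α ≫ φ = β ≫ ψ := by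
      apply Spec.map_injective
      have hφ' : Spec.map φ ≫ jA = w.toScheme ≫ fst.left := hφ
      have hψ' : Spec.map ψ ≫ jB = w.toScheme ≫ snd.left := hψ
      have h₃ := isPullback_left h |>.w
      rw [Spec.map_comp, Spec.map_comp, hα, hβ, reassoc_of% hφ', reassoc_of% hψ',
        reassoc_of% h₃]
    refine ⟨hpo.desc φ ψ hw', hpo.inl_desc _ _ _, hpo.inr_desc _ _ _, ?_⟩
    apply hp.hom_ext
    · rw [Category.assoc, hj₁, ← Category.assoc, ← Spec.map_comp, hpo.inl_desc, hφ]
      rfl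
    · rw [Category.assoc, hj₂, ← Category.assoc, ← Spec.map_comp, hpo.inr_desc, hψ]
      rfl
  obtain ⟨hA₁, hA₂⟩ := hX A jA inferInstance hA
  obtain ⟨hB₁, hB₂⟩ := hY B jB inferInstance hB
  have hlies : ∀ᶠ z in 𝓝 z₀, Lies j (F z) := by
    filter_upwards [hA₁, hB₁] with z ⟨φ, hφ⟩ ⟨ψ, hψ⟩
    obtain ⟨χ, -, -, hχ⟩ := key _ φ ψ hφ hψ
    exact ⟨χ, hχ⟩
  refine reg_of_chart hD j hlies ?_
  -- the functions whose values along the family belong to `D` form a subring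
  let R : Subring T :=
    { carrier := {t | D (fun z => value j t (F z))}
      mul_mem' := fun {s t} hs ht => hD.congr (hD.mul hs ht) <| by
        filter_upwards [hlies] with z hz using (value_mul j hz s t).symm
      add_mem' := fun {s t} hs ht => hD.congr (hD.add hs ht) <| by
        filter_upwards [hlies] with z hz using (value_add j hz s t).symm
      one_mem' := hD.congr (hD.const 1) <| by
        filter_upwards [hlies] with z hz
        obtain ⟨φ, -, h⟩ := hz.exists_hom
        simp [h]
      zero_mem' := hD.congr (hD.const 0) <| by
        filter_upwards [hlies] with z hz
        obtain ⟨φ, -, h⟩ := hz.exists_hom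
        simp [h]
      neg_mem' := fun {s} hs => hD.congr (hD.mul (hD.const (-1)) hs) <| by
        filter_upwards [hlies] with z hz
        obtain ⟨φ, -, h⟩ := hz.exists_hom
        simp [h] }
  have hRa : ∀ s : A, a.hom s ∈ R := by
    intro s
    refine hD.congr (hA₂ s) ?_
    filter_upwards [hA₁, hB₁] with z ⟨φ, hφ⟩ ⟨ψ, hψ⟩
    obtain ⟨χ, h₁, h₂, hχ⟩ := key _ φ ψ hφ hψ
    rw [value_eq jA hφ, value_eq j hχ, ← h₁]
    rfl
  have hRb : ∀ s : B, b.hom s ∈ R := by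
    intro s
    refine hD.congr (hB₂ s) ?_
    filter_upwards [hA₁, hB₁] with z ⟨φ, hφ⟩ ⟨ψ, hψ⟩
    obtain ⟨χ, h₁, h₂, hχ⟩ := key _ φ ψ hφ hψ
    rw [value_eq jB hψ, value_eq j hχ, ← h₂]
    rfl
  -- it is everything, because the fibre product is generated by its two factors
  have hR : ∀ t : T, t ∈ R := by
    let ι : CommRingCat.of R ⟶ T := CommRingCat.ofHom R.subtype
    let a' : A ⟶ CommRingCat.of R := CommRingCat.ofHom (a.hom.codRestrict R hRa)
    let b' : B ⟶ CommRingCat.of R := CommRingCat.ofHom (b.hom.codRestrict R hRb)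
    have hab : α ≫ a' = β ≫ b' := by
      apply CommRingCat.hom_ext
      apply RingHom.ext
      intro c
      refine Subtype.ext (p := fun t => t ∈ R) ?_
      exact congrArg (fun k => k.hom c) hpo.w
    have hid : hpo.desc a' b' hab ≫ ι = 𝟙 T := by
      apply hpo.hom_ext
      · rw [← Category.assoc, hpo.inl_desc, Category.comp_id]
        rfl
      · rw [← Category.assoc, hpo.inr_desc, Category.comp_id]
        rfl
    intro t
    have := congrArg (fun k => k.hom t) hid
    change ((hpo.desc a' b' hab).hom t : R).1 = t at this
    rw [← this]
    exact ((hpo.desc a' b' hab).hom t : R).2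
  exact hR

end Reg

/-! ### The analytic topology -/

section Topology

variable {X Y W S : SchR}

lemma isOpen_lies_and {A : CommRingCat.{0}} (j : Spec A ⟶ X.left) [IsOpenImmersion j] (a : A)
    {V : Set ℂ} (hV : IsOpen V) : IsOpen {x : ComplexPoints X | Lies j x ∧ value j a x ∈ V} := by
  apply TopologicalSpace.isOpen_generateFrom_of_mem
  refine ⟨A, j, a, V, inferInstance, hV, ?_⟩
  ext x
  constructor
  · rintro ⟨⟨φ, hφ⟩, h⟩
    rw [value_eq j hφ] at h
    exact ⟨φ, hφ, h⟩
  · rintro ⟨φ, hφ, h⟩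
    rw [← value_eq j hφ] at h
    exact ⟨⟨φ, hφ⟩, h⟩

/-- A family of complex points is continuous for the analytic topology if and only if its
coordinates in affine charts are. -/
lemma reg_continuousAt_iff {Z : Type*} [TopologicalSpace Z] {z₀ : Z} {F : Z → ComplexPoints X} :
    Reg z₀ (fun u => ContinuousAt u z₀) F ↔ ContinuousAt F z₀ := by
  constructor
  · intro h
    refine TopologicalSpace.tendsto_nhds_generateFrom_iff.2 ?_
    rintro _ ⟨A, j, a, V, _, hV, rfl⟩ ⟨φ, hφ, hφV⟩
    obtain ⟨h₁, h₂⟩ := h A j inferInstance ⟨φ, hφ⟩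
    have := (h₂ a).eventually (hV.mem_nhds (by
      change value j a (F z₀) ∈ V
      rwa [value_eq j hφ]))
    filter_upwards [h₁, this] with z ⟨ψ, hψ⟩ hz
    rw [value_eq j hψ] at hz
    exact ⟨ψ, hψ, hz⟩
  · intro h A j _ hj
    refine ⟨?_, fun a => ?_⟩
    · have := h.eventually ((isOpen_lies_and j 0 isOpen_univ).mem_nhds ⟨hj, trivial⟩)
      exact this.mono fun z hz => hz.1
    · refine tendsto_nhds.2 ?_
      intro V hV hz
      have := h.eventually ((isOpen_lies_and j a hV).mem_nhds ⟨hj, hz⟩)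
      exact this.mono fun z hz => hz.2

/-- Morphisms of real schemes are continuous on complex points. -/
lemma continuous_complexPointsMap (f : X ⟶ Y) :
    Continuous (ComplexPoints.map f) :=
  continuous_iff_continuousAt.2 fun x => reg_continuousAt_iff.1 <|
    Reg.comp_hom (isGermClass_continuousAt x) (F := fun x => x)
      (reg_continuousAt_iff.2 continuousAt_id) f

/-- The complex points of a fibre product over an affine scheme carry the subspace topology of the
product. -/
lemma continuous_of_isPullback {fst : W ⟶ X} {snd : W ⟶ Y} {f : X ⟶ S} {g : Y ⟶ S}
    [IsAffine S.left] (h : IsPullback fst snd f g) {Z : Type*} [TopologicalSpace Z]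
    {F : Z → ComplexPoints W}
    (hX : Continuous (fun z => (F z).map fst))
    (hY : Continuous (fun z => (F z).map snd)) :
    Continuous F :=
  continuous_iff_continuousAt.2 fun z => reg_continuousAt_iff.1 <|
    Reg.of_isPullback (isGermClass_continuousAt z) h
      (reg_continuousAt_iff.2 hX.continuousAt) (reg_continuousAt_iff.2 hY.continuousAt)

/-- Precomposition with an `ℝ`-endomorphism of `Spec ℂ` is continuous on complex points. -/
lemma continuous_precomp (s : specC ⟶ specC) :
    Continuous (ComplexPoints.precomp s : ComplexPoints X → ComplexPoints X) := by
  let σ : CommRingCat.of ℂ ⟶ CommRingCat.of ℂ := Spec.preimage s.left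
  have hs : Spec.map σ = s.left := Spec.map_preimage _
  have hσ : Continuous σ.hom := by
    have hr : ∀ r : ℝ, σ.hom (r : ℂ) = r := by
      intro r
      have h : CommRingCat.ofHom (algebraMap ℝ ℂ) ≫ σ = CommRingCat.ofHom (algebraMap ℝ ℂ) := by
        apply Spec.map_injective
        rw [Spec.map_comp, hs]
        exact Over.w s
      exact congrArg (fun k => k.hom r) h
    let σ' : ℂ →ₐ[ℝ] ℂ := { σ.hom with commutes' := hr }
    exact σ'.toLinearMap.continuous_of_finiteDimensional
  refine continuous_iff_continuousAt.2 fun x => reg_continuousAt_iff.1 ?_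
  obtain ⟨A, j, _, hj⟩ := exists_chart x
  have key : ∀ (y : ComplexPoints X) (φ : A ⟶ CommRingCat.of ℂ), Spec.map φ ≫ j = y.toScheme →
      Spec.map (φ ≫ σ) ≫ j = (y.precomp s).toScheme := by
    intro y φ h
    rw [Spec.map_comp, Category.assoc, h, hs]
    rfl
  obtain ⟨h₁, h₂⟩ := reg_continuousAt_iff.2 (continuousAt_id (x := x)) A j inferInstance hj
  refine reg_of_chart (isGermClass_continuousAt x) j ?_ fun a => ?_
  · filter_upwards [h₁] with y ⟨φ, hφ⟩ using ⟨_, key y φ hφ⟩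
  · refine (hσ.continuousAt.comp (h₂ a)).congr ?_
    filter_upwards [h₁] with y ⟨φ, hφ⟩
    have hφ' : Spec.map φ ≫ j = y.toScheme := hφ
    rw [value_eq j (key y φ hφ)]
    change σ.hom (value j a y) = _
    rw [value_eq j hφ']
    rfl

end Topology

section

/-! ### Zero sets of polynomials with invertible Jacobian -/

section Analysis

open MvPolynomial

variable {ι σ : Type} [Fintype ι]

lemma contDiff_aeval (p : MvPolynomial ι ℝ) : ContDiff ℂ 1 (fun v : ι → ℂ => aeval v p) := by
  induction p using MvPolynomial.induction_on with
  | C a => simpa using contDiff_const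
  | add p q hp hq => simpa using hp.add hq
  | mul_X p i hp => simpa using hp.mul (contDiff_apply ℂ ℂ i)

lemma hasFDerivAt_aeval (p : MvPolynomial ι ℝ) (v : ι → ℂ) :
    HasFDerivAt (fun v : ι → ℂ => aeval v p)
      (∑ i, aeval v (pderiv i p) • (ContinuousLinearMap.proj i : (ι → ℂ) →L[ℂ] ℂ)) v := by
  classical
  induction p using MvPolynomial.induction_on with
  | C a =>
    have h : (fun v : ι → ℂ => aeval v (C a : MvPolynomial ι ℝ)) = fun _ => (a : ℂ) := by
      ext
      simp
    rw [h]
    refine (hasFDerivAt_const (𝕜 := ℂ) (a : ℂ) v).congr_fderiv ?_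
    ext w
    simp
  | add p q hp hq =>
    simp only [map_add]
    refine (hp.add hq).congr_fderiv ?_
    ext w
    simp [add_mul, Finset.sum_add_distrib]
  | mul_X p k hp =>
    simp only [map_mul, aeval_X]
    refine (hp.mul (hasFDerivAt_apply k v)).congr_fderiv ?_
    ext w
    have h₁ : ∀ i, aeval v (Pi.single (M := fun _ => MvPolynomial ι ℝ) i 1 k) =
        if k = i then (1 : ℂ) else 0 := by
      intro i
      rw [Pi.single_apply]
      split_ifs <;> simp
    simp [h₁, Finset.sum_add_distrib, Finset.mul_sum, mul_add, mul_comm, mul_left_comm]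

/-- The implicit function theorem for the zero set of polynomials `r s`, `s ∈ σ`, whose partial
derivatives with respect to the variables `m s`, `s ∈ σ`, form an invertible matrix: near a zero
`v₀` the remaining variables parametrize the zero set. -/
lemma exists_parametrization [Fintype σ] (m : σ → ι) (hm : Function.Injective m)
    (r : σ → MvPolynomial ι ℝ) (v₀ : ι → ℂ) (h₀ : ∀ s, aeval v₀ (r s) = 0)
    [DecidableEq σ] [Fintype {i // i ∉ Set.range m}]
    (hdet : (Matrix.of fun i j => aeval v₀ (pderiv (m i) (r j)) : Matrix σ σ ℂ).det ≠ 0) :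
    ∃ ρ : ({i // i ∉ Set.range m} → ℂ) → (ι → ℂ),
      ρ (fun i => v₀ i) = v₀ ∧ ContDiffAt ℂ 1 ρ (fun i => v₀ i) ∧
      (∀ᶠ t in 𝓝 fun i => v₀ i, ContinuousAt ρ t) ∧
      (∀ᶠ t in 𝓝 fun i => v₀ i, (∀ s, aeval (ρ t) (r s) = 0) ∧ ∀ i, ρ t i.1 = t i) ∧
      ∀ᶠ v in 𝓝 v₀, (∀ s, aeval v (r s) = 0) → ρ (fun i => v i) = v := by
  classical
  -- complete the equations by the remaining variables to a square system
  let q : ι → MvPolynomial ι ℝ := fun i => if h : i ∈ Set.range m then r h.choose else X i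
  have hq₁ : ∀ s, q (m s) = r s := by
    intro s
    have h : m s ∈ Set.range m := ⟨s, rfl⟩
    simp only [q, dif_pos h]
    rw [hm h.choose_spec]
  have hq₂ : ∀ i, i ∉ Set.range m → q i = X i := fun i hi => dif_neg hi
  let E : (ι → ℂ) → (ι → ℂ) := fun v i => aeval v (q i)
  have hE : ContDiffAt ℂ 1 E v₀ := (contDiff_pi.2 fun i => contDiff_aeval (q i)).contDiffAt
  let L : (ι → ℂ) →L[ℂ] (ι → ℂ) := ContinuousLinearMap.pi fun i =>
    ∑ k, aeval v₀ (pderiv k (q i)) • (ContinuousLinearMap.proj k : (ι → ℂ) →L[ℂ] ℂ)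
  have hL : HasFDerivAt E L v₀ := hasFDerivAt_pi.2 fun i => hasFDerivAt_aeval (q i) v₀
  have hLa : ∀ w i, L w i = ∑ k, aeval v₀ (pderiv k (q i)) * w k := by
    intro w i
    simp [L]
  have hinj : Function.Injective L := by
    refine (injective_iff_map_eq_zero L).2 fun w hw => ?_
    have h₂ : ∀ i, i ∉ Set.range m → w i = 0 := by
      intro i hi
      have := hLa w i
      rw [hw, hq₂ i hi] at this
      simpa [pderiv_X, Pi.single_apply, apply_ite] using this.symm
    have h₁ : (fun s => w (m s)) = 0 := by
      refine Matrix.eq_zero_of_vecMul_eq_zero hdet ?_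
      ext s
      have := hLa w (m s)
      rw [hw, hq₁] at this
      refine Eq.trans ?_ this.symm
      rw [Matrix.vecMul, dotProduct]
      have := Finset.sum_subset (Finset.subset_univ (Finset.univ.image m))
        (f := fun k => aeval v₀ (pderiv k (r s)) * w k) (fun k _ hk => by
          rw [h₂ k (by simpa using hk), mul_zero])
      rw [← this, Finset.sum_image hm.injOn]
      exact Finset.sum_congr rfl fun k _ => mul_comm _ _
    ext i
    by_cases hi : i ∈ Set.range m
    · obtain ⟨s, rfl⟩ := hi
      exact congrFun h₁ s
    · exact h₂ i hi
  let L' : (ι → ℂ) ≃L[ℂ] (ι → ℂ) :=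
    (LinearEquiv.ofInjectiveEndo (L : (ι → ℂ) →ₗ[ℂ] (ι → ℂ)) hinj).toContinuousLinearEquiv
  have hL' : HasFDerivAt E (L' : (ι → ℂ) →L[ℂ] (ι → ℂ)) v₀ := hL
  let e := hE.toOpenPartialHomeomorph E hL' one_ne_zero
  have hes : v₀ ∈ e.source := hE.mem_toOpenPartialHomeomorph_source hL' one_ne_zero
  have het : E v₀ ∈ e.target := hE.image_mem_toOpenPartialHomeomorph_target hL' one_ne_zero
  have hec : ContDiffAt ℂ 1 e.symm (E v₀) := hE.to_localInverse hL' one_ne_zero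
  let x : ({i // i ∉ Set.range m} → ℂ) → (ι → ℂ) :=
    fun t i => if h : i ∉ Set.range m then t ⟨i, h⟩ else 0
  have hxc : ContDiff ℂ 1 x := by
    refine contDiff_pi.2 fun i => ?_
    by_cases h : i ∉ Set.range m
    · simp only [x, dif_pos h]
      exact contDiff_apply ℂ ℂ _
    · simp only [x, dif_neg h]
      exact contDiff_const
  have hxE : ∀ v, (∀ s, aeval v (r s) = 0) → x (fun i => v i) = E v := by
    intro v hv
    ext i
    by_cases hi : i ∈ Set.range m
    · obtain ⟨s, rfl⟩ := hi
      simp [x, E, hq₁, hv]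
    · simp only [x, dif_pos hi, E, hq₂ i hi, aeval_X]
  have hx₀ := hxE v₀ h₀
  have hev : ∀ᶠ t in 𝓝 fun i : {i // i ∉ Set.range m} => v₀ i, x t ∈ e.target :=
    hxc.continuous.continuousAt.eventually (e.open_target.mem_nhds (hx₀ ▸ het))
  refine ⟨fun t => e.symm (x t), ?_, ?_, ?_, ?_, ?_⟩
  · exact (congrArg e.symm hx₀).trans (e.left_inv hes)
  · refine ContDiffAt.comp (g := e.symm) (f := x) _ ?_ hxc.contDiffAt
    exact hx₀.symm ▸ hec
  · filter_upwards [hev] with t ht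
    exact (e.continuousAt_symm ht).comp hxc.continuous.continuousAt
  · filter_upwards [hev] with t ht
    have h : E (e.symm (x t)) = x t := e.right_inv ht
    refine ⟨fun s => ?_, fun i => ?_⟩
    · have := congrFun h (m s)
      have hms : ¬ m s ∉ Set.range m := not_not_intro ⟨s, rfl⟩
      simpa only [E, hq₁, x, dif_neg hms] using this
    · have := congrFun h i.1
      simpa only [E, hq₂ _ i.2, x, dif_pos i.2, aeval_X] using this
  · filter_upwards [e.open_source.mem_nhds hes] with v hv hz
    exact (congrArg e.symm (hxE v hz)).trans (e.left_inv hv)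

end Analysis

end

/-! ### Smooth real schemes are locally parametrized by complex vector spaces -/

lemma isGermClass_contDiffAt {E : Type*} [NormedAddCommGroup E] [NormedSpace ℂ E] (z₀ : E) :
    IsGermClass z₀ (fun u : E → ℂ => ContDiffAt ℂ 1 u z₀) where
  continuousAt h := h.continuousAt
  const _ := contDiffAt_const
  add h h' := h.add h'
  mul h h' := h.mul h'
  inv h h' := h.inv h'
  congr h h' := h.congr_of_eventuallyEq h'.symm

lemma ComplexPoints.toScheme_comp_hom {X : SchR} (x : ComplexPoints X) :
    x.toScheme ≫ X.hom = Spec.map (CommRingCat.ofHom (algebraMap ℝ ℂ)) := by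
  let f : specC ⟶ X := x
  exact Over.w f

/-- A smooth real scheme is covered by charts that are standard smooth over `ℝ` itself, because
`Spec ℝ` has no proper nonempty open subset. -/
lemma exists_isStandardSmooth_chart {X : SchR} [Smooth X.hom] (x : ComplexPoints X) :
    ∃ (B : CommRingCat.{0}) (κ : CommRingCat.of ℝ ⟶ B) (j : Spec B ⟶ X.left),
      IsOpenImmersion j ∧ Lies j x ∧ Spec.map κ = j ≫ X.hom ∧ κ.hom.IsStandardSmooth := by
  obtain ⟨U, hU, V, hV, hx, hVU, hs⟩ := Smooth.exists_isStandardSmooth X.hom x.pt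
  have hsub : Subsingleton (Spec (CommRingCat.of ℝ)) :=
    inferInstanceAs (Subsingleton (PrimeSpectrum ℝ))
  have hUtop : U = ⊤ := by
    refine top_le_iff.1 fun p _ => ?_
    rw [Subsingleton.elim p (X.hom x.pt)]
    exact hVU hx
  have hiso : IsIso hU.fromSpec :=
    isIso_of_isOpenImmersion_of_opensRange_eq_top _ (by rw [hU.opensRange_fromSpec, hUtop])
  let κ : CommRingCat.of ℝ ⟶ Γ(X.left, V) := Spec.preimage (hV.fromSpec ≫ X.hom)
  have hκ : Spec.map κ = hV.fromSpec ≫ X.hom := Spec.map_preimage _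
  let ε : CommRingCat.of ℝ ⟶ Γ(Spec (CommRingCat.of ℝ), U) := Spec.preimage hU.fromSpec
  have hε : Spec.map ε = hU.fromSpec := Spec.map_preimage _
  have hεi : IsIso ε := by
    have : IsIso (Spec.map ε) := by rw [hε]; exact hiso
    exact (ConcreteCategory.isIso_iff_bijective ε).2 (isIso_SpecMap_iff.1 this)
  have hκε : κ = ε ≫ X.hom.appLE U V hVU := by
    apply Spec.map_injective
    rw [Spec.map_comp, hκ, hε]
    exact (hU.SpecMap_appLE_fromSpec X.hom hV hVU).symm
  refine ⟨Γ(X.left, V), κ, hV.fromSpec, inferInstance, ?_, hκ, ?_⟩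
  · rw [lies_iff, hV.range_fromSpec]
    exact hx
  · rw [hκε]
    exact RingHom.isStandardSmooth_respectsIso.2 _ (asIso ε).commRingCatIsoToRingEquiv hs

/-- Near a complex point `x₀`, the complex points of a smooth real scheme are parametrized by an
open subset of a finite-dimensional complex vector space, such that a family of complex points is
continuously differentiable if and only if its coordinates are. -/
lemma exists_local_coordinates {X : SchR} [Smooth X.hom] (x₀ : ComplexPoints X) :
    ∃ (κ : Type) (_ : Fintype κ) (ρ : (κ → ℂ) → ComplexPoints X) (c : ComplexPoints X → (κ → ℂ)),
      ρ (c x₀) = x₀ ∧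
      Reg (c x₀) (fun u => ContDiffAt ℂ 1 u (c x₀)) ρ ∧
      (∀ (E : Type) (_ : NormedAddCommGroup E) (_ : NormedSpace ℂ E) (z₀ : E)
        (F : E → ComplexPoints X), F z₀ = x₀ → Reg z₀ (fun u => ContDiffAt ℂ 1 u z₀) F →
        ContDiffAt ℂ 1 (fun z => c (F z)) z₀) ∧
      (∀ᶠ t in 𝓝 (c x₀), c (ρ t) = t) ∧ (∀ᶠ x in 𝓝 x₀, ρ (c x) = x) ∧
      (∀ᶠ t in 𝓝 (c x₀), ContinuousAt ρ t) ∧ ∀ᶠ x in 𝓝 x₀, ContinuousAt c x := by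
  classical
  obtain ⟨B, κ, j, _, hj, hκ, hs⟩ := exists_isStandardSmooth_chart x₀
  algebraize [κ.hom]
  obtain ⟨ι, σ, _, _, ⟨P⟩⟩ := (inferInstance : Algebra.IsStandardSmooth ℝ B).out
  have := Fintype.ofFinite ι
  have := Fintype.ofFinite σ
  -- points in the chart are `ℝ`-algebra homomorphisms
  have hlies : ∀ x, Lies j x → ∃ φ : B →ₐ[ℝ] ℂ, ∀ b, value j b x = φ b := by
    intro x hx
    obtain ⟨φ, hφ, hφv⟩ := hx.exists_hom
    refine ⟨{ φ.hom with commutes' := fun r => ?_ }, hφv⟩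
    have h : κ ≫ φ = CommRingCat.ofHom (algebraMap ℝ ℂ) := by
      apply Spec.map_injective
      rw [Spec.map_comp, hκ, ← Category.assoc, hφ, x.toScheme_comp_hom]
    exact congrArg (fun k => k.hom r) h
  have hpoint : ∀ φ : B →ₐ[ℝ] ℂ, ∃ x, Lies j x ∧ ∀ b, value j b x = φ b := by
    intro φ
    have h : (Spec.map (CommRingCat.ofHom (φ : B →+* ℂ)) ≫ j) ≫ X.hom = specC.hom := by
      rw [Category.assoc, ← hκ, ← Spec.map_comp]
      change _ = Spec.map (CommRingCat.ofHom (algebraMap ℝ ℂ))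
      congr 1
      apply CommRingCat.hom_ext
      apply RingHom.ext
      intro r
      exact φ.commutes r
    let f : specC ⟶ X := Over.homMk (Spec.map (CommRingCat.ofHom (φ : B →+* ℂ)) ≫ j) h
    let x : ComplexPoints X := f
    have hx : Spec.map (CommRingCat.ofHom (φ : B →+* ℂ)) ≫ j = x.toScheme := rfl
    exact ⟨x, ⟨_, hx⟩, fun b => value_eq j hx b⟩
  have hext : ∀ x y, Lies j x → Lies j y → (∀ i, value j (P.val i) x = value j (P.val i) y) →
      x = y := by
    intro x y hx hy h
    obtain ⟨φ, hφ, hφv⟩ := hx.exists_hom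
    obtain ⟨ψ, hψ, hψv⟩ := hy.exists_hom
    obtain ⟨φ', hφ'⟩ := hlies x hx
    obtain ⟨ψ', hψ'⟩ := hlies y hy
    have e : φ' = ψ' := by
      refine AlgHom.ext fun b => ?_
      rw [← P.aeval_val_σ b, ← AlgHom.comp_apply, ← AlgHom.comp_apply]
      congr 1
      refine MvPolynomial.algHom_ext fun i => ?_
      simpa [hφ', hψ'] using h i
    have e' : φ = ψ := by
      apply CommRingCat.hom_ext
      apply RingHom.ext
      intro b
      rw [← hφv, ← hψv, hφ', hψ', e]
    have h' : x.toScheme = y.toScheme := by rw [← hφ, ← hψ, e']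
    let x' : specC ⟶ X := x
    let y' : specC ⟶ X := y
    exact Over.OverMorphism.ext (f := x') (g := y') h'
  let v : ComplexPoints X → ι → ℂ := fun x i => value j (P.val i) x
  have hv : ∀ x, Lies j x → ∀ p : MvPolynomial ι ℝ,
      MvPolynomial.aeval (v x) p = value j (MvPolynomial.aeval P.val p) x := by
    intro x hx p
    obtain ⟨φ, hφ⟩ := hlies x hx
    rw [hφ, ← AlgHom.comp_apply]
    congr 1
    refine MvPolynomial.algHom_ext fun i => ?_
    simp [v, hφ]
  have hrel : ∀ x, Lies j x → ∀ s, MvPolynomial.aeval (v x) (P.relation s) = 0 := by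
    intro x hx s
    obtain ⟨φ, hφ⟩ := hlies x hx
    rw [hv x hx, P.aeval_val_relation, hφ, map_zero]
  have hsurj : ∀ w : ι → ℂ, (∀ s, MvPolynomial.aeval w (P.relation s) = 0) →
      ∃ x, Lies j x ∧ v x = w := by
    intro w hw
    let q : P.Ring →ₐ[ℝ] B := MvPolynomial.aeval P.val
    have hq : Function.Surjective q := fun b => ⟨P.σ b, P.aeval_val_σ b⟩
    have hker : RingHom.ker q ≤ RingHom.ker (MvPolynomial.aeval w : MvPolynomial ι ℝ →ₐ[ℝ] ℂ) := by
      have : RingHom.ker q = Ideal.span (Set.range P.relation) :=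
        P.span_range_relation_eq_ker.symm ▸ P.ker_eq_ker_aeval_val.symm
      rw [this, Ideal.span_le]
      rintro _ ⟨s, rfl⟩
      exact hw s
    let φ : B →ₐ[ℝ] ℂ := AlgHom.liftOfSurjective q hq (MvPolynomial.aeval w) hker
    have hφ : ∀ p, φ (q p) = MvPolynomial.aeval w p :=
      fun p => AlgHom.liftOfSurjective_apply q hq _ hker p
    obtain ⟨x, hx, hxv⟩ := hpoint φ
    refine ⟨x, hx, funext fun i => ?_⟩
    have := hφ (MvPolynomial.X i)
    simp only [q, MvPolynomial.aeval_X] at this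
    rw [← this]
    exact hxv _
  have hdet : (Matrix.of fun a b => MvPolynomial.aeval (v x₀)
      (MvPolynomial.pderiv (P.map a) (P.relation b)) : Matrix σ σ ℂ).det ≠ 0 := by
    obtain ⟨φ, hφ⟩ := hlies x₀ hj
    have hu := P.jacobian_isUnit.map φ
    rw [Algebra.PreSubmersivePresentation.jacobian_eq_jacobiMatrix_det] at hu
    refine ne_of_eq_of_ne ?_ hu.ne_zero
    rw [P.algebraMap_eq]
    change _ = φ (MvPolynomial.aeval P.val P.jacobiMatrix.det)
    rw [← hφ, ← hv x₀ hj, AlgHom.map_det]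
    congr 1
    ext a b
    simp [Algebra.PreSubmersivePresentation.jacobiMatrix_apply]
  obtain ⟨ρ, hρ₀, hρ₁, hρ₂, hρ₃, hρ₄⟩ :=
    exists_parametrization P.map P.map_inj P.relation (v x₀) (hrel x₀ hj) hdet
  let c : ComplexPoints X → ({i // i ∉ Set.range P.map} → ℂ) := fun x i => v x i
  have : Nonempty (ComplexPoints X) := ⟨x₀⟩
  choose! pt hpt₁ hpt₂ using hsurj
  have hev : ∀ᶠ t in 𝓝 (c x₀), Lies j (pt (ρ t)) ∧ v (pt (ρ t)) = ρ t ∧ c (pt (ρ t)) = t := by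
    filter_upwards [hρ₃] with t ht
    refine ⟨hpt₁ _ ht.1, hpt₂ _ ht.1, ?_⟩
    ext i
    change v (pt (ρ t)) i = t i
    rw [hpt₂ _ ht.1, ht.2]
  have hreg : ∀ {Z : Type} [TopologicalSpace Z] {z₀ : Z} {D : (Z → ℂ) → Prop}
      (hD : IsGermClass z₀ D) {F : Z → ComplexPoints X}, (∀ᶠ z in 𝓝 z₀, Lies j (F z)) →
      (∀ i, D fun z => v (F z) i) →
      Reg z₀ D F := by
    intro Z _ z₀ D hD F hF h
    refine reg_of_chart hD j hF fun b => ?_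
    rw [← P.aeval_val_σ b]
    refine hD.congr (u := fun z => MvPolynomial.aeval (v (F z)) (P.σ b)) ?_
      (hF.mono fun z hz => hv _ hz _)
    induction P.σ b using MvPolynomial.induction_on with
    | C a => simpa using hD.const a
    | add p q hp hq => simpa using hD.add hp hq
    | mul_X p i hp => simpa using hD.mul hp (h i)
  have hcont : ∀ x, Lies j x → ContinuousAt c x := by
    intro x hx
    exact continuousAt_pi.2 fun i => (reg_continuousAt_iff.2 (continuousAt_id (x := x)) B j
      inferInstance hx).2 _
  have hx₀ : pt (ρ (c x₀)) = x₀ := by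
    have h : Lies j (pt (ρ (c x₀))) ∧ v (pt (ρ (c x₀))) = ρ (c x₀) ∧ _ := hev.self_of_nhds
    exact hext _ _ h.1 hj (congrFun (h.2.1.trans hρ₀))
  have hopen : ∀ᶠ x in 𝓝 x₀, Lies j x :=
    (reg_continuousAt_iff.2 (continuousAt_id (x := x₀)) B j inferInstance hj).1
  refine ⟨{i // i ∉ Set.range P.map}, inferInstance, fun t => pt (ρ t), c, hx₀, ?_, ?_, ?_, ?_, ?_,
    ?_⟩
  · refine hreg (isGermClass_contDiffAt _) (hev.mono fun t ht => ht.1) fun i => ?_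
    refine (contDiffAt_pi.1 hρ₁ i).congr_of_eventuallyEq ?_
    filter_upwards [hev] with t ht
    rw [ht.2.1]
  · intro E _ _ z₀ F hF₀ hF
    exact contDiffAt_pi.2 fun i => (hF B j inferInstance (hF₀ ▸ hj)).2 _
  · exact hev.mono fun t ht => ht.2.2
  · have hc₀ : ContinuousAt c x₀ := hcont x₀ hj
    have hv₀ : ContinuousAt v x₀ := continuousAt_pi.2 fun i =>
      (reg_continuousAt_iff.2 (continuousAt_id (x := x₀)) B j inferInstance hj).2 _
    filter_upwards [hopen, hc₀.eventually hev, hv₀.eventually hρ₄] with x hx h h'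
    exact hext _ _ h.1 hx (congrFun (h.2.1.trans (h' (hrel x hx))))
  · filter_upwards [hev.eventually_nhds, hρ₂] with t ht ht'
    refine reg_continuousAt_iff.1 (hreg (isGermClass_continuousAt t) (ht.mono fun t ht => ht.1)
      fun i => ?_)
    refine (continuousAt_pi.1 ht' i).congr ?_
    filter_upwards [ht] with t ht
    rw [ht.2.1]
  · exact hopen.mono hcont

section

open scoped MonObj

/-! ### The groups of complex points and their actions -/

section Group

variable {G X Y : SchR}

instance [GrpObj G] : Group (ComplexPoints G) := inferInstanceAs (Group (specC ⟶ G))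

instance [GrpObj G] [ModObj G X] : MulAction (ComplexPoints G) (ComplexPoints X) :=
  inferInstanceAs (MulAction (specC ⟶ G) (specC ⟶ X))

instance isAffine_unit : IsAffine (𝟙_ SchR).left :=
  inferInstanceAs (IsAffine (Spec (CommRingCat.of ℝ)))

lemma isPullback_fst_snd (X Y : SchR) : IsPullback (fst X Y) (snd X Y) (toUnit X) (toUnit Y) :=
  ⟨⟨toUnit_unique _ _⟩, ⟨PullbackCone.IsLimit.mk _ (fun s => lift s.fst s.snd) (by simp) (by simp)
    fun s m h₁ h₂ => by ext <;> simp [← h₁, ← h₂]⟩⟩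

/-- The complex point of a product with given components. -/
def ComplexPoints.pair (x : ComplexPoints X) (y : ComplexPoints Y) : ComplexPoints (X ⊗ Y) :=
  let f : specC ⟶ X := x
  let g : specC ⟶ Y := y
  lift f g

lemma ComplexPoints.map_fst_pair (x : ComplexPoints X) (y : ComplexPoints Y) :
    (x.pair y).map (fst X Y) = x := by
  let f : specC ⟶ X := x
  let g : specC ⟶ Y := y
  exact lift_fst f g

lemma ComplexPoints.map_snd_pair (x : ComplexPoints X) (y : ComplexPoints Y) :
    (x.pair y).map (snd X Y) = y := by
  let f : specC ⟶ X := x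
  let g : specC ⟶ Y := y
  exact lift_snd f g

lemma ComplexPoints.smul_eq [GrpObj G] [ModObj G X] (g : ComplexPoints G) (x : ComplexPoints X) :
    g • x = (g.pair x).map (act G X) := rfl

variable {Z : Type*} [TopologicalSpace Z] {z₀ : Z} {D : (Z → ℂ) → Prop}

lemma Reg.pair (hD : IsGermClass z₀ D) {F₁ : Z → ComplexPoints X} {F₂ : Z → ComplexPoints Y}
    (h₁ : Reg z₀ D F₁) (h₂ : Reg z₀ D F₂) : Reg z₀ D (fun z => (F₁ z).pair (F₂ z)) :=
  Reg.of_isPullback hD (isPullback_fst_snd X Y) (by simpa only [ComplexPoints.map_fst_pair])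
    (by simpa only [ComplexPoints.map_snd_pair])

lemma Reg.smul [GrpObj G] [ModObj G X] (hD : IsGermClass z₀ D) {F₁ : Z → ComplexPoints G}
    {F₂ : Z → ComplexPoints X} (h₁ : Reg z₀ D F₁) (h₂ : Reg z₀ D F₂) :
    Reg z₀ D (fun z => F₁ z • F₂ z) :=
  (Reg.pair hD h₁ h₂).comp_hom hD (act G X)

lemma Reg.mul [GrpObj G] (hD : IsGermClass z₀ D) {F₁ F₂ : Z → ComplexPoints G}
    (h₁ : Reg z₀ D F₁) (h₂ : Reg z₀ D F₂) : Reg z₀ D (fun z => F₁ z * F₂ z) :=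
  (Reg.pair hD h₁ h₂).comp_hom hD MonObj.mul

instance [GrpObj G] : IsTopologicalGroup (ComplexPoints G) where
  continuous_mul := continuous_iff_continuousAt.2 fun p => reg_continuousAt_iff.1 <|
    Reg.mul (isGermClass_continuousAt p) (reg_continuousAt_iff.2 continuousAt_fst)
      (reg_continuousAt_iff.2 continuousAt_snd)
  continuous_inv := continuous_complexPointsMap _

instance [GrpObj G] [ModObj G X] : ContinuousSMul (ComplexPoints G) (ComplexPoints X) where
  continuous_smul := continuous_iff_continuousAt.2 fun p => reg_continuousAt_iff.1 <|
    Reg.smul (isGermClass_continuousAt p) (reg_continuousAt_iff.2 continuousAt_fst)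
      (reg_continuousAt_iff.2 continuousAt_snd)

end Group

/-! ### Square roots near the identity -/

/-- A topological group has square roots near the identity if squaring is injective near the
identity and has a continuous local section fixing the identity. -/
structure HasLocalSqrt (H : Type*) [Group H] [TopologicalSpace H] : Prop where
  injOn : ∃ N ∈ 𝓝 (1 : H), Set.InjOn (fun x => x * x) N
  sqrt : ∃ r : H → H, r 1 = 1 ∧ (∀ᶠ z in 𝓝 1, ContinuousAt r z) ∧ ∀ᶠ z in 𝓝 1, r z * r z = z

/-- If a binary operation `m` has `t₀` as a two-sided unit near `t₀`, then the derivative of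
`t ↦ m (t, t)` at `t₀` is multiplication by two. -/
lemma hasFDerivAt_diag {E : Type*} [NormedAddCommGroup E] [NormedSpace ℂ E] {m : E × E → E} {t₀ : E}
    (hm : DifferentiableAt ℂ m (t₀, t₀)) (h₁ : ∀ᶠ t in 𝓝 t₀, m (t, t₀) = t)
    (h₂ : ∀ᶠ t in 𝓝 t₀, m (t₀, t) = t) :
    HasFDerivAt (fun t => m (t, t)) ((2 : ℂ) • ContinuousLinearMap.id ℂ E) t₀ := by
  have hM := hm.hasFDerivAt
  have k₁ := (hM.comp (f := fun t => (t, t₀)) t₀ (hasFDerivAt_prodMk_left t₀ t₀)).unique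
    ((hasFDerivAt_id (𝕜 := ℂ) t₀).congr_of_eventuallyEq (by exact h₁))
  have k₂ := (hM.comp (f := fun t => (t₀, t)) t₀ (hasFDerivAt_prodMk_right t₀ t₀)).unique
    ((hasFDerivAt_id (𝕜 := ℂ) t₀).congr_of_eventuallyEq (by exact h₂))
  refine (hM.comp (f := fun t => (t, t)) t₀
    ((hasFDerivAt_id t₀).prodMk (hasFDerivAt_id t₀))).congr_fderiv ?_
  ext v
  have e₁ := DFunLike.congr_fun k₁ v
  have e₂ := DFunLike.congr_fun k₂ v
  simp only [ContinuousLinearMap.comp_apply, ContinuousLinearMap.inl_apply,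
    ContinuousLinearMap.inr_apply, ContinuousLinearMap.id_apply] at e₁ e₂
  simp only [ContinuousLinearMap.comp_apply, ContinuousLinearMap.prod_apply,
    ContinuousLinearMap.id_apply, smul_apply]
  rw [two_smul]
  refine Eq.trans ?_ (congrArg₂ (· + ·) e₁ e₂)
  rw [← map_add]
  simp

lemma Reg.comp_contDiffAt {E E' : Type*} [NormedAddCommGroup E] [NormedSpace ℂ E]
    [NormedAddCommGroup E'] [NormedSpace ℂ E'] {X : SchR} {F : E → ComplexPoints X} {k : E' → E}
    {z : E'} (hF : Reg (k z) (fun u => ContDiffAt ℂ 1 u (k z)) F) (hk : ContDiffAt ℂ 1 k z) :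
    Reg z (fun u => ContDiffAt ℂ 1 u z) (fun z => F (k z)) := by
  intro A j _ hj
  obtain ⟨h₁, h₂⟩ := hF A j inferInstance hj
  exact ⟨hk.continuousAt.eventually h₁, fun a => (h₂ a).comp z hk⟩

/-- In local coordinates, squaring has derivative two at the identity, so that it is invertible
there by the inverse function theorem. -/
lemma hasLocalSqrt_complexPoints (G : SchR) [GrpObj G] [Smooth G.hom] :
    HasLocalSqrt (ComplexPoints G) := by
  obtain ⟨κ, _, ρ, c, hρ₀, hρ, hc, hcρ, hρc, hρcont, hccont⟩ :=
    exists_local_coordinates (1 : ComplexPoints G)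
  obtain ⟨t₀, ht₀⟩ : ∃ t, t = c 1 := ⟨_, rfl⟩
  rw [← ht₀] at hρ₀ hρ hcρ hρcont
  let m : (κ → ℂ) × (κ → ℂ) → (κ → ℂ) := fun p => c (ρ p.1 * ρ p.2)
  have hm : ContDiffAt ℂ 1 m (t₀, t₀) := by
    refine hc _ inferInstance inferInstance (t₀, t₀) (fun p => ρ p.1 * ρ p.2) ?_ ?_
    · change ρ t₀ * ρ t₀ = 1
      rw [hρ₀, mul_one]
    · exact Reg.mul (isGermClass_contDiffAt _)
        (Reg.comp_contDiffAt (k := Prod.fst) (z := (t₀, t₀)) hρ contDiffAt_fst)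
        (Reg.comp_contDiffAt (k := Prod.snd) (z := (t₀, t₀)) hρ contDiffAt_snd)
  let s : (κ → ℂ) → (κ → ℂ) := fun t => c (ρ t * ρ t)
  have hs : ContDiffAt ℂ 1 s t₀ :=
    ContDiffAt.comp (g := m) (f := fun t => (t, t)) t₀ hm (contDiffAt_id.prodMk contDiffAt_id)
  obtain ⟨L, hLc⟩ : ∃ L : (κ → ℂ) ≃L[ℂ] (κ → ℂ),
      (L : (κ → ℂ) →L[ℂ] (κ → ℂ)) = (2 : ℂ) • ContinuousLinearMap.id ℂ (κ → ℂ) :=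
    ⟨ContinuousLinearEquiv.smulLeft (Units.mk0 (2 : ℂ) two_ne_zero), by
      ext
      simp [ContinuousLinearEquiv.smulLeft]⟩
  have hL : HasFDerivAt s (L : (κ → ℂ) →L[ℂ] (κ → ℂ)) t₀ := by
    rw [hLc]
    refine hasFDerivAt_diag (m := m) (hm.differentiableAt one_ne_zero) ?_ ?_
    · filter_upwards [hcρ] with t ht
      simp only [m, hρ₀, mul_one, ht]
    · filter_upwards [hcρ] with t ht
      simp only [m, hρ₀, one_mul, ht]
  let e := hs.toOpenPartialHomeomorph s hL one_ne_zero
  have hes : t₀ ∈ e.source := hs.mem_toOpenPartialHomeomorph_source hL one_ne_zero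
  have hst : s t₀ = t₀ := by
    simp only [s, hρ₀, mul_one]
    exact ht₀.symm
  have het : t₀ ∈ e.target := hst ▸ hs.image_mem_toOpenPartialHomeomorph_target hL one_ne_zero
  have hes₀ : e.symm t₀ = t₀ := (congrArg e.symm hst).symm.trans (e.left_inv hes)
  have hc₁ : Tendsto c (𝓝 1) (𝓝 t₀) := ht₀ ▸ hccont.self_of_nhds.tendsto
  have hρ₁ : Tendsto ρ (𝓝 t₀) (𝓝 1) := by
    have := hρcont.self_of_nhds.tendsto
    rwa [hρ₀] at this
  have hsymm : Tendsto e.symm (𝓝 t₀) (𝓝 t₀) := by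
    have := (e.continuousAt_symm het).tendsto
    rwa [hes₀] at this
  refine ⟨?_, fun z => ρ (e.symm (c z)), ?_, ?_, ?_⟩
  · refine ⟨{x | ρ (c x) = x ∧ c x ∈ e.source}, ?_, ?_⟩
    · filter_upwards [hρc, hc₁.eventually (e.open_source.mem_nhds hes)] with x h h' using ⟨h, h'⟩
    · rintro x ⟨hx, hx'⟩ y ⟨hy, hy'⟩ hxy
      have : s (c x) = s (c y) := by
        simp only [s, hx, hy]
        exact congrArg c hxy
      rw [← hx, ← hy, e.injOn hx' hy' this]
  · simp only [← ht₀, hes₀, hρ₀]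
  · have h₁ : ∀ᶠ t in 𝓝 t₀, ContinuousAt e.symm t := by
      filter_upwards [e.open_target.mem_nhds het] with t ht using e.continuousAt_symm ht
    filter_upwards [hccont, hc₁.eventually h₁, hc₁.eventually (hsymm.eventually hρcont)]
      with z hz₁ hz₂ hz₃
    exact ContinuousAt.comp (g := ρ) hz₃ (ContinuousAt.comp (g := e.symm) hz₂ hz₁)
  · have h₁ : Tendsto (fun z => ρ (e.symm (c z))) (𝓝 1) (𝓝 1) := hρ₁.comp (hsymm.comp hc₁)
    have h₂ : Tendsto (fun z => ρ (e.symm (c z)) * ρ (e.symm (c z))) (𝓝 1) (𝓝 1) := by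
      simpa only [mul_one] using h₁.mul h₁
    filter_upwards [hρc, h₂.eventually hρc, hc₁.eventually (e.open_target.mem_nhds het)]
      with z hz₁ hz₂ hz₃
    have : s (e.symm (c z)) = c z := e.right_inv hz₃
    rw [← hz₂, ← hz₁]
    exact congrArg ρ (by rw [hz₁]; exact this)

end

/-! ### Galois descent of morphisms -/

/-- Complex conjugation, as an element of the Galois group. -/
abbrev conjC2 : C2 := Complex.conjAe

lemma conjC2_mul_self : conjC2 * conjC2 = 1 := by
  ext z
  exact Complex.conj_conj z

lemma eq_one_or_eq_conjC2 (γ : C2) : γ = 1 ∨ γ = conjC2 := by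
  rcases Complex.real_algHom_eq_id_or_conj (γ : ℂ →ₐ[ℝ] ℂ) with h | h
  · left
    ext z
    exact DFunLike.congr_fun h z
  · right
    ext z
    exact DFunLike.congr_fun h z

instance : Etale specCToR.left := by
  change Etale (Spec.map (CommRingCat.ofHom (algebraMap ℝ ℂ)))
  rw [HasRingHomProperty.Spec_iff (P := @Etale)]
  have : Algebra.FormallyEtale ℝ ℂ := Algebra.FormallyEtale.of_isSeparable ℝ ℂ
  have : Algebra.FinitePresentation ℝ ℂ :=
    (Algebra.FinitePresentation.of_finiteType).1 inferInstance
  have : Algebra.Etale ℝ ℂ := ⟨inferInstance, inferInstance⟩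
  exact (RingHom.etale_algebraMap (R := ℝ) (S := ℂ)).2 this

instance : Surjective specCToR.left := by
  refine ⟨fun x => ⟨IsLocalRing.closedPoint (CommRingCat.of ℂ), ?_⟩⟩
  have : Subsingleton (specR.left : Type) := inferInstanceAs (Subsingleton (PrimeSpectrum ℝ))
  exact Subsingleton.elim _ _

instance : IsAffine specR.left := inferInstanceAs (IsAffine (Spec (CommRingCat.of ℝ)))

instance : IsAffine specC.left := inferInstanceAs (IsAffine (Spec (CommRingCat.of ℂ)))

/-- The ring homomorphism `ℂ → Γ(W, ⊤)` given by a morphism `W ⟶ Spec ℂ`. -/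
def toΓ {W : Scheme.{0}} (a : W ⟶ Spec (CommRingCat.of ℂ)) : CommRingCat.of ℂ ⟶ Γ(W, ⊤) :=
  (Scheme.ΓSpecIso (CommRingCat.of ℂ)).inv ≫ a.appTop

lemma toΓ_injective {W : Scheme.{0}} {a b : W ⟶ Spec (CommRingCat.of ℂ)} (h : toΓ a = toΓ b) :
    a = b :=
  ext_of_isAffine ((cancel_epi _).1 h)

lemma toΓ_comp {W W' : Scheme.{0}} (k : W' ⟶ W) (a : W ⟶ Spec (CommRingCat.of ℂ)) :
    toΓ (k ≫ a) = toΓ a ≫ k.appTop := by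
  simp [toΓ]

lemma toΓ_comp_map {W : Scheme.{0}} (a : W ⟶ Spec (CommRingCat.of ℂ))
    (φ : CommRingCat.of ℂ ⟶ CommRingCat.of ℂ) : toΓ (a ≫ Spec.map φ) = φ ≫ toΓ a := by
  rw [toΓ, toΓ, Scheme.Hom.comp_appTop, ← Scheme.ΓSpecIso_inv_naturality_assoc]

lemma toΓ_ofReal {W : Scheme.{0}} {a b : W ⟶ Spec (CommRingCat.of ℂ)}
    (h : a ≫ specC.hom = b ≫ specC.hom) (r : ℝ) : (toΓ a).hom (r : ℂ) = (toΓ b).hom (r : ℂ) := by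
  have key : ∀ c : W ⟶ Spec (CommRingCat.of ℂ), CommRingCat.ofHom (algebraMap ℝ ℂ) ≫ toΓ c =
      (Scheme.ΓSpecIso (CommRingCat.of ℝ)).inv ≫ (c ≫ specC.hom).appTop := by
    intro c
    have e : c ≫ specC.hom = c ≫ Spec.map (CommRingCat.ofHom (algebraMap ℝ ℂ)) := rfl
    rw [e, toΓ, Scheme.Hom.comp_appTop, ← Scheme.ΓSpecIso_inv_naturality_assoc]
  have := (key a).trans ((congrArg (fun k => _ ≫ Scheme.Hom.appTop k) h).trans (key b).symm)
  exact congrArg (fun k => k.hom r) this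

lemma ringHom_complex_ext {R : Type*} [CommRing R] {u v : ℂ →+* R}
    (h : ∀ r : ℝ, u r = v r) (hI : u Complex.I = v Complex.I) : u = v := by
  ext z
  have hz := Complex.re_add_im z
  rw [← hz, map_add, map_add, map_mul, map_mul, h, h, hI]

/-- Any two morphisms to `Spec ℂ` over `ℝ` are, locally on the source, equal or conjugate. -/
lemma exists_opens_eq_or_conj {W : Scheme.{0}} (a b : W ⟶ Spec (CommRingCat.of ℂ))
    (h : a ≫ specC.hom = b ≫ specC.hom) :
    ∃ U V : W.Opens, U ⊔ V = ⊤ ∧ U.ι ≫ a = U.ι ≫ b ∧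
      V.ι ≫ a ≫ (specGal conjC2).left = V.ι ≫ b := by
  let i := (toΓ a).hom Complex.I
  let k := (toΓ b).hom Complex.I
  have hsq : (i + k) * (i - k) = 0 := by
    have h₁ : i * i = -1 := by rw [← map_mul, Complex.I_mul_I, map_neg, map_one]
    have h₂ : k * k = -1 := by rw [← map_mul, Complex.I_mul_I, map_neg, map_one]
    linear_combination h₁ - h₂
  have hu : IsUnit ((i + k) + (i - k)) := by
    have : (i + k) + (i - k) = (toΓ a).hom (2 * Complex.I) := by
      rw [map_mul, map_ofNat]
      ring
    rw [this]
    exact (IsUnit.mk0 (2 * Complex.I) (by simp)).map (toΓ a).hom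
  have hunit : ∀ s : Γ(W, ⊤), IsUnit ((W.basicOpen s).ι.appTop.hom s) := by
    intro s
    have h₁ : IsUnit (W.presheaf.map (homOfLE (W.basicOpen_le s)).op s) :=
      RingedSpace.isUnit_res_basicOpen W.toRingedSpace s
    have h₂ := h₁.map (W.presheaf.map (homOfLE (W.basicOpen s).ι_image_top.le).op).hom
    rw [← CommRingCat.comp_apply, ← Functor.map_comp] at h₂
    exact h₂
  refine ⟨W.basicOpen (i + k), W.basicOpen (i - k), ?_, ?_, ?_⟩
  · exact eq_top_iff.2 ((Scheme.basicOpen_of_isUnit _ hu).ge.trans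
      (Scheme.basicOpen_add_le W (i + k) (i - k)))
  · apply toΓ_injective
    rw [toΓ_comp, toΓ_comp]
    apply CommRingCat.hom_ext
    apply ringHom_complex_ext
    · intro r
      exact congrArg (W.basicOpen (i + k)).ι.appTop.hom (toΓ_ofReal h r)
    · have := congrArg (W.basicOpen (i + k)).ι.appTop.hom hsq
      rw [map_mul, map_zero, (hunit _).mul_right_eq_zero, map_sub, sub_eq_zero] at this
      exact this
  · apply toΓ_injective
    change toΓ ((W.basicOpen (i - k)).ι ≫
      (a ≫ Spec.map (CommRingCat.ofHom ((conjC2 : ℂ ≃ₐ[ℝ] ℂ) : ℂ →+* ℂ)))) = _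
    rw [toΓ_comp (W.basicOpen (i - k)).ι, toΓ_comp_map, toΓ_comp]
    apply CommRingCat.hom_ext
    apply ringHom_complex_ext
    · intro r
      refine Eq.trans ?_ (congrArg (W.basicOpen (i - k)).ι.appTop.hom (toΓ_ofReal h r))
      change (W.basicOpen (i - k)).ι.appTop.hom ((toΓ a).hom (conjC2 (r : ℂ))) = _
      rw [conjC2, Complex.conjAe_coe, Complex.conj_ofReal]
    · have := congrArg (W.basicOpen (i - k)).ι.appTop.hom hsq
      rw [map_mul, map_zero, (hunit _).mul_left_eq_zero, map_add] at this
      change (W.basicOpen (i - k)).ι.appTop.hom ((toΓ a).hom (conjC2 Complex.I)) =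
        (W.basicOpen (i - k)).ι.appTop.hom k
      rw [conjC2, Complex.conjAe_coe, Complex.conj_I, map_neg, map_neg]
      exact neg_eq_of_add_eq_zero_right this

lemma Scheme.hom_ext_of_sup_eq_top {W Z : Scheme.{0}} {f g : W ⟶ Z} (U V : W.Opens)
    (h : U ⊔ V = ⊤) (hU : U.ι ≫ f = U.ι ≫ g) (hV : V.ι ≫ f = V.ι ≫ g) : f = g := by
  have hc : TopologicalSpace.IsOpenCover (fun b : Bool => cond b U V) := by
    rw [TopologicalSpace.IsOpenCover, iSup_bool_eq]
    exact h
  refine (W.openCoverOfIsOpenCover _ hc).hom_ext _ _ fun b => ?_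
  cases b
  · exact hV
  · exact hU

section Descent

variable {Y Y₀ Z : SchR} {π : Y ⟶ Y₀} {q : Y ⟶ specC} {q₀ : Y₀ ⟶ specR}

lemma etale_of_isPullback_specCToR (h : IsPullback π q q₀ specCToR) : Etale π.left :=
  MorphismProperty.of_isPullback (P := @Etale) (isPullback_left h).flip inferInstance

lemma surjective_of_isPullback_specCToR (h : IsPullback π q q₀ specCToR) : Surjective π.left :=
  MorphismProperty.of_isPullback (P := @Surjective) (isPullback_left h).flip inferInstance

lemma epi_of_isPullback_specCToR (h : IsPullback π q q₀ specCToR) : Epi π := by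
  have := etale_of_isPullback_specCToR h
  have := surjective_of_isPullback_specCToR h
  have : EffectiveEpi π.left := inferInstance
  exact Over.epi_of_epi_left π

/-- A morphism out of the complexification `Y` of a real scheme `Y₀` descends to `Y₀` as soon as it
is invariant under complex conjugation: the morphism `Y ⟶ Y₀` is an effective epimorphism, and
locally any two points of `Y` over the same point of `Y₀` are equal or conjugate. -/
lemma exists_descent (h : IsPullback π q q₀ specCToR) {e : Y ⟶ Y} (he : e ≫ π = π)
    (heq : e ≫ q = q ≫ specGal conjC2) {f : Y ⟶ Z} (hf : e ≫ f = f) :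
    ∃ f₀ : Y₀ ⟶ Z, π ≫ f₀ = f := by
  have := etale_of_isPullback_specCToR h
  have := surjective_of_isPullback_specCToR h
  have : EffectiveEpi π.left := inferInstance
  have hl := isPullback_left h
  have key : ∀ {W : Scheme.{0}} (g₁ g₂ : W ⟶ Y.left), g₁ ≫ π.left = g₂ ≫ π.left →
      g₁ ≫ f.left = g₂ ≫ f.left := by
    intro W g₁ g₂ hg
    have hY : g₁ ≫ Y.hom = g₂ ≫ Y.hom := by
      rw [← Over.w π, reassoc_of% hg]
    have hq : (g₁ ≫ q.left) ≫ specC.hom = (g₂ ≫ q.left) ≫ specC.hom := by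
      rw [Category.assoc, Category.assoc, Over.w q, hY]
    obtain ⟨U, V, hUV, hU, hV⟩ := exists_opens_eq_or_conj (g₁ ≫ q.left) (g₂ ≫ q.left) hq
    have he' : e.left ≫ π.left = π.left := congrArg CommaMorphism.left he
    have heq' : e.left ≫ q.left = q.left ≫ (specGal conjC2).left := congrArg CommaMorphism.left heq
    have hf' : e.left ≫ f.left = f.left := congrArg CommaMorphism.left hf
    refine Scheme.hom_ext_of_sup_eq_top U V hUV ?_ ?_
    · have : U.ι ≫ g₁ = U.ι ≫ g₂ := by
        apply hl.hom_ext
        · rw [Category.assoc, Category.assoc, hg]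
        · rw [Category.assoc, Category.assoc]
          exact hU
      rw [reassoc_of% this]
    · have : V.ι ≫ g₁ ≫ e.left = V.ι ≫ g₂ := by
        apply hl.hom_ext
        · rw [Category.assoc, Category.assoc, Category.assoc, he', hg]
        · rw [Category.assoc, Category.assoc, Category.assoc, heq']
          exact (congrArg (V.ι ≫ ·) (Category.assoc _ _ _).symm).trans hV
      rw [← reassoc_of% this, hf']
  have hd : π.left ≫ EffectiveEpi.desc π.left f.left key = f.left := EffectiveEpi.fac _ _ _
  refine ⟨Over.homMk (EffectiveEpi.desc π.left f.left key) ?_, ?_⟩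
  · rw [← cancel_epi π.left, reassoc_of% hd, Over.w, Over.w]
  · ext : 1
    exact hd

end Descent

/-! ### Galois descent of affine schemes -/

section Ring

variable {B : CommRingCat.{0}} (u : CommRingCat.of ℂ ⟶ B) (σ : B ⟶ B)

/-- The subring of invariants of an endomorphism of a ring. -/
def fixedRing : Subring B := RingHom.eqLocus σ.hom (RingHom.id B)

/-- The inclusion of the subring of invariants. -/
def fixedIncl : CommRingCat.of (fixedRing σ) ⟶ B := CommRingCat.ofHom (fixedRing σ).subtype

variable {σ} (hσu : ∀ z : ℂ, σ.hom (u.hom z) = u.hom (starRingEnd ℂ z))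

/-- The structure of a real algebra on the invariants of a semilinear endomorphism of a complex
algebra. -/
def realToFixed : CommRingCat.of ℝ ⟶ CommRingCat.of (fixedRing σ) :=
  CommRingCat.ofHom ((u.hom.comp (algebraMap ℝ ℂ)).codRestrict (fixedRing σ) fun r => by
    change σ.hom (u.hom (r : ℂ)) = u.hom (r : ℂ)
    rw [hσu, Complex.conj_ofReal])

/-- A complex algebra `B` with a semilinear involution `σ` is the complexification of its ring of
invariants: every `b` is `a + i c` for the invariants `a = (b + σ b) / 2` and
`c = i (σ b - b) / 2`. -/
lemma isPushout_fixedRing (hσ : ∀ b, σ.hom (σ.hom b) = b) :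
    IsPushout (realToFixed u hσu) (CommRingCat.ofHom (algebraMap ℝ ℂ)) (fixedIncl σ) u := by
  have hI : u.hom Complex.I * u.hom Complex.I = -1 := by
    rw [← map_mul, Complex.I_mul_I, map_neg, map_one]
  have h2 : u.hom (1 / 2) * 2 = 1 := by
    rw [← map_ofNat u.hom 2, ← map_mul]
    norm_num
  have hσI : σ.hom (u.hom Complex.I) = - u.hom Complex.I := by
    rw [hσu, Complex.conj_I, map_neg]
  have hσ2 : σ.hom (u.hom (1 / 2)) = u.hom (1 / 2) := by
    rw [hσu]
    congr 1
    rw [map_div₀, map_one, map_ofNat]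
  let re : B → fixedRing σ := fun b => ⟨u.hom (1 / 2) * (b + σ.hom b), by
    change σ.hom (u.hom (1 / 2) * (b + σ.hom b)) = u.hom (1 / 2) * (b + σ.hom b)
    rw [map_mul, map_add, hσ, hσ2, add_comm]⟩
  let im : B → fixedRing σ := fun b => ⟨u.hom (1 / 2) * (u.hom Complex.I * (σ.hom b - b)), by
    change σ.hom (u.hom (1 / 2) * (u.hom Complex.I * (σ.hom b - b))) =
      u.hom (1 / 2) * (u.hom Complex.I * (σ.hom b - b))
    rw [map_mul, map_mul, map_sub, hσ, hσ2, hσI]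
    ring⟩
  have hre : ∀ b, (re b : B) = u.hom (1 / 2) * (b + σ.hom b) := fun _ => rfl
  have him : ∀ b, (im b : B) = u.hom (1 / 2) * (u.hom Complex.I * (σ.hom b - b)) := fun _ => rfl
  have hdec : ∀ b, b = (re b : B) + u.hom Complex.I * (im b : B) := by
    intro b
    rw [hre, him]
    linear_combination (- b) * h2 - u.hom (1 / 2) * (σ.hom b - b) * hI
  have re_fix : ∀ a : fixedRing σ, re a = a := by
    intro a
    have ha : σ.hom (a : B) = a := a.2
    apply Subtype.ext
    rw [hre, ha]
    linear_combination (a : B) * h2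
  have im_fix : ∀ a : fixedRing σ, im a = 0 := by
    intro a
    have ha : σ.hom (a : B) = a := a.2
    apply Subtype.ext
    rw [him, ha]
    simp
  have re_add : ∀ a b, re (a + b) = re a + re b := fun a b => Subtype.ext (by
    rw [Subring.coe_add, hre, hre, hre, map_add]
    ring)
  have im_add : ∀ a b, im (a + b) = im a + im b := fun a b => Subtype.ext (by
    rw [Subring.coe_add, him, him, him, map_add]
    ring)
  have re_mul : ∀ a b, re (a * b) = re a * re b - im a * im b := fun a b => Subtype.ext (by
    rw [AddSubgroupClass.coe_sub, Subring.coe_mul, Subring.coe_mul, hre, hre, hre, him, him,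
      map_mul]
    linear_combination (-u.hom (1 / 2) * (a * b + σ.hom a * σ.hom b)) * h2 +
      u.hom (1 / 2) * u.hom (1 / 2) * (σ.hom a - a) * (σ.hom b - b) * hI)
  have im_mul : ∀ a b, im (a * b) = re a * im b + im a * re b := fun a b => Subtype.ext (by
    rw [Subring.coe_add, Subring.coe_mul, Subring.coe_mul, hre, hre, him, him, him, map_mul]
    linear_combination (-u.hom (1 / 2) * u.hom Complex.I * (σ.hom a * σ.hom b - a * b)) * h2)
  have huz : ∀ z : ℂ, re (u.hom z) = (realToFixed u hσu).hom z.re ∧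
      im (u.hom z) = (realToFixed u hσu).hom z.im := by
    intro z
    constructor
    · apply Subtype.ext
      rw [hre, hσu, ← map_add, ← map_mul]
      change _ = u.hom (z.re : ℂ)
      congr 1
      rw [Complex.add_conj]
      push_cast
      ring
    · apply Subtype.ext
      rw [him, hσu, ← map_sub, ← map_mul, ← map_mul]
      change _ = u.hom (z.im : ℂ)
      congr 1
      have := Complex.sub_conj z
      push_cast at this
      linear_combination (- Complex.I / 2) * this - z.im * Complex.I_mul_I
  refine ⟨⟨rfl⟩, ⟨PushoutCocone.IsColimit.mk _ (fun s => CommRingCat.ofHom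
    { toFun := fun b => s.inl.hom (re b) + s.inr.hom Complex.I * s.inl.hom (im b)
      map_one' := ?_, map_zero' := ?_, map_add' := ?_, map_mul' := ?_ }) ?_ ?_ ?_⟩⟩
  · have h₁ := re_fix 1
    have h₂ := im_fix 1
    rw [Subring.coe_one] at h₁ h₂
    rw [h₁, h₂]
    simp
  · intro a b
    have hI' : s.inr.hom Complex.I * s.inr.hom Complex.I = -1 := by
      rw [← map_mul, Complex.I_mul_I, map_neg, map_one]
    rw [re_mul, im_mul, map_sub, map_add, map_mul, map_mul, map_mul, map_mul]
    linear_combination (- s.inl.hom (im a) * s.inl.hom (im b)) * hI'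
  · have h₁ := re_fix 0
    have h₂ := im_fix 0
    rw [Subring.coe_zero] at h₁ h₂
    rw [h₁, h₂]
    simp
  · intro a b
    rw [re_add, im_add, map_add, map_add]
    ring
  · intro s
    apply CommRingCat.hom_ext
    apply RingHom.ext
    intro a
    change s.inl.hom (re a) + s.inr.hom Complex.I * s.inl.hom (im a) = s.inl.hom a
    rw [re_fix, im_fix]
    simp
  · intro s
    have hs : ∀ r : ℝ, s.inl.hom ((realToFixed u hσu).hom r) = s.inr.hom (r : ℂ) := fun r =>
      congrArg (fun k => k.hom r) s.condition
    apply CommRingCat.hom_ext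
    apply RingHom.ext
    intro z
    change s.inl.hom (re (u.hom z)) + s.inr.hom Complex.I * s.inl.hom (im (u.hom z)) = s.inr.hom z
    rw [(huz z).1, (huz z).2, hs, hs, ← map_mul, ← map_add, mul_comm, Complex.re_add_im]
  · intro s m h₁ h₂
    apply CommRingCat.hom_ext
    apply RingHom.ext
    intro b
    change m.hom b = s.inl.hom (re b) + s.inr.hom Complex.I * s.inl.hom (im b)
    have e := (congrArg m.hom (hdec b)).trans
      ((map_add m.hom _ _).trans (congrArg (m.hom (re b : B) + ·) (map_mul m.hom _ _)))
    rw [← h₁, ← h₂]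
    exact e

end Ring

lemma isPullback_of_left {W X Y S : SchR} {fst : W ⟶ X} {snd : W ⟶ Y} {f : X ⟶ S} {g : Y ⟶ S}
    (h : IsPullback fst.left snd.left f.left g.left) : IsPullback fst snd f g :=
  IsPullback.of_map (Over.forget _) (by ext : 1; exact h.w) h

lemma isoSpec_hom_comp_map_toΓ {Y : Scheme.{0}} [IsAffine Y] (a : Y ⟶ Spec (CommRingCat.of ℂ)) :
    Y.isoSpec.hom ≫ Spec.map (toΓ a) = a := by
  rw [toΓ, Spec.map_comp, Scheme.isoSpec_hom_naturality_assoc]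
  simp [Scheme.isoSpec]

/-- An affine scheme over `ℂ` with a semilinear involution is the complexification of a real
scheme, the spectrum of the ring of invariant functions. -/
lemma exists_descent_of_isAffine {Y : SchR} [IsAffine Y.left] {q : Y ⟶ specC} {e : Y ⟶ Y}
    (heq : e ≫ q = q ≫ specGal conjC2) (hee : e ≫ e = 𝟙 Y) :
    ∃ (Y₀ : SchR) (π : Y ⟶ Y₀) (q₀ : Y₀ ⟶ specR), IsPullback π q q₀ specCToR ∧ e ≫ π = π := by
  let σ := e.left.appTop
  let q' : Y.left ⟶ Spec (CommRingCat.of ℂ) := q.left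
  have hq' : e.left ≫ q' =
      q' ≫ Spec.map (CommRingCat.ofHom ((conjC2 : ℂ ≃ₐ[ℝ] ℂ) : ℂ →+* ℂ)) :=
    congrArg CommaMorphism.left heq
  let u := toΓ q'
  have hσ : ∀ b, σ.hom (σ.hom b) = b := by
    intro b
    have h : σ ≫ σ = 𝟙 _ := by
      change e.left.appTop ≫ e.left.appTop = _
      rw [← Scheme.Hom.comp_appTop]
      have : e.left ≫ e.left = 𝟙 _ := congrArg CommaMorphism.left hee
      rw [this, Scheme.Hom.id_appTop]
    exact congrArg (fun k => k.hom b) h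
  have hσu : ∀ z : ℂ, σ.hom (u.hom z) = u.hom (starRingEnd ℂ z) := by
    intro z
    have h : u ≫ σ = CommRingCat.ofHom ((conjC2 : ℂ ≃ₐ[ℝ] ℂ) : ℂ →+* ℂ) ≫ u := by
      change toΓ q' ≫ e.left.appTop = _ ≫ toΓ q'
      rw [← toΓ_comp, ← toΓ_comp_map, hq']
    exact congrArg (fun k => k.hom z) h
  have hp := isPullback_SpecMap_of_isPushout _ _ _ _ (isPushout_fixedRing u hσu hσ)
  let Y₀ : SchR := Over.mk (Spec.map (realToFixed u hσu))
  let π : Y ⟶ Y₀ := Over.homMk (Y.left.isoSpec.hom ≫ Spec.map (fixedIncl σ)) (by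
    change (Y.left.isoSpec.hom ≫ Spec.map (fixedIncl σ)) ≫ Spec.map (realToFixed u hσu) = _
    rw [Category.assoc, hp.w, ← Category.assoc, isoSpec_hom_comp_map_toΓ]
    exact Over.w q)
  let q₀ : Y₀ ⟶ specR := Over.homMk Y₀.hom (Category.comp_id _)
  refine ⟨Y₀, π, q₀, isPullback_of_left ?_, ?_⟩
  · have h : IsPullback (Y.left.isoSpec.hom ≫ Spec.map (fixedIncl σ)) q'
        (Spec.map (realToFixed u hσu)) (Spec.map (CommRingCat.ofHom (algebraMap ℝ ℂ))) := by
      refine hp.of_iso Y.left.isoSpec.symm (Iso.refl _) (Iso.refl _) (Iso.refl _) (by simp) ?_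
        (by simp) (by simp)
      rw [Iso.symm_hom, Iso.refl_hom, Category.comp_id, Iso.eq_inv_comp]
      exact isoSpec_hom_comp_map_toΓ q'
    exact h
  · ext : 1
    change e.left ≫ Y.left.isoSpec.hom ≫ Spec.map (fixedIncl σ) =
      Y.left.isoSpec.hom ≫ Spec.map (fixedIncl σ)
    rw [← Scheme.isoSpec_hom_naturality_assoc, ← Spec.map_comp]
    congr 2
    apply CommRingCat.hom_ext
    apply RingHom.ext
    intro a
    exact a.2

/-! ### Galois descent of torsors -/

lemma hom_specR_ext {T : SchR} (a b : T ⟶ specR) : a = b := by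
  ext : 1
  exact ((Category.comp_id _).symm.trans (Over.w a)).trans
    ((Category.comp_id _).symm.trans (Over.w b)).symm

/-- The morphism `π : Y ⟶ Y₀` exhibits `q : Y ⟶ Spec ℂ` as the complexification of the real scheme
`Y₀`, and `e` is the complex conjugation of `Y`. -/
structure IsComplexification {Y Y₀ : SchR} (π : Y ⟶ Y₀) (q : Y ⟶ specC) (q₀ : Y₀ ⟶ specR)
    (e : Y ⟶ Y) : Prop where
  isPullback : IsPullback π q q₀ specCToR
  comp_π : e ≫ π = π
  comp_q : e ≫ q = q ≫ specGal conjC2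

namespace IsComplexification

variable {Y Y₀ Z : SchR} {π : Y ⟶ Y₀} {q : Y ⟶ specC} {q₀ : Y₀ ⟶ specR} {e : Y ⟶ Y}
  (h : IsComplexification π q q₀ e)

include h

lemma epi : Epi π := epi_of_isPullback_specCToR h.isPullback

lemma exists_fac {f : Y ⟶ Z} (hf : e ≫ f = f) : ∃ f₀ : Y₀ ⟶ Z, π ≫ f₀ = f :=
  exists_descent h.isPullback h.comp_π h.comp_q hf

lemma whiskerLeft (G : SchR) :
    IsComplexification (G ◁ π) (snd G Y ≫ q) (snd G Y₀ ≫ q₀) (G ◁ e) where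
  isPullback := (isPullback_whiskerLeft_snd G π).paste_vert h.isPullback
  comp_π := by rw [← MonoidalCategory.whiskerLeft_comp, h.comp_π]
  comp_q := by rw [whiskerLeft_snd_assoc, h.comp_q, Category.assoc]

end IsComplexification

lemma isComplexification_pullback {Y₀ : SchR} (q₀ : Y₀ ⟶ specR) :
    IsComplexification (pullback.snd specCToR q₀) (pullback.fst specCToR q₀) q₀
      (pullbackEnd q₀ specCToR (specGal conjC2) (specGal_comp conjC2)) where
  isPullback := (IsPullback.of_hasPullback _ _).flip
  comp_π := pullbackEnd_snd _ _ _ _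
  comp_q := pullbackEnd_fst _ _ _ _

section Descent

variable {G Y Y₀ : SchR} [GrpObj G] [ModObj G Y] {π : Y ⟶ Y₀} {q : Y ⟶ specC} {q₀ : Y₀ ⟶ specR}
  {e : Y ⟶ Y}

/-- A `G`-action on a complex scheme that commutes with complex conjugation descends. -/
lemma IsComplexification.exists_action (h : IsComplexification π q q₀ e)
    (he : act G Y ≫ e = G ◁ e ≫ act G Y) :
    ∃ _ : ModObj G Y₀, act G Y ≫ π = G ◁ π ≫ act G Y₀ := by
  obtain ⟨a, ha⟩ := (h.whiskerLeft G).exists_fac (f := act G Y ≫ π)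
    (by rw [← Category.assoc, ← he, Category.assoc, h.comp_π])
  refine ⟨{ smul := a, one_smul := ?_, mul_smul := ?_ }, ha.symm⟩
  · change MonObj.one (X := G) ▷ Y₀ ≫ a = (λ_ Y₀).hom
    have := (h.whiskerLeft (𝟙_ SchR)).epi
    rw [← cancel_epi (𝟙_ SchR ◁ π), whisker_exchange_assoc, ha, ← Category.assoc, one_act,
      leftUnitor_naturality]
  · change MonObj.mul (X := G) ▷ Y₀ ≫ a = (α_ G G Y₀).hom ≫ G ◁ a ≫ a
    have := (h.whiskerLeft (G ⊗ G)).epi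
    rw [← cancel_epi ((G ⊗ G) ◁ π), whisker_exchange_assoc, ha, ← Category.assoc, mul_act]
    rw [Category.assoc, Category.assoc, ← ha, associator_naturality_right_assoc,
      ← whiskerLeft_comp_assoc, ← whiskerLeft_comp_assoc, ha]

/-- If the complexification of `Y₀` is a torsor over `Spec ℂ`, then the action on `Y₀` is simply
transitive: for points `a`, `b` of `Y₀` with values in `T`, the element of `G` moving `b` to `a`
exists over the complexification of `T`, and it is invariant by uniqueness. -/
lemma IsComplexification.isPullback_act [ModObj G Y₀] (h : IsComplexification π q q₀ e)
    (he : act G Y ≫ e = G ◁ e ≫ act G Y) (hπ : act G Y ≫ π = G ◁ π ≫ act G Y₀)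
    (hY : IsPullback (act G Y) (snd G Y) q q) : IsPullback (act G Y₀) (snd G Y₀) q₀ q₀ := by
  have key : ∀ (T : SchR) (a b : T ⟶ Y₀), ∃ g : T ⟶ G, lift g b ≫ act G Y₀ = a ∧
      ∀ m : T ⟶ G ⊗ Y₀, m ≫ act G Y₀ = a → m ≫ snd G Y₀ = b → m ≫ fst G Y₀ = g := by
    intro T a b
    let T' := pullback specCToR (a ≫ q₀)
    let r : T' ⟶ T := pullback.snd specCToR (a ≫ q₀)
    let s : T' ⟶ specC := pullback.fst specCToR (a ≫ q₀)
    let c : T' ⟶ T' := pullbackEnd (a ≫ q₀) specCToR (specGal conjC2) (specGal_comp conjC2)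
    have hT : IsComplexification r s (a ≫ q₀) c := isComplexification_pullback _
    have hr : Epi r := hT.epi
    have hab : a ≫ q₀ = b ≫ q₀ := hom_specR_ext _ _
    let a' : T' ⟶ Y := h.isPullback.lift (r ≫ a) s (by rw [Category.assoc, hT.isPullback.w])
    let b' : T' ⟶ Y := h.isPullback.lift (r ≫ b) s
      (by rw [Category.assoc, ← hab, hT.isPullback.w])
    have ha₁ : a' ≫ π = r ≫ a := h.isPullback.lift_fst _ _ _
    have ha₂ : a' ≫ q = s := h.isPullback.lift_snd _ _ _
    have hb₁ : b' ≫ π = r ≫ b := h.isPullback.lift_fst _ _ _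
    have hb₂ : b' ≫ q = s := h.isPullback.lift_snd _ _ _
    have hca : c ≫ a' = a' ≫ e := by
      apply h.isPullback.hom_ext
      · rw [Category.assoc, Category.assoc, ha₁, h.comp_π, ha₁, ← Category.assoc, hT.comp_π]
      · rw [Category.assoc, Category.assoc, ha₂, h.comp_q, reassoc_of% ha₂, hT.comp_q]
    have hcb : c ≫ b' = b' ≫ e := by
      apply h.isPullback.hom_ext
      · rw [Category.assoc, Category.assoc, hb₁, h.comp_π, hb₁, ← Category.assoc, hT.comp_π]
      · rw [Category.assoc, Category.assoc, hb₂, h.comp_q, reassoc_of% hb₂, hT.comp_q]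
    let k : T' ⟶ G ⊗ Y := hY.lift a' b' (ha₂.trans hb₂.symm)
    have hk₁ : k ≫ act G Y = a' := hY.lift_fst _ _ _
    have hk₂ : k ≫ snd G Y = b' := hY.lift_snd _ _ _
    have hck : c ≫ k = k ≫ G ◁ e := by
      apply hY.hom_ext
      · rw [Category.assoc, Category.assoc, hk₁, hca, ← he, reassoc_of% hk₁]
      · rw [Category.assoc, Category.assoc, hk₂, hcb, whiskerLeft_snd, reassoc_of% hk₂]
    obtain ⟨g, hg⟩ := hT.exists_fac (f := k ≫ fst G Y) (by
      rw [reassoc_of% hck, whiskerLeft_fst])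
    refine ⟨g, ?_, fun m hm₁ hm₂ => ?_⟩
    · have e₁ : r ≫ lift g b = k ≫ G ◁ π := by
        ext
        · simp [hg]
        · simp [← hb₁, reassoc_of% hk₂]
      rw [← cancel_epi r, reassoc_of% e₁, ← hπ, reassoc_of% hk₁, ha₁]
    · let m' : T' ⟶ G ⊗ Y := lift (r ≫ m ≫ fst G Y₀) b'
      have hm' : m' ≫ G ◁ π = r ≫ m := by
        ext
        · simp [m']
        · simp [m', hb₁, hm₂]
      have hmk : m' = k := by
        apply hY.hom_ext
        · rw [hk₁]
          apply h.isPullback.hom_ext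
          · rw [Category.assoc, hπ, reassoc_of% hm', hm₁, ha₁]
          · rw [Category.assoc, hY.w, ha₂]
            simp [m', hb₂]
        · rw [hk₂]
          simp [m']
      rw [← cancel_epi r, hg, ← hmk]
      simp [m']
  refine ⟨⟨hom_specR_ext _ _⟩, ⟨PullbackCone.IsLimit.mk _
    (fun s => lift (key s.pt s.fst s.snd).choose s.snd)
    (fun s => (key s.pt s.fst s.snd).choose_spec.1) (fun s => lift_snd _ _) fun s m h₁ h₂ => ?_⟩⟩
  apply CartesianMonoidalCategory.hom_ext
  · rw [lift_fst]
    exact (key s.pt s.fst s.snd).choose_spec.2 m h₁ h₂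
  · rw [lift_snd, h₂]

end Descent

namespace Torsor

variable {G : SchR} [GrpObj G]

/-- Torsors over `Spec ℂ` are trivial. -/
lemma exists_section (P : Torsor G specC) : ∃ y : specC ⟶ P.P, y ≫ P.p = 𝟙 specC := by
  obtain ⟨S', u, t, hu, _, -, hP⟩ := P.locally_trivial
  obtain ⟨x, hx⟩ := u.left.surjective
    (default : (Spec (CommRingCat.of ℂ)))
  let u' : S'.left ⟶ Spec (CommRingCat.of ℂ) := u.left
  have : Etale u' := hu
  obtain ⟨l, hl, -⟩ := Scheme.exists_fac_of_etale_of_isSepClosed (f := u')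
    (𝟙 (Spec (CommRingCat.of ℂ))) x hx
  let l' : specC ⟶ S' := Over.homMk l (by
    exact (congrArg (l ≫ ·) (Over.w u)).symm.trans ((Category.assoc l u' specC.hom).symm.trans
      ((congrArg (· ≫ specC.hom) hl).trans (Category.id_comp _))))
  have hl' : l' ≫ u = 𝟙 specC := by
    ext : 1
    exact hl
  refine ⟨lift (toUnit _ ≫ MonObj.one) l' ≫ t, ?_⟩
  rw [Category.assoc, hP.w, lift_snd_assoc, hl']

/-- The orbit map of a section of a torsor is an isomorphism. -/
lemma isPullback_orbit {S : SchR} (P : Torsor G S) {y : S ⟶ P.P} (hy : y ≫ P.p = 𝟙 S) :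
    IsPullback (G ◁ y ≫ act G P.P) (snd G S) P.p (𝟙 S) := by
  have := (isPullback_whiskerLeft_snd G y).paste_horiz P.isPullback_act
  rwa [hy] at this

lemma isAffine [IsAffineHom G.hom] (P : Torsor G specC) : IsAffine P.P.left := by
  obtain ⟨y, hy⟩ := P.exists_section
  have h := P.isPullback_orbit hy
  have : IsIso (G ◁ y ≫ act G P.P) := h.isIso_fst_of_isIso
  have : IsIso (G ◁ y ≫ act G P.P).left :=
    inferInstanceAs (IsIso ((Over.forget _).map (G ◁ y ≫ act G P.P)))
  have : IsAffineHom (toUnit G).left := inferInstanceAs (IsAffineHom G.hom)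
  have : IsAffineHom (snd G specC).left :=
    MorphismProperty.of_isPullback (P := @IsAffineHom)
      (isPullback_left (isPullback_fst_snd G specC)) this
  have : IsAffine (G ⊗ specC).left := isAffine_of_isAffineHom (snd G specC).left
  exact IsAffine.of_isIso (inv (G ◁ y ≫ act G P.P).left)

/-- Galois descent: a torsor over `Spec ℂ` with an equivariant semilinear involution comes from a
torsor over `Spec ℝ`. -/
lemma exists_descent [IsAffineHom G.hom] (P : Torsor G specC) {e : P.P ⟶ P.P}
    (hp : e ≫ P.p = P.p ≫ specGal conjC2) (he : act G P.P ≫ e = G ◁ e ≫ act G P.P)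
    (hee : e ≫ e = 𝟙 P.P) :
    ∃ (P₀ : Torsor G specR) (π : P.P ⟶ P₀.P), IsComplexification π P.p P₀.p e ∧
      act G P.P ≫ π = G ◁ π ≫ act G P₀.P := by
  have := P.isAffine
  obtain ⟨Y₀, π, q₀, hpb, hπ⟩ := exists_descent_of_isAffine hp hee
  have h : IsComplexification π P.p q₀ e := ⟨hpb, hπ, hp⟩
  obtain ⟨_, ha⟩ := h.exists_action he
  refine ⟨⟨Y₀, q₀, h.isPullback_act he ha P.isPullback_act, ?_⟩, π, h, ha⟩
  obtain ⟨S', u, t, _, _, ht, hP⟩ := P.locally_trivial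
  refine ⟨S', u ≫ specCToR, t ≫ π, ?_, ?_, ?_, hP.paste_horiz hpb⟩
  · exact (inferInstance : Etale (u.left ≫ specCToR.left))
  · exact (inferInstance : Surjective (u.left ≫ specCToR.left))
  · rw [← Category.assoc, ht, Category.assoc, Category.assoc, ha, ← whiskerLeft_comp_assoc]

end Torsor

section

open scoped MonObj

/-! ### Equivariant families of morphisms out of a torsor -/

namespace ComplexPoints

variable {G W X Y Z S : SchR}

lemma map_id (x : ComplexPoints X) : x.map (𝟙 X) = x := by
  let f : specC ⟶ X := x
  exact Category.comp_id f

lemma map_comp (f : X ⟶ Y) (g : Y ⟶ Z) (x : ComplexPoints X) : x.map (f ≫ g) = (x.map f).map g := by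
  let k : specC ⟶ X := x
  exact (Category.assoc k f g).symm

/-- A pair of complex points of the factors of a fibre product over the same point of the base is a
complex point of the fibre product. -/
lemma exists_of_isPullback {fst : W ⟶ X} {snd : W ⟶ Y} {f : X ⟶ S} {g : Y ⟶ S}
    (h : IsPullback fst snd f g) {x : ComplexPoints X} {y : ComplexPoints Y}
    (hxy : x.map f = y.map g) : ∃ w : ComplexPoints W, w.map fst = x ∧ w.map snd = y := by
  let x' : specC ⟶ X := x
  let y' : specC ⟶ Y := y
  let w : specC ⟶ W := h.lift x' y' hxy
  exact ⟨w, h.lift_fst _ _ _, h.lift_snd _ _ _⟩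

lemma ext_of_isPullback {fst : W ⟶ X} {snd : W ⟶ Y} {f : X ⟶ S} {g : Y ⟶ S}
    (h : IsPullback fst snd f g) {v w : ComplexPoints W} (h₁ : v.map fst = w.map fst)
    (h₂ : v.map snd = w.map snd) : v = w := by
  let v' : specC ⟶ W := v
  let w' : specC ⟶ W := w
  exact h.hom_ext (show v' ≫ fst = w' ≫ fst from h₁) h₂

variable [GrpObj G] [ModObj G X] [ModObj G Y]

lemma smul_map {f : X ⟶ Y} (hf : act G X ≫ f = G ◁ f ≫ act G Y) (g : ComplexPoints G)
    (x : ComplexPoints X) : (g • x).map f = g • x.map f := by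
  rw [smul_eq, smul_eq, ← map_comp, hf, map_comp]
  congr 1
  refine ext_of_isPullback (isPullback_fst_snd G Y) ?_ ?_
  · rw [← map_comp, whiskerLeft_fst, map_fst_pair, map_fst_pair]
  · rw [← map_comp, whiskerLeft_snd, map_snd_pair, map_comp, map_snd_pair]

end ComplexPoints

section Eval

variable {G : SchR} [GrpObj G] {Z : Type*} [TopologicalSpace Z]

lemma continuous_pointwise_iff {Y W : SchR} {F : Z → (Y ⟶ W)} :
    Continuous[inferInstance, pointwiseTopology Y W] F ↔
      ∀ y : ComplexPoints Y, Continuous fun z => y.map (F z) := by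
  rw [continuous_iInf_rng]
  exact forall_congr' fun y => continuous_induced_rng

lemma continuous_torsorHom_iff {S : SchR} {P Q : Torsor G S} {F : Z → Torsor.Hom P Q} :
    Continuous F ↔ ∀ y : ComplexPoints P.P, Continuous fun z => y.map (F z).iso.hom :=
  continuous_induced_rng.trans continuous_pointwise_iff

lemma continuous_equivariantMap_iff {P X : SchR} [ModObj G P] [ModObj G X]
    {F : Z → EquivariantMap G P X} :
    Continuous F ↔ ∀ y : ComplexPoints P, Continuous fun z => y.map (F z).1 :=
  continuous_induced_rng.trans continuous_pointwise_iff

end Eval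

namespace Torsor

variable {G : SchR} [GrpObj G] {S : SchR} (P : Torsor G S) {X : SchR} [ModObj G X]
  {Z : Type*} [TopologicalSpace Z]

lemma exists_smul_eq {x y : ComplexPoints P.P} (h : x.map P.p = y.map P.p) :
    ∃ g : ComplexPoints G, g • y = x := by
  obtain ⟨w, h₁, h₂⟩ := ComplexPoints.exists_of_isPullback P.isPullback_act h
  refine ⟨w.map (fst G P.P), ?_⟩
  rw [ComplexPoints.smul_eq, ← h₁]
  congr 1
  refine ComplexPoints.ext_of_isPullback (isPullback_fst_snd G P.P) ?_ ?_
  · rw [ComplexPoints.map_fst_pair]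
  · rw [ComplexPoints.map_snd_pair, h₂]

lemma smul_left_injective (y : ComplexPoints P.P) :
    Function.Injective fun g : ComplexPoints G => g • y := by
  intro g g' h
  have e : g.pair y = g'.pair y := by
    refine ComplexPoints.ext_of_isPullback P.isPullback_act h ?_
    rw [ComplexPoints.map_snd_pair, ComplexPoints.map_snd_pair]
  rw [← ComplexPoints.map_fst_pair g y, e, ComplexPoints.map_fst_pair]

variable {P} {Q R : Torsor G S}

lemma Hom.map_p (φ : Hom P Q) (x : ComplexPoints P.P) : (x.map φ.iso.hom).map Q.p = x.map P.p := by
  rw [← ComplexPoints.map_comp, φ.comp_p]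

/-- The composition of isomorphisms of torsors. -/
@[simps]
def Hom.trans (φ : Hom P Q) (ψ : Hom Q R) : Hom P R where
  iso := φ.iso ≪≫ ψ.iso
  equivariant := by
    rw [Iso.trans_hom, ← Category.assoc, φ.equivariant, Category.assoc, ψ.equivariant]
    simp
  comp_p := by
    simp [φ.comp_p, ψ.comp_p]

/-- The inverse of an isomorphism of torsors. -/
@[simps]
def Hom.symm (φ : Hom P Q) : Hom Q P where
  iso := φ.iso.symm
  equivariant := by
    rw [Iso.symm_hom, Iso.comp_inv_eq, Category.assoc, φ.equivariant, ← whiskerLeft_comp_assoc]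
    simp
  comp_p := by
    rw [Iso.symm_hom, Iso.inv_comp_eq, φ.comp_p]

variable (P) in
/-- The identity of a torsor. -/
@[simps]
def Hom.refl : Hom P P where
  iso := Iso.refl _
  equivariant := by simp
  comp_p := by simp

variable (P) [IsAffine S.left]

/-- In a torsor, the group element that moves one point to another depends continuously on the two
points. -/
lemma continuous_of_smul_eq {g : Z → ComplexPoints G} {x y : Z → ComplexPoints P.P}
    (hx : Continuous x) (hy : Continuous y) (h : ∀ z, g z • y z = x z) : Continuous g := by
  have : Continuous fun z => (g z).pair (y z) := by
    refine continuous_of_isPullback P.isPullback_act ?_ ?_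
    · exact hx.congr fun z => (h z).symm
    · simpa only [ComplexPoints.map_snd_pair] using hy
  simpa only [Function.comp_def, ComplexPoints.map_fst_pair] using
    (continuous_complexPointsMap (fst G P.P)).comp this

/-- A pointwise continuous family of equivariant morphisms out of a torsor can be evaluated on a
continuous family of points of a fibre. -/
lemma continuous_eval {f : Z → (P.P ⟶ X)}
    (hf : ∀ y : ComplexPoints P.P, Continuous fun z => y.map (f z))
    (hfe : ∀ z, act G P.P ≫ f z = G ◁ f z ≫ act G X) {x : Z → ComplexPoints P.P}
    (hx : Continuous x) (hxp : ∀ z z', (x z).map P.p = (x z').map P.p) :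
    Continuous fun z => (x z).map (f z) := by
  rcases isEmpty_or_nonempty Z with _ | ⟨⟨z₀⟩⟩
  · exact continuous_of_const fun z => isEmptyElim z
  choose g hg using fun z => P.exists_smul_eq (hxp z z₀)
  have hgc : Continuous g := P.continuous_of_smul_eq hx continuous_const hg
  refine (hgc.smul (hf (x z₀))).congr fun z => ?_
  change g z • (x z₀).map (f z) = _
  rw [← ComplexPoints.smul_map (hfe z), hg]

variable {P}

lemma Hom.continuous_comp {φ : Z → Hom P Q} (hφ : Continuous φ) {f : Z → EquivariantMap G Q.P X}
    (hf : Continuous f) (y : ComplexPoints P.P) :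
    Continuous fun z => y.map ((φ z).iso.hom ≫ (f z).1) := by
  simp only [ComplexPoints.map_comp]
  refine Q.continuous_eval (continuous_equivariantMap_iff.1 hf) (fun z => (f z).2)
    (continuous_torsorHom_iff.1 hφ y) fun z z' => ?_
  rw [Hom.map_p, Hom.map_p]

lemma Hom.continuous_trans {φ : Z → Hom P Q} (hφ : Continuous φ) {ψ : Z → Hom Q R}
    (hψ : Continuous ψ) : Continuous fun z => (φ z).trans (ψ z) := by
  refine continuous_torsorHom_iff.2 fun y => ?_
  simp only [Hom.trans_iso, Iso.trans_hom, ComplexPoints.map_comp]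
  refine Q.continuous_eval (continuous_torsorHom_iff.1 hψ) (fun z => (ψ z).equivariant)
    (continuous_torsorHom_iff.1 hφ y) fun z z' => ?_
  rw [Hom.map_p, Hom.map_p]

lemma Hom.continuous_symm {φ : Z → Hom P Q} (hφ : Continuous φ) :
    Continuous fun z => (φ z).symm := by
  refine continuous_torsorHom_iff.2 fun y => ?_
  rcases isEmpty_or_nonempty Z with _ | ⟨⟨z₀⟩⟩
  · exact continuous_of_const fun z => isEmptyElim z
  let x₀ := y.map (φ z₀).symm.iso.hom
  have hx₀ : ∀ z, y.map Q.p = (x₀.map (φ z).iso.hom).map Q.p := by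
    intro z
    rw [Hom.map_p, Hom.map_p]
  choose g hg using fun z => Q.exists_smul_eq (hx₀ z)
  have hgc : Continuous g :=
    Q.continuous_of_smul_eq continuous_const (continuous_torsorHom_iff.1 hφ x₀) hg
  refine (hgc.smul (continuous_const (y := x₀))).congr fun z => ?_
  rw [← hg z, ComplexPoints.smul_map (φ z).symm.equivariant, ← ComplexPoints.map_comp]
  simp [ComplexPoints.map_id]

/-! ### The automorphism group of a torsor over the complex numbers -/

/-- The automorphisms of a torsor form a group, with composition in diagrammatic order, so that
evaluation at a section is a homomorphism to `G`. -/
instance : Group (Hom P P) where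
  mul φ ψ := φ.trans ψ
  one := Hom.refl P
  inv φ := φ.symm
  mul_assoc φ ψ θ := Hom.ext (Iso.ext (Category.assoc _ _ _))
  one_mul φ := Hom.ext (Iso.ext (Category.id_comp _))
  mul_one φ := Hom.ext (Iso.ext (Category.comp_id _))
  inv_mul_cancel φ := Hom.ext (Iso.ext (Iso.inv_hom_id _))

instance : IsTopologicalGroup (Hom P P) where
  continuous_mul := Hom.continuous_trans continuous_fst continuous_snd
  continuous_inv := Hom.continuous_symm continuous_id

end Torsor

section GeneralizedPoints

variable {G S T X Y : SchR} [GrpObj G] [ModObj G X] [ModObj G Y]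

lemma smul_comp (g : T ⟶ G) (x : T ⟶ X) {f : X ⟶ Y} (hf : act G X ≫ f = G ◁ f ≫ act G Y) :
    (g • x) ≫ f = g • (x ≫ f) := by
  rw [Hom.smul_def, Hom.smul_def, Category.assoc, hf, ← Category.assoc]
  congr 1
  ext <;> simp

variable (P : Torsor G S)

lemma Torsor.smul_comp_p (g : T ⟶ G) (x : T ⟶ P.P) : (g • x) ≫ P.p = x ≫ P.p := by
  rw [Hom.smul_def, Category.assoc, P.isPullback_act.w, lift_snd_assoc]

lemma Torsor.smul_cancel {g g' : T ⟶ G} {x : T ⟶ P.P} (h : g • x = g' • x) : g = g' := by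
  have e : lift g x = lift g' x := P.isPullback_act.hom_ext h (by simp)
  rw [← lift_fst g x, e, lift_fst]

lemma Torsor.exists_smul_section {y : S ⟶ P.P} (hy : y ≫ P.p = 𝟙 S) (x : T ⟶ P.P) :
    ∃ h : T ⟶ G, h • (x ≫ P.p ≫ y) = x := by
  have e : x ≫ P.p = (x ≫ P.p ≫ y) ≫ P.p := by simp [hy]
  refine ⟨P.isPullback_act.lift _ _ e ≫ fst G P.P, ?_⟩
  rw [Hom.smul_def]
  have : lift (P.isPullback_act.lift _ _ e ≫ fst G P.P) (x ≫ P.p ≫ y) =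
      P.isPullback_act.lift _ _ e := by
    apply CartesianMonoidalCategory.hom_ext
    · simp
    · rw [lift_snd, P.isPullback_act.lift_snd]
  rw [this]
  exact P.isPullback_act.lift_fst _ _ _

/-- An equivariant morphism out of a torsor is determined by its value on a section. -/
lemma Torsor.hom_ext_of_section {y : S ⟶ P.P} (hy : y ≫ P.p = 𝟙 S) {α β : P.P ⟶ X}
    (hα : act G P.P ≫ α = G ◁ α ≫ act G X) (hβ : act G P.P ≫ β = G ◁ β ≫ act G X)
    (h : y ≫ α = y ≫ β) : α = β := by
  obtain ⟨k, hk⟩ := P.exists_smul_section hy (𝟙 P.P)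
  rw [← Category.id_comp α, ← Category.id_comp β, ← hk, smul_comp _ _ hα, smul_comp _ _ hβ]
  simp [h]

/-- A torsor with a section has an automorphism moving the section by a given element of the group:
in the coordinates `(h, s) ↦ h • y(s)` it is `(h, s) ↦ (h g(s)) • y(s)`. -/
lemma Torsor.exists_comp_eq_smul {y : S ⟶ P.P} (hy : y ≫ P.p = 𝟙 S) (g : S ⟶ G) :
    ∃ α : P.P ⟶ P.P, act G P.P ≫ α = G ◁ α ≫ act G P.P ∧ α ≫ P.p = P.p ∧ y ≫ α = g • y := by
  obtain ⟨k, hk⟩ := P.exists_smul_section hy (𝟙 P.P)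
  rw [Category.id_comp] at hk
  have hact : act G P.P = fst G P.P • snd G P.P := by
    rw [Hom.smul_def]
    simp
  refine ⟨(k * (P.p ≫ g)) • (P.p ≫ y), ?_, ?_, ?_⟩
  · have e : act G P.P ≫ k = fst G P.P * (snd G P.P ≫ k) := by
      refine P.smul_cancel (x := snd G P.P ≫ P.p ≫ y) ?_
      rw [mul_smul, ← ModObj.comp_smul, hk, ← P.isPullback_act.w_assoc, ← ModObj.comp_smul, hk,
        Category.comp_id, Category.comp_id, hact]
    rw [ModObj.comp_smul, MonObj.comp_mul, e, P.isPullback_act.w_assoc, P.isPullback_act.w_assoc,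
      mul_assoc, mul_smul, ← MonObj.comp_mul, ← ModObj.comp_smul, Hom.smul_def]
    rfl
  · rw [P.smul_comp_p, Category.assoc, hy, Category.comp_id]
  · have e : y ≫ k = 1 := by
      refine P.smul_cancel (x := y) ?_
      have := congrArg (y ≫ ·) hk
      simp only [ModObj.comp_smul, reassoc_of% hy, Category.comp_id] at this
      rw [this, one_smul]
    rw [ModObj.comp_smul, MonObj.comp_mul, e, reassoc_of% hy, reassoc_of% hy, one_mul]

end GeneralizedPoints

/-- The automorphism group of a torsor over `Spec ℂ` is isomorphic to the group of complex points of
`G`, by evaluation at a section. -/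
lemma Torsor.hasLocalSqrt_hom {G : SchR} [GrpObj G] [Smooth G.hom] (P : Torsor G specC) :
    HasLocalSqrt (Torsor.Hom P P) := by
  obtain ⟨y, hy⟩ := P.exists_section
  choose α hα₁ hα₂ hα₃ using fun g => P.exists_comp_eq_smul hy g
  have hα : ∀ g g', α g ≫ α g' = α (g * g') := by
    intro g g'
    refine P.hom_ext_of_section hy ?_ (hα₁ _) ?_
    · rw [← Category.assoc, hα₁, Category.assoc, hα₁]
      simp
    · rw [← Category.assoc, hα₃, smul_comp _ _ (hα₁ g'), hα₃, hα₃, mul_smul]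
  have hα1 : α 1 = 𝟙 _ := by
    refine P.hom_ext_of_section hy (hα₁ _) (by simp) ?_
    rw [hα₃, one_smul, Category.comp_id]
  let A' : (specC ⟶ G) → Torsor.Hom P P := fun g =>
    ⟨⟨α g, α g⁻¹, by rw [hα, mul_inv_cancel, hα1], by rw [hα, inv_mul_cancel, hα1]⟩, hα₁ g, hα₂ g⟩
  let A : ComplexPoints G → Torsor.Hom P P := A'
  let y' : ComplexPoints P.P := y
  have hA : ∀ g, y'.map (A g).iso.hom = g • y' := hα₃
  have hex : ∀ φ : Torsor.Hom P P, ∃ g, g • y' = y'.map φ.iso.hom := fun φ =>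
    P.exists_smul_eq (φ.map_p y')
  choose E hE using hex
  have hEc : Continuous E := P.continuous_of_smul_eq
    (continuous_torsorHom_iff.1 continuous_id y') continuous_const hE
  have hEA : ∀ g, E (A g) = g := fun g => P.smul_left_injective y' ((hE _).trans (hA g))
  have hAE : ∀ φ, A (E φ) = φ := fun φ => Torsor.Hom.ext (Iso.ext
    (P.hom_ext_of_section hy (hα₁ _) φ.equivariant ((hα₃ _).trans (hE φ))))
  have hE_mul : ∀ φ ψ, E (φ * ψ) = E φ * E ψ := by
    intro φ ψ
    refine P.smul_left_injective y' ?_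
    change E (φ * ψ) • y' = (E φ * E ψ) • y'
    rw [hE, mul_smul, hE ψ, ← ComplexPoints.smul_map ψ.equivariant, hE φ, ← ComplexPoints.map_comp]
    rfl
  have hAc : Continuous A := by
    refine continuous_torsorHom_iff.2 fun x => ?_
    let x' : specC ⟶ P.P := x
    obtain ⟨h, hh⟩ := P.exists_smul_section hy x'
    let h' : ComplexPoints G := h
    have key : ∀ g : ComplexPoints G, x.map (A g).iso.hom =
        h' • ((g • y').precomp (x' ≫ P.p)) := by
      intro g
      let g' : specC ⟶ G := g
      change x' ≫ α g' = h • ((x' ≫ P.p) ≫ (g' • y))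
      rw [← hα₃, ← Category.assoc (x' ≫ P.p), Category.assoc x', ← smul_comp _ _ (hα₁ g), hh]
    simp only [key]
    have h₁ : Continuous fun g : ComplexPoints G => g • y' := continuous_id.smul continuous_const
    exact (continuous_const (y := h')).smul ((continuous_precomp (x' ≫ P.p)).comp h₁)
  have hE1 : E 1 = 1 := by simpa using hE_mul 1 1
  obtain ⟨⟨N, hN, hinj⟩, r, hr₁, hr₂, hr₃⟩ := hasLocalSqrt_complexPoints G
  have hE₁ : Tendsto E (𝓝 1) (𝓝 1) := hE1 ▸ hEc.tendsto 1
  refine ⟨⟨E ⁻¹' N, hE₁ hN, ?_⟩, fun φ => A (r (E φ)), ?_, ?_, ?_⟩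
  · intro φ hφ ψ hψ h
    rw [← hAE φ, ← hAE ψ]
    congr 1
    refine hinj hφ hψ ?_
    simp only [← hE_mul]
    exact congrArg E h
  · simp only [hE1, hr₁]
    rw [← hE1, hAE]
  · filter_upwards [hE₁.eventually hr₂] with φ hφ
    exact hAc.continuousAt.comp (hφ.comp hEc.continuousAt)
  · filter_upwards [hE₁.eventually hr₃] with φ hφ
    rw [← hAE (A _ * A _), hE_mul, hEA, hφ, hAE]

/-- Near the identity, a cocycle of an involution `σ` of a topological group with local square roots
is the coboundary of its square root: if `z = h²` and `σ(z) = z⁻¹`, then `σ(h) = h⁻¹`, since both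
are square roots of `z⁻¹` near the identity. -/
lemma HasLocalSqrt.exists_coboundary {H : Type*} [Group H] [TopologicalSpace H]
    [IsTopologicalGroup H] (hH : HasLocalSqrt H) {σ : H →* H} (hσ : Continuous σ) :
    ∃ (U : Set H) (r : H → H), IsOpen U ∧ 1 ∈ U ∧ ContinuousOn r U ∧ r 1 = 1 ∧
      ∀ z ∈ U, σ z * z = 1 → (σ (r z))⁻¹ * r z = z := by
  obtain ⟨⟨N, hN, hinj⟩, r, hr₁, hr₂, hr₃⟩ := hH
  have hr : Tendsto r (𝓝 1) (𝓝 1) := by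
    have := hr₂.self_of_nhds.tendsto
    rwa [hr₁] at this
  have h₁ : ∀ᶠ z in 𝓝 1, (r z)⁻¹ ∈ N := by
    have : Tendsto (fun z => (r z)⁻¹) (𝓝 1) (𝓝 1) := by simpa using hr.inv
    exact this hN
  have h₂ : ∀ᶠ z in 𝓝 1, σ (r z) ∈ N := by
    have : Tendsto (fun z => σ (r z)) (𝓝 1) (𝓝 1) := by
      have := (hσ.tendsto 1).comp hr
      rwa [map_one] at this
    exact this hN
  obtain ⟨U, hU, hUo, h1⟩ := eventually_nhds_iff.1 (((hr₂.and hr₃).and h₁).and h₂)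
  refine ⟨U, r, hUo, h1, fun z hz => (hU z hz).1.1.1.continuousWithinAt, hr₁, fun z hz hσz => ?_⟩
  obtain ⟨⟨⟨-, hz₁⟩, hz₂⟩, hz₃⟩ := hU z hz
  have : σ (r z) = (r z)⁻¹ := by
    refine hinj hz₃ hz₂ ?_
    change σ (r z) * σ (r z) = (r z)⁻¹ * (r z)⁻¹
    rw [← map_mul, ← mul_inv_rev, hz₁]
    exact eq_inv_of_mul_eq_one_left hσz
  rw [this, inv_inv, hz₁]

end

/-! ### Continuous families of objects and morphisms -/

section Local

variable {Z Y : Type*} [TopologicalSpace Z] [TopologicalSpace Y]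

lemma continuous_of_local {F : Z → Y}
    (h : ∀ z₀, ∃ N : Set Z, IsOpen N ∧ z₀ ∈ N ∧ Continuous fun z : N => F z) : Continuous F := by
  refine continuous_iff_continuousAt.2 fun z₀ => ?_
  obtain ⟨N, hN, hz₀, hc⟩ := h z₀
  exact (hN.isOpenEmbedding_subtypeVal.continuousAt_iff (x := ⟨z₀, hz₀⟩)).1 hc.continuousAt

lemma exists_local_sigma {ι : Type*} {T : ι → Type*} [∀ i, TopologicalSpace (T i)]
    {F : Z → Σ i, T i} (hF : Continuous F) (z₀ : Z) :
    ∃ N : Set Z, IsOpen N ∧ z₀ ∈ N ∧ ∃ k : N → T (F z₀).1, Continuous k ∧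
      ∀ z : N, F z = ⟨(F z₀).1, k z⟩ := by
  let N : Set Z := F ⁻¹' Set.range (Sigma.mk (F z₀).1)
  have hN : ∀ z : N, ∃ k : T (F z₀).1, F z = ⟨(F z₀).1, k⟩ := fun ⟨z, k, hk⟩ => ⟨k, hk.symm⟩
  choose k hk using hN
  refine ⟨N, isOpen_range_sigmaMk.preimage hF, ⟨(F z₀).2, rfl⟩, k, ?_, hk⟩
  rw [IsOpenEmbedding.sigmaMk.isInducing.continuous_iff]
  exact (hF.comp continuous_subtype_val).congr hk

end Local

namespace Points

variable {G X : SchR} [GrpObj G] [ModObj G X] {S : SchR}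
  {Z : Type*} [TopologicalSpace Z]

/-- The object of `[G\X](S)` given by a torsor and an equivariant map. -/
def ofMap (P : Torsor G S) (f : EquivariantMap G P.P X) : Points G X S := ⟨P, f.1, f.2⟩

lemma ofMap_injective (P : Torsor G S) :
    Function.Injective (ofMap P : EquivariantMap G P.P X → Points G X S) := by
  intro f g h
  exact Subtype.ext (eq_of_heq (Points.mk.inj h).2)

/-- The morphism of `[G\X](S)` given by an isomorphism of torsors over `X`. -/
def ofHom {P Q : Torsor G S} (φ : Torsor.Hom P Q) (f : EquivariantMap G P.P X)
    (g : EquivariantMap G Q.P X) (h : φ.iso.hom ≫ g.1 = f.1) : ofMap P f ⟶ ofMap Q g :=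
  Hom.mk φ h

lemma continuous_ofMap {P : Torsor G S} {f : Z → EquivariantMap G P.P X} (hf : Continuous f) :
    Continuous fun z => ofMap P (f z) :=
  continuous_induced_rng.2 (continuous_sigmaMk.comp hf)

lemma continuous_ofHom {P Q : Torsor G S} {φ : Z → Torsor.Hom P Q}
    {f : Z → EquivariantMap G P.P X} {g : Z → EquivariantMap G Q.P X} (hφ : Continuous φ)
    (hf : Continuous f) (hg : Continuous g) (h : ∀ z, (φ z).iso.hom ≫ (g z).1 = (f z).1) :
    Continuous fun z => Arrow.mk (ofHom (φ z) (f z) (g z) (h z)) := by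
  refine continuous_induced_rng.2 ?_
  exact (continuous_sigmaMk (σ := fun PQ : Torsor G S × Torsor G S => Torsor.Hom PQ.1 PQ.2 ×
    EquivariantMap G PQ.1.P X × EquivariantMap G PQ.2.P X) (i := (P, Q))).comp
      (hφ.prodMk (hf.prodMk hg))

/-- A continuous family of objects locally consists of a fixed torsor and a continuous family of
equivariant maps. -/
lemma exists_local_ofMap {F : Z → Points G X S} (hF : Continuous F) (z₀ : Z) :
    ∃ N : Set Z, IsOpen N ∧ z₀ ∈ N ∧ ∃ f : N → EquivariantMap G (F z₀).torsor.P X, Continuous f ∧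
      ∀ z : N, F z = ofMap (F z₀).torsor (f z) := by
  obtain ⟨N, hN, hz₀, f, hf, h⟩ := exists_local_sigma (continuous_induced_rng.1 hF) z₀
  refine ⟨N, hN, hz₀, f, hf, fun z => ?_⟩
  exact congrArg (fun s : Σ P : Torsor G S, EquivariantMap G P.P X => ofMap s.1 s.2) (h z)

/-- A continuous family of morphisms locally has fixed source and target torsors and consists of
continuous families of isomorphisms and of equivariant maps. -/
lemma exists_local_ofHom {F : Z → Arrow (Points G X S)} (hF : Continuous F) (z₀ : Z) :
    ∃ N : Set Z, IsOpen N ∧ z₀ ∈ N ∧ ∃ (P Q : Torsor G S) (φ : N → Torsor.Hom P Q)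
      (f : N → EquivariantMap G P.P X) (g : N → EquivariantMap G Q.P X)
      (h : ∀ z, (φ z).iso.hom ≫ (g z).1 = (f z).1), Continuous φ ∧ Continuous f ∧ Continuous g ∧
        ∀ z : N, F z = Arrow.mk (ofHom (φ z) (f z) (g z) (h z)) := by
  obtain ⟨N, hN, hz₀, k, hk, h⟩ := exists_local_sigma (continuous_induced_rng.1 hF) z₀
  have key : ∀ (a : Arrow (Points G X S)) (PQ : Torsor G S × Torsor G S)
      (t : Torsor.Hom PQ.1 PQ.2 × EquivariantMap G PQ.1.P X × EquivariantMap G PQ.2.P X),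
      (⟨(a.left.torsor, a.right.torsor),
        (torsorIso a.hom, a.left.equivariantMap, a.right.equivariantMap)⟩ :
      Σ PQ : Torsor G S × Torsor G S,
        Torsor.Hom PQ.1 PQ.2 × EquivariantMap G PQ.1.P X × EquivariantMap G PQ.2.P X) = ⟨PQ, t⟩ →
      ∃ h : t.1.iso.hom ≫ t.2.2.1 = t.2.1.1, a = Arrow.mk (ofHom t.1 t.2.1 t.2.2 h) := by
    intro a PQ t e
    obtain ⟨rfl, e⟩ := Sigma.mk.inj e
    obtain rfl := eq_of_heq e
    exact ⟨Hom.comm a.hom, rfl⟩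
  choose h' h'' using fun z : N => key (F z) _ _ (h z)
  exact ⟨N, hN, hz₀, _, _, fun z => (k z).1, fun z => (k z).2.1, fun z => (k z).2.2, h',
    continuous_fst.comp hk, continuous_fst.comp (continuous_snd.comp hk),
    continuous_snd.comp (continuous_snd.comp hk), h''⟩

lemma ofHom_comp {P Q R : Torsor G S} {φ : Torsor.Hom P Q} {ψ : Torsor.Hom Q R}
    {f : EquivariantMap G P.P X} {g g' : EquivariantMap G Q.P X} {k : EquivariantMap G R.P X}
    (h : φ.iso.hom ≫ g.1 = f.1) (h' : ψ.iso.hom ≫ k.1 = g'.1) (e : ofMap Q g = ofMap Q g')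
    (h'' : (φ.trans ψ).iso.hom ≫ k.1 = f.1) :
    ofHom φ f g h ≫ eqToHom e ≫ ofHom ψ g' k h' = ofHom (φ.trans ψ) f k h'' := by
  obtain rfl := ofMap_injective Q e
  rw [eqToHom_refl, Category.id_comp]
  rfl

/-- The points of the quotient stack over an affine base form a topological groupoid. -/
theorem isTopologicalGroupoid [IsAffine S.left] : IsTopologicalGroupoid (Points G X S) where
  continuous_source := continuous_of_local fun a₀ => by
    obtain ⟨N, hN, ha₀, P, Q, φ, f, g, h, hφ, hf, hg, e⟩ :=
      exists_local_ofHom (continuous_id (X := Arrow (Points G X S))) a₀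
    exact ⟨N, hN, ha₀, (continuous_ofMap hf).congr fun a => (congrArg Comma.left (e a)).symm⟩
  continuous_target := continuous_of_local fun a₀ => by
    obtain ⟨N, hN, ha₀, P, Q, φ, f, g, h, hφ, hf, hg, e⟩ :=
      exists_local_ofHom (continuous_id (X := Arrow (Points G X S))) a₀
    exact ⟨N, hN, ha₀, (continuous_ofMap hg).congr fun a => (congrArg Comma.right (e a)).symm⟩
  continuous_id := continuous_of_local fun x₀ => by
    obtain ⟨N, hN, hx₀, f, hf, e⟩ := exists_local_ofMap (continuous_id (X := Points G X S)) x₀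
    refine ⟨N, hN, hx₀, (continuous_ofHom (continuous_const (y := Torsor.Hom.refl _)) hf hf
      fun _ => Category.id_comp _).congr fun x => ?_⟩
    exact congrArg (fun x : Points G X S => Arrow.mk (𝟙 x)) (e x).symm
  continuous_inv := continuous_of_local fun a₀ => by
    obtain ⟨N, hN, ha₀, P, Q, φ, f, g, h, hφ, hf, hg, e⟩ :=
      exists_local_ofHom (continuous_id (X := Arrow (Points G X S))) a₀
    refine ⟨N, hN, ha₀, (continuous_ofHom (Torsor.Hom.continuous_symm hφ) hg hf
      fun a => ?_).congr fun a => ?_⟩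
    · rw [Torsor.Hom.symm_iso, Iso.symm_hom, Iso.inv_comp_eq, h]
    · exact congrArg (fun a : Arrow (Points G X S) => Arrow.mk (Groupoid.inv a.hom)) (e a).symm
  continuous_comp := continuous_of_local fun p₀ => by
    obtain ⟨N, hN, hp₀, P, Q, φ, f, g, h, hφ, hf, hg, e⟩ :=
      exists_local_ofHom (Z := {p : Arrow (Points G X S) × Arrow (Points G X S) //
        (p.1.right : Points G X S) = p.2.left}) (F := fun p => p.1.1)
        (continuous_fst.comp continuous_subtype_val) p₀
    obtain ⟨N', hN', hp₀', Q', R, ψ, g', k, h', hψ, hg', hk, e'⟩ :=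
      exists_local_ofHom (Z := {p : Arrow (Points G X S) × Arrow (Points G X S) //
        (p.1.right : Points G X S) = p.2.left}) (F := fun p => p.1.2)
        (continuous_snd.comp continuous_subtype_val) p₀
    have hQ : Q = Q' := by
      have h₁ := congrArg Comma.right (e ⟨p₀, hp₀⟩)
      have h₂ := congrArg Comma.left (e' ⟨p₀, hp₀'⟩)
      exact congrArg torsor (h₁.symm.trans (p₀.2.trans h₂))
    subst hQ
    let i : ↥(N ∩ N') → N := fun p => ⟨p.1, p.2.1⟩
    let i' : ↥(N ∩ N') → N' := fun p => ⟨p.1, p.2.2⟩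
    have hi : Continuous i := continuous_subtype_val.subtype_mk _
    have hi' : Continuous i' := continuous_subtype_val.subtype_mk _
    have hgg : ∀ p : ↥(N ∩ N'), ofMap Q (g (i p)) = ofMap Q (g' (i' p)) := fun p =>
      (congrArg Comma.right (e (i p))).symm.trans (p.1.2.trans (congrArg Comma.left (e' (i' p))))
    refine ⟨N ∩ N', hN.inter hN', ⟨hp₀, hp₀'⟩, (continuous_ofHom
      (Torsor.Hom.continuous_trans (hφ.comp hi) (hψ.comp hi')) (hf.comp hi) (hk.comp hi')
      fun p => ?_).congr fun p => ?_⟩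
    · have := ofMap_injective Q (hgg p)
      simp only [Function.comp_apply, Torsor.Hom.trans_iso, Iso.trans_hom, Category.assoc]
      rw [h', ← this, h]
    · have key : ∀ (a b : Arrow (Points G X S)) (hab : (a.right : Points G X S) = b.left),
          a = Arrow.mk (ofHom _ _ _ (h (i p))) → b = Arrow.mk (ofHom _ _ _ (h' (i' p))) →
          ∀ h'' : ((φ (i p)).trans (ψ (i' p))).iso.hom ≫ (k (i' p)).1 = (f (i p)).1,
          Arrow.mk (ofHom _ _ _ h'') = Arrow.mk (a.hom ≫ eqToHom hab ≫ b.hom) := by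
        rintro _ _ hab rfl rfl h''
        exact congrArg Arrow.mk (ofHom_comp _ _ hab _).symm
      exact key _ _ p.1.2 (e (i p)) (e' (i' p)) _

end Points

/-! ### Homotopy fixed points -/

namespace HFix

variable {Γ : Type*} [Group Γ] {C : Type*} [Groupoid C] {A : GroupAction Γ C}

lemma arrow_ext {a b : Arrow (HFix A)} (h₁ : (a.left : HFix A) = b.left)
    (h₂ : (a.right : HFix A) = b.right)
    (h : (forget A).mapArrow.obj a = (forget A).mapArrow.obj b) : a = b := by
  obtain ⟨x, y, f⟩ := a
  obtain ⟨x', y', g⟩ := b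
  obtain rfl : x = x' := h₁
  obtain rfl : y = y' := h₂
  have e : Arrow.mk f.hom = Arrow.mk g.hom := h
  have : f = g := Hom.ext (Arrow.mk_injective _ _ e)
  rw [this]

variable [TopologicalSpace C] [TopologicalSpace (Arrow C)] {Z : Type*} [TopologicalSpace Z]

lemma continuous_iff {F : Z → HFix A} : Continuous F ↔ Continuous (fun z => (F z).obj) ∧
    ∀ γ, Continuous fun z => Arrow.mk ((F z).φ γ).hom :=
  continuous_induced_rng.trans (continuous_prodMk.trans (and_congr_right' continuous_pi_iff))

lemma continuous_arrow_iff {F : Z → Arrow (HFix A)} : Continuous F ↔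
    Continuous (fun z => ((F z).left : HFix A)) ∧ Continuous (fun z => ((F z).right : HFix A)) ∧
      Continuous fun z => (forget A).mapArrow.obj (F z) :=
  continuous_induced_rng.trans (continuous_prodMk.trans (and_congr_right' continuous_prodMk))

theorem isTopologicalGroupoid (hC : IsTopologicalGroupoid C) : IsTopologicalGroupoid (HFix A) := by
  obtain ⟨hs, ht, hf⟩ := continuous_arrow_iff.1 (continuous_id (X := Arrow (HFix A)))
  have ho : Continuous fun x : HFix A => x.obj :=
    (continuous_iff.1 (continuous_id (X := HFix A))).1
  refine ⟨hs, ht, ?_, ?_, ?_⟩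
  · exact continuous_arrow_iff.2 ⟨continuous_id, continuous_id, hC.continuous_id.comp ho⟩
  · exact continuous_arrow_iff.2 ⟨ht, hs, hC.continuous_inv.comp hf⟩
  · have hp₁ : Continuous fun p : {p : Arrow (HFix A) × Arrow (HFix A) //
        (p.1.right : HFix A) = p.2.left} => p.1.1 := continuous_fst.comp continuous_subtype_val
    have hp₂ : Continuous fun p : {p : Arrow (HFix A) × Arrow (HFix A) //
        (p.1.right : HFix A) = p.2.left} => p.1.2 := continuous_snd.comp continuous_subtype_val
    have hl := hs.comp hp₁
    have hr := ht.comp hp₂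
    refine continuous_arrow_iff.2 ⟨hl, hr, ?_⟩
    let i : {p : Arrow (HFix A) × Arrow (HFix A) // (p.1.right : HFix A) = p.2.left} →
        {p : Arrow C × Arrow C // (p.1.right : C) = p.2.left} := fun p =>
      ⟨((forget A).mapArrow.obj p.1.1, (forget A).mapArrow.obj p.1.2),
        congrArg HFix.obj p.2⟩
    have hi : Continuous i := ((hf.comp hp₁).prodMk (hf.comp hp₂)).subtype_mk _
    refine (hC.continuous_comp.comp hi).congr fun p => ?_
    have e : (forget A).map (p.1.1.hom ≫ eqToHom p.2 ≫ p.1.2.hom) =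
        (i p).1.1.hom ≫ eqToHom (i p).2 ≫ (i p).1.2.hom := by
      rw [Functor.map_comp, Functor.map_comp, eqToHom_map]
      rfl
    exact (congrArg Arrow.mk e).symm

end HFix

namespace Points

variable {G X : SchR} [GrpObj G] [ModObj G X]

/-- The isomorphism of torsors `γ . P ≅ γ . Q` given by an isomorphism `P ≅ Q`. -/
def twistHom (γ : C2) {P Q : Torsor G specC} (φ : Torsor.Hom P Q) :
    Torsor.Hom (P.twist γ) (Q.twist γ) :=
  ⟨φ.iso, φ.equivariant, comp_eq_of_eq _ φ.comp_p _⟩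

theorem isContinuous_galoisAction : (galoisAction G X).IsContinuous where
  continuous_obj γ := continuous_of_local fun x₀ => by
    obtain ⟨N, hN, hx₀, f, hf, e⟩ := exists_local_ofMap (continuous_id (X := Points G X specC)) x₀
    refine ⟨N, hN, hx₀, (continuous_ofMap (P := x₀.torsor.twist γ) hf).congr fun x => ?_⟩
    exact congrArg (twist γ).obj (e x).symm
  continuous_map γ := continuous_of_local fun a₀ => by
    obtain ⟨N, hN, ha₀, P, Q, φ, f, g, h, hφ, hf, hg, e⟩ :=
      exists_local_ofHom (continuous_id (X := Arrow (Points G X specC))) a₀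
    refine ⟨N, hN, ha₀, (continuous_ofHom (P := P.twist γ) (Q := Q.twist γ)
      (φ := fun z => twistHom γ (φ z))
      (continuous_torsorHom_iff.2 fun y => continuous_torsorHom_iff.1 hφ y) hf hg
      h).congr fun a => ?_⟩
    exact congrArg (twist γ).mapArrow.obj (e a).symm
  continuous_comparison γ δ := continuous_of_local fun x₀ => by
    obtain ⟨N, hN, hx₀, f, hf, e⟩ := exists_local_ofMap (continuous_id (X := Points G X specC)) x₀
    refine ⟨N, hN, hx₀, (continuous_ofHom (P := (x₀.torsor.twist δ).twist γ)
      (Q := x₀.torsor.twist (γ * δ)) (φ := fun _ => torsorIso (twistMul γ δ x₀).hom)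
      continuous_const hf hf fun _ => Category.id_comp _).congr fun x => ?_⟩
    exact congrArg (fun x => Arrow.mk (twistMul γ δ x).hom) (e x).symm
  continuous_unit := continuous_of_local fun x₀ => by
    obtain ⟨N, hN, hx₀, f, hf, e⟩ := exists_local_ofMap (continuous_id (X := Points G X specC)) x₀
    refine ⟨N, hN, hx₀, (continuous_ofHom (P := x₀.torsor)
      (Q := x₀.torsor.twist 1) (φ := fun _ => torsorIso (twistOne x₀).hom)
      continuous_const hf hf fun _ => Category.id_comp _).congr fun x => ?_⟩
    exact congrArg (fun x => Arrow.mk (twistOne x).hom) (e x).symm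

end Points

/-! ### Complexification of torsors -/

lemma IsComplexification.equivariant_of_comp {G Y Y₀ W : SchR} [GrpObj G] [ModObj G Y]
    [ModObj G Y₀] [ModObj G W] {π : Y ⟶ Y₀} {q : Y ⟶ specC} {q₀ : Y₀ ⟶ specR} {e : Y ⟶ Y}
    (h : IsComplexification π q q₀ e) (hπ : act G Y ≫ π = G ◁ π ≫ act G Y₀) {f : Y₀ ⟶ W}
    (hf : act G Y ≫ π ≫ f = G ◁ (π ≫ f) ≫ act G W) : act G Y₀ ≫ f = G ◁ f ≫ act G W := by
  have := (h.whiskerLeft G).epi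
  rw [← cancel_epi (G ◁ π), ← whiskerLeft_comp_assoc, ← hf, reassoc_of% hπ]

namespace Torsor

variable {G X : SchR} [GrpObj G] [ModObj G X] (P Q : Torsor G specR)

/-- The complexification of a torsor over `Spec ℝ`. -/
def complexify : Torsor G specC := P.baseChange specCToR

/-- The projection from the complexification of a torsor to the torsor. -/
def proj : P.complexify.P ⟶ P.P := pullback.snd specCToR P.p

/-- Complex conjugation on the complexification of a torsor. -/
def conjugation : P.complexify.P ⟶ P.complexify.P :=
  pullbackEnd P.p specCToR (specGal conjC2) (specGal_comp conjC2)

lemma isComplexification_complexify :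
    IsComplexification P.proj P.complexify.p P.p P.conjugation :=
  isComplexification_pullback P.p

lemma act_proj : act G P.complexify.P ≫ P.proj = G ◁ P.proj ≫ act G P.P :=
  pullbackAct_snd G P.p specCToR P.isPullback_act.w

lemma act_conjugation :
    act G P.complexify.P ≫ P.conjugation = G ◁ P.conjugation ≫ act G P.complexify.P :=
  pullbackEnd_equivariant G P.p specCToR (specGal conjC2) (specGal_comp conjC2) P.isPullback_act.w

lemma conjugation_comp_self : P.conjugation ≫ P.conjugation = 𝟙 _ := by
  have h := P.isComplexification_complexify
  refine h.isPullback.hom_ext ?_ ?_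
  · rw [Category.assoc, h.comp_π, h.comp_π, Category.id_comp]
  · rw [Category.assoc, h.comp_q, reassoc_of% h.comp_q, ← specGal_mul, conjC2_mul_self, specGal_one,
      Category.comp_id, Category.id_comp]

variable {P Q}

/-- The complexification of an isomorphism of torsors. -/
def Hom.complexify (φ : Hom P Q) : Hom P.complexify Q.complexify :=
  ⟨pullbackMapIso specCToR φ.iso φ.comp_p,
    pullbackMap_equivariant G specCToR _ _ _ φ.comp_p φ.equivariant, pullbackMap_fst _ _ φ.comp_p⟩

lemma Hom.complexify_comp_proj (φ : Hom P Q) :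
    φ.complexify.iso.hom ≫ Q.proj = P.proj ≫ φ.iso.hom :=
  pullbackMap_snd specCToR φ.iso.hom φ.comp_p

lemma Hom.complexify_injective :
    Function.Injective (Hom.complexify : Hom P Q → Hom P.complexify Q.complexify) := by
  intro φ ψ h
  have := P.isComplexification_complexify.epi
  refine Hom.ext (Iso.ext ((cancel_epi P.proj).1 ?_))
  rw [← φ.complexify_comp_proj, ← ψ.complexify_comp_proj, h]

/-- An isomorphism of complexified torsors that commutes with complex conjugation descends. -/
lemma Hom.exists_complexify_eq {Φ : Hom P.complexify Q.complexify}
    (h : P.conjugation ≫ Φ.iso.hom = Φ.iso.hom ≫ Q.conjugation) :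
    ∃ φ : Hom P Q, φ.complexify = Φ := by
  have hP := P.isComplexification_complexify
  have hQ := Q.isComplexification_complexify
  have h' : Q.conjugation ≫ Φ.iso.inv = Φ.iso.inv ≫ P.conjugation := by
    rw [Iso.eq_inv_comp, ← Category.assoc, ← h, Category.assoc, Iso.hom_inv_id, Category.comp_id]
  obtain ⟨f, hf⟩ := hP.exists_fac (f := Φ.iso.hom ≫ Q.proj) (by
    rw [reassoc_of% h, hQ.comp_π])
  obtain ⟨g, hg⟩ := hQ.exists_fac (f := Φ.iso.inv ≫ P.proj) (by
    rw [reassoc_of% h', hP.comp_π])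
  have := hP.epi
  have := hQ.epi
  refine ⟨⟨⟨f, g, ?_, ?_⟩, ?_, hom_specR_ext _ _⟩, ?_⟩
  · rw [← cancel_epi P.proj, reassoc_of% hf, hg, Iso.hom_inv_id_assoc, Category.comp_id]
  · rw [← cancel_epi Q.proj, reassoc_of% hg, hf, Iso.inv_hom_id_assoc, Category.comp_id]
  · refine hP.equivariant_of_comp P.act_proj ?_
    rw [hf, ← Category.assoc, Φ.equivariant, Category.assoc, Q.act_proj,
      ← whiskerLeft_comp_assoc]
  · refine Hom.ext (Iso.ext (hQ.isPullback.hom_ext ?_ ?_))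
    · rw [Hom.complexify_comp_proj]
      exact hf
    · rw [Hom.comp_p, Hom.comp_p]

/-- The restriction of an equivariant map to the complexification. -/
def complexifyMap (P : Torsor G specR) (f : EquivariantMap G P.P X) :
    EquivariantMap G P.complexify.P X :=
  ⟨P.proj ≫ f.1, by
    rw [← Category.assoc, P.act_proj, Category.assoc, f.2, ← whiskerLeft_comp_assoc]⟩

lemma complexifyMap_injective (P : Torsor G specR) : Function.Injective
    (P.complexifyMap : EquivariantMap G P.P X → EquivariantMap G P.complexify.P X) := by
  intro f g h
  have := P.isComplexification_complexify.epi
  exact Subtype.ext ((cancel_epi P.proj).1 (congrArg Subtype.val h))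

/-- An equivariant map on a complexified torsor that is invariant under complex conjugation
descends. -/
lemma exists_complexifyMap_eq {F : EquivariantMap G P.complexify.P X}
    (h : P.conjugation ≫ F.1 = F.1) : ∃ f, P.complexifyMap f = F := by
  have hP := P.isComplexification_complexify
  obtain ⟨f, hf⟩ := hP.exists_fac h
  exact ⟨⟨f, hP.equivariant_of_comp P.act_proj (by rw [hf]; exact F.2)⟩, Subtype.ext hf⟩

lemma exists_map_proj_eq (y : ComplexPoints P.P) : ∃ x : ComplexPoints P.complexify.P,
    x.map P.proj = y := by
  let i : ComplexPoints specC := 𝟙 specC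
  obtain ⟨x, hx, -⟩ := ComplexPoints.exists_of_isPullback
    P.isComplexification_complexify.isPullback (x := y) (y := i) (hom_specR_ext _ _)
  exact ⟨x, hx⟩

section Continuity

variable {Z : Type*} [TopologicalSpace Z]

lemma continuous_complexifyMap_iff {f : Z → EquivariantMap G P.P X} :
    Continuous (fun z => P.complexifyMap (f z)) ↔ Continuous f := by
  rw [continuous_equivariantMap_iff, continuous_equivariantMap_iff]
  constructor
  · intro h y
    obtain ⟨x, rfl⟩ := exists_map_proj_eq y
    exact (h x).congr fun z => ComplexPoints.map_comp _ _ _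
  · intro h x
    exact (h (x.map P.proj)).congr fun z => (ComplexPoints.map_comp _ _ _).symm

lemma continuous_complexify_iff {φ : Z → Hom P Q} :
    Continuous (fun z => (φ z).complexify) ↔ Continuous φ := by
  rw [continuous_torsorHom_iff, continuous_torsorHom_iff]
  constructor
  · intro h y
    obtain ⟨x, rfl⟩ := exists_map_proj_eq y
    refine ((continuous_complexPointsMap Q.proj).comp (h x)).congr fun z => ?_
    rw [Function.comp_apply, ← ComplexPoints.map_comp, ← ComplexPoints.map_comp,
      Hom.complexify_comp_proj]
  · intro h x
    refine continuous_of_isPullback Q.isComplexification_complexify.isPullback ?_ ?_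
    · refine (h (x.map P.proj)).congr fun z => ?_
      rw [← ComplexPoints.map_comp, ← ComplexPoints.map_comp, Hom.complexify_comp_proj]
    · simp only [Hom.map_p]
      exact continuous_const

end Continuity

/-- A descended torsor has the given torsor as its complexification. -/
lemma exists_complexify_hom {P : Torsor G specC} {P₀ : Torsor G specR} {π : P.P ⟶ P₀.P}
    {e : P.P ⟶ P.P} (h : IsComplexification π P.p P₀.p e)
    (hπ : act G P.P ≫ π = G ◁ π ≫ act G P₀.P) :
    ∃ θ : Hom P₀.complexify P, θ.iso.hom ≫ π = P₀.proj ∧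
      P₀.conjugation ≫ θ.iso.hom = θ.iso.hom ≫ e := by
  have h₀ := P₀.isComplexification_complexify
  let t := h₀.isPullback.isoIsPullback _ _ h.isPullback
  have ht₁ : t.hom ≫ π = P₀.proj := h₀.isPullback.isoIsPullback_hom_fst _ _ h.isPullback
  have ht₂ : t.hom ≫ P.p = P₀.complexify.p := h₀.isPullback.isoIsPullback_hom_snd _ _ h.isPullback
  have ht₃ : act G P₀.complexify.P ≫ t.hom = G ◁ t.hom ≫ act G P.P := by
    refine h.isPullback.hom_ext ?_ ?_
    · rw [Category.assoc, Category.assoc, ht₁, P₀.act_proj, hπ, ← whiskerLeft_comp_assoc, ht₁]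
    · rw [Category.assoc, Category.assoc, ht₂, P.isPullback_act.w, P₀.complexify.isPullback_act.w,
        whiskerLeft_snd_assoc, ht₂]
  refine ⟨⟨t, ht₃, ht₂⟩, ht₁, ?_⟩
  change P₀.conjugation ≫ t.hom = t.hom ≫ e
  refine h.isPullback.hom_ext ?_ ?_
  · rw [Category.assoc, Category.assoc, ht₁, h.comp_π, h₀.comp_π, ht₁]
  · rw [Category.assoc, Category.assoc, ht₂, h.comp_q, h₀.comp_q, reassoc_of% ht₂]

end Torsor

/-! ### Homotopy fixed points as semilinear involutions -/

namespace Points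

variable {G X : SchR} [GrpObj G] [ModObj G X]

/-- The underlying morphism of total spaces of the homotopy fixed point datum at `γ`. -/
def totalφ (d : HFix (galoisAction G X)) (γ : C2) : d.obj.torsor.P ⟶ d.obj.torsor.P :=
  total (y := (twist γ).obj d.obj) (d.φ γ).hom

/-- The semilinear involution of the torsor underlying a homotopy fixed point. -/
def involution (d : HFix (galoisAction G X)) : d.obj.torsor.P ⟶ d.obj.torsor.P :=
  totalφ d conjC2

lemma totalφ_mul (d : HFix (galoisAction G X)) (γ δ : C2) :
    totalφ d (γ * δ) = totalφ d γ ≫ totalφ d δ := by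
  have h : totalφ d (γ * δ) = totalφ d γ ≫ totalφ d δ ≫ 𝟙 d.obj.torsor.P :=
    congrArg (total (y := (twist (γ * δ)).obj d.obj)) (d.cocycle γ δ)
  rw [h, Category.comp_id]

lemma totalφ_one (d : HFix (galoisAction G X)) : totalφ d 1 = 𝟙 d.obj.torsor.P := by
  have : IsIso (totalφ d 1) :=
    inferInstanceAs (IsIso (torsorIso (y := (twist 1).obj d.obj) (d.φ 1).hom).iso.hom)
  rw [← cancel_epi (totalφ d 1), ← totalφ_mul, Category.comp_id, one_mul]

lemma involution_comp_self (d : HFix (galoisAction G X)) :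
    involution d ≫ involution d = 𝟙 _ := by
  rw [involution, ← totalφ_mul, conjC2_mul_self, totalφ_one]

lemma act_involution (d : HFix (galoisAction G X)) :
    act G d.obj.torsor.P ≫ involution d = G ◁ involution d ≫ act G d.obj.torsor.P :=
  (torsorIso (y := (twist conjC2).obj d.obj) (d.φ conjC2).hom).equivariant

lemma comp_p_of_comp_twist_p {P : Torsor G specC} {Y : SchR} {q : Y ⟶ specC} {e : Y ⟶ P.P}
    {γ : C2} (h : e ≫ (P.twist γ).p = q) : e ≫ P.p = q ≫ specGal γ := by
  have h' : e ≫ P.p ≫ specGal γ⁻¹ = q := h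
  rw [← h', Category.assoc, Category.assoc, specGal_inv_comp, Category.comp_id]

lemma involution_comp_p (d : HFix (galoisAction G X)) :
    involution d ≫ d.obj.torsor.p = d.obj.torsor.p ≫ specGal conjC2 :=
  comp_p_of_comp_twist_p (torsorIso (y := (twist conjC2).obj d.obj) (d.φ conjC2).hom).comp_p

lemma involution_comp_map (d : HFix (galoisAction G X)) :
    involution d ≫ d.obj.map = d.obj.map :=
    total_comp_map (y := (twist conjC2).obj d.obj) (d.φ conjC2).hom

/-- A morphism of homotopy fixed points is a morphism commuting with the involutions. -/
lemma exists_hom_eq {d d' : HFix (galoisAction G X)} (f : d.obj ⟶ d'.obj)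
    (h : involution d ≫ total f = total f ≫ involution d') : ∃ F : d ⟶ d', F.hom = f := by
  refine ⟨⟨f, fun γ => hom_ext ?_⟩, rfl⟩
  rcases eq_one_or_eq_conjC2 γ with rfl | rfl
  · change totalφ d 1 ≫ total f = total f ≫ totalφ d' 1
    rw [totalφ_one d, totalφ_one d']
    exact (Category.id_comp _).trans (Category.comp_id _).symm
  · exact h

lemma involution_comm {d d' : HFix (galoisAction G X)} (F : d ⟶ d') :
    involution d ≫ total F.hom = total F.hom ≫ involution d' :=
  congrArg (total (y := (twist conjC2).obj d'.obj)) (F.comm conjC2)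

/-! ### The complexification functor is an equivalence of categories -/

instance faithful_complexification : (complexification G X).Faithful where
  map_injective {x y f g} h := by
    have h' : (torsorIso f).complexify = (torsorIso g).complexify :=
      congrArg (fun F : (complexification G X).obj x ⟶ (complexification G X).obj y =>
        torsorIso F.hom) h
    exact Hom.ext (Torsor.Hom.complexify_injective h')

instance full_complexification : (complexification G X).Full where
  map_surjective {x y} F := by
    obtain ⟨φ, hφ⟩ := Torsor.Hom.exists_complexify_eq (P := x.torsor) (Q := y.torsor)
      (Φ := torsorIso F.hom) (involution_comm F)
    have := x.torsor.isComplexification_complexify.epi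
    refine ⟨⟨φ, ?_⟩, HFix.Hom.ext (Hom.ext hφ)⟩
    rw [← cancel_epi x.torsor.proj, ← Category.assoc, ← φ.complexify_comp_proj, hφ, Category.assoc]
    exact total_comp_map F.hom

instance essSurj_complexification [IsAffineHom G.hom] : (complexification G X).EssSurj where
  mem_essImage d := by
    obtain ⟨P₀, π, h, hπ⟩ := d.obj.torsor.exists_descent (involution_comp_p d) (act_involution d)
      (involution_comp_self d)
    obtain ⟨f, hf⟩ := h.exists_fac (involution_comp_map d)
    obtain ⟨θ, hθ₁, hθ₂⟩ := Torsor.exists_complexify_hom h hπ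
    let x : Points G X specR :=
      ⟨P₀, f, h.equivariant_of_comp hπ (by rw [hf]; exact d.obj.equivariant)⟩
    let θ' : ((complexification G X).obj x).obj ⟶ d.obj := ⟨θ, by
      change θ.iso.hom ≫ d.obj.map = P₀.proj ≫ f
      rw [← hf, ← hθ₁, Category.assoc]⟩
    obtain ⟨F, -⟩ := exists_hom_eq (d := (complexification G X).obj x) θ' hθ₂
    exact ⟨x, ⟨(Groupoid.isoEquivHom _ _).symm F⟩⟩

theorem isEquivalence_complexification [IsAffineHom G.hom] :
    (complexification G X).IsEquivalence where

end Points

/-! ### Continuity of the complexification functor -/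

namespace Points

variable {G X : SchR} [GrpObj G] [ModObj G X]

lemma complexify_comp_complexifyMap {P Q : Torsor G specR} {φ : Torsor.Hom P Q}
    {f : EquivariantMap G P.P X} {g : EquivariantMap G Q.P X} (h : φ.iso.hom ≫ g.1 = f.1) :
    φ.complexify.iso.hom ≫ (Q.complexifyMap g).1 = (P.complexifyMap f).1 := by
  change φ.complexify.iso.hom ≫ Q.proj ≫ g.1 = P.proj ≫ f.1
  rw [← Category.assoc, φ.complexify_comp_proj, Category.assoc, h]

lemma continuous_complexification_obj : Continuous (complexification G X).obj := by
  refine HFix.continuous_iff.2 ⟨continuous_of_local fun x₀ => ?_, fun γ =>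
    continuous_of_local fun x₀ => ?_⟩
  all_goals
    obtain ⟨N, hN, hx₀, f, hf, e⟩ := exists_local_ofMap (continuous_id (X := Points G X specR)) x₀
    have hf' := Torsor.continuous_complexifyMap_iff.2 hf
  · refine ⟨N, hN, hx₀, (continuous_ofMap hf').congr fun x => ?_⟩
    exact congrArg (fun x => ((complexification G X).obj x).obj) (e x).symm
  · let φ : Torsor.Hom x₀.torsor.complexify (x₀.torsor.complexify.twist γ) :=
      torsorIso (conj γ x₀).hom
    refine ⟨N, hN, hx₀, (continuous_ofHom (P := x₀.torsor.complexify)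
      (Q := x₀.torsor.complexify.twist γ) (continuous_const (y := φ)) hf' hf' fun x =>
        pullbackEnd_snd_assoc _ _ _ (specGal_comp γ) _).congr fun x => ?_⟩
    exact congrArg (fun x => Arrow.mk (((complexification G X).obj x).φ γ).hom) (e x).symm

lemma continuous_complexification_map : Continuous (complexification G X).mapArrow.obj := by
  have h := isTopologicalGroupoid (G := G) (X := X) (S := specR)
  refine HFix.continuous_arrow_iff.2 ⟨continuous_complexification_obj.comp h.continuous_source,
    continuous_complexification_obj.comp h.continuous_target, continuous_of_local fun a₀ => ?_⟩
  obtain ⟨N, hN, ha₀, P, Q, φ, f, g, h, hφ, hf, hg, e⟩ :=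
    exists_local_ofHom (continuous_id (X := Arrow (Points G X specR))) a₀
  refine ⟨N, hN, ha₀, (continuous_ofHom (Torsor.continuous_complexify_iff.2 hφ)
    (Torsor.continuous_complexifyMap_iff.2 hf) (Torsor.continuous_complexifyMap_iff.2 hg)
    fun a => complexify_comp_complexifyMap (h a)).congr fun a => ?_⟩
  exact congrArg (fun a : Arrow (Points G X specR) =>
      (HFix.forget _).mapArrow.obj ((complexification G X).mapArrow.obj a)) (e a).symm

/-! ### The space of morphisms -/

lemma ofHom_injective {S : SchR} {P Q : Torsor G S} {φ φ' : Torsor.Hom P Q}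
    {f f' : EquivariantMap G P.P X} {g g' : EquivariantMap G Q.P X}
    {h : φ.iso.hom ≫ g.1 = f.1} {h' : φ'.iso.hom ≫ g'.1 = f'.1}
    (e : Arrow.mk (ofHom φ f g h) = Arrow.mk (ofHom φ' f' g' h')) : φ = φ' := by
  obtain rfl := ofMap_injective P (congrArg Comma.left e)
  obtain rfl := ofMap_injective Q (congrArg Comma.right e)
  exact congrArg torsorIso (Arrow.mk_injective _ _ e)

lemma exists_arrow_eq_ofHom {S : SchR} (a : Arrow (Points G X S)) {P Q : Torsor G S}
    {f : EquivariantMap G P.P X} {g : EquivariantMap G Q.P X}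
    (h₁ : (a.left : Points G X S) = ofMap P f) (h₂ : (a.right : Points G X S) = ofMap Q g) :
    ∃ (φ : Torsor.Hom P Q) (h : φ.iso.hom ≫ g.1 = f.1), a = Arrow.mk (ofHom φ f g h) := by
  obtain ⟨x, y, u⟩ := a
  obtain rfl : x = ofMap P f := h₁
  obtain rfl : y = ofMap Q g := h₂
  exact ⟨torsorIso u, total_comp_map u, rfl⟩

lemma isHomeomorph_complexification : IsHomeomorph (fun a : Arrow (Points G X specR) =>
    (⟨((a.left, a.right), (complexification G X).mapArrow.obj a), rfl, rfl⟩ :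
      {z : (Points G X specR × Points G X specR) × Arrow (HFix (galoisAction G X)) //
        (complexification G X).obj z.1.1 = z.2.left ∧
          (complexification G X).obj z.1.2 = z.2.right})) := by
  set F := fun a : Arrow (Points G X specR) =>
    (⟨((a.left, a.right), (complexification G X).mapArrow.obj a), rfl, rfl⟩ :
      {z : (Points G X specR × Points G X specR) × Arrow (HFix (galoisAction G X)) //
        (complexification G X).obj z.1.1 = z.2.left ∧
          (complexification G X).obj z.1.2 = z.2.right}) with hF
  have hgr := isTopologicalGroupoid (G := G) (X := X) (S := specR)
  have hFc : Continuous F := ((hgr.continuous_source.prodMk hgr.continuous_target).prodMk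
    continuous_complexification_map).subtype_mk _
  have hb : Function.Bijective F := by
    constructor
    · rintro ⟨x, y, f⟩ ⟨x', y', g⟩ e
      have e' := congrArg Subtype.val e
      obtain rfl : x = x' := congrArg (fun z => z.1.1) e'
      obtain rfl : y = y' := congrArg (fun z => z.1.2) e'
      have : (complexification G X).map f = (complexification G X).map g :=
        Arrow.mk_injective _ _ (congrArg Prod.snd e')
      rw [(complexification G X).map_injective this]
    · rintro ⟨⟨⟨x, y⟩, ⟨x', y', f⟩⟩, h₁, h₂⟩
      obtain rfl : (complexification G X).obj x = x' := h₁
      obtain rfl : (complexification G X).obj y = y' := h₂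
      obtain ⟨g, rfl⟩ := (complexification G X).map_surjective f
      exact ⟨Arrow.mk g, rfl⟩
  let E := Equiv.ofBijective F hb
  -- a morphism is locally given by two objects and an isomorphism of fixed torsors, and the latter
  -- varies continuously as soon as its complexification does
  have hE : Continuous E.symm := continuous_of_local fun z₀ => by
    have hl : Continuous fun z => ((E.symm z).left : Points G X specR) :=
      (continuous_fst.comp (continuous_fst.comp continuous_subtype_val)).congr fun z =>
        congrArg (fun w => w.1.1.1) (E.apply_symm_apply z).symm
    have hr : Continuous fun z => ((E.symm z).right : Points G X specR) :=
      (continuous_snd.comp (continuous_fst.comp continuous_subtype_val)).congr fun z =>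
        congrArg (fun w => w.1.1.2) (E.apply_symm_apply z).symm
    have hm : Continuous fun z => (HFix.forget (galoisAction G X)).mapArrow.obj
        ((complexification G X).mapArrow.obj (E.symm z)) :=
      ((HFix.continuous_arrow_iff.1 continuous_id).2.2.comp
        (continuous_snd.comp continuous_subtype_val)).congr fun z =>
          congrArg (HFix.forget (galoisAction G X)).mapArrow.obj
            (congrArg (fun w => w.1.2) (E.apply_symm_apply z).symm)
    obtain ⟨N₁, hN₁, hz₁, f, hf, e₁⟩ := exists_local_ofMap hl z₀
    obtain ⟨N₂, hN₂, hz₂, g, hg, e₂⟩ := exists_local_ofMap hr z₀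
    obtain ⟨N₃, hN₃, hz₃, P, Q, Φ, f', g', h', hΦ, -, -, e₃⟩ := exists_local_ofHom hm z₀
    let i₁ : ↥(N₁ ∩ N₂ ∩ N₃) → N₁ := fun z => ⟨z.1, z.2.1.1⟩
    let i₂ : ↥(N₁ ∩ N₂ ∩ N₃) → N₂ := fun z => ⟨z.1, z.2.1.2⟩
    let i₃ : ↥(N₁ ∩ N₂ ∩ N₃) → N₃ := fun z => ⟨z.1, z.2.2⟩
    have hi₁ : Continuous i₁ := continuous_subtype_val.subtype_mk _
    have hi₂ : Continuous i₂ := continuous_subtype_val.subtype_mk _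
    have hi₃ : Continuous i₃ := continuous_subtype_val.subtype_mk _
    choose φ hφ e₄ using fun z : ↥(N₁ ∩ N₂ ∩ N₃) =>
      exists_arrow_eq_ofHom (E.symm z) (e₁ (i₁ z)) (e₂ (i₂ z))
    have hP : (E.symm z₀).left.torsor.complexify = P :=
      congrArg (fun a : Arrow (Points G X specC) => a.left.torsor) (e₃ ⟨z₀, hz₃⟩)
    have hQ : (E.symm z₀).right.torsor.complexify = Q :=
      congrArg (fun a : Arrow (Points G X specC) => a.right.torsor) (e₃ ⟨z₀, hz₃⟩)
    subst hP hQ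
    have hφΦ : ∀ z, (φ z).complexify = Φ (i₃ z) := by
      intro z
      exact ofHom_injective (h := complexify_comp_complexifyMap (hφ z)) ((congrArg
        (fun a : Arrow (Points G X specR) => (HFix.forget (galoisAction G X)).mapArrow.obj
          ((complexification G X).mapArrow.obj a)) (e₄ z)).symm.trans (e₃ (i₃ z)))
    have hφc : Continuous φ := by
      rw [← Torsor.continuous_complexify_iff]
      exact (hΦ.comp hi₃).congr fun z => (hφΦ z).symm
    exact ⟨N₁ ∩ N₂ ∩ N₃, (hN₁.inter hN₂).inter hN₃, ⟨⟨hz₁, hz₂⟩, hz₃⟩,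
      (continuous_ofHom hφc (hf.comp hi₁) (hg.comp hi₂) hφ).congr fun z => (e₄ z).symm⟩
  exact (Homeomorph.mk E hFc hE).isHomeomorph

/-! ### Local sections -/

end Points

/-- The semilinear automorphism of the total space of a torsor given by an isomorphism with its
complex conjugate. -/
def Torsor.Hom.semilinear {G : SchR} [GrpObj G] {Q : Torsor G specC}
    (ψ : Torsor.Hom Q (Q.twist conjC2)) : Q.P ≅ Q.P := ψ.iso

namespace Points

variable {G X : SchR} [GrpObj G] [ModObj G X]

lemma arrow_ofHom_congr {S : SchR} {P Q : Torsor G S} {φ φ' : Torsor.Hom P Q}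
    {f f' : EquivariantMap G P.P X} {g g' : EquivariantMap G Q.P X}
    {h : φ.iso.hom ≫ g.1 = f.1} {h' : φ'.iso.hom ≫ g'.1 = f'.1} (e₁ : φ = φ') (e₂ : f = f')
    (e₃ : g = g') : Arrow.mk (ofHom φ f g h) = Arrow.mk (ofHom φ' f' g' h') := by
  subst e₁ e₂ e₃
  rfl

/-- Near a homotopy fixed point, the torsor does not change, and the equivariant map and the
semilinear involution vary continuously. -/
lemma exists_local_involution (d₀ : HFix (galoisAction G X)) :
    ∃ N : Set (HFix (galoisAction G X)), IsOpen N ∧ d₀ ∈ N ∧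
      ∃ (m : N → EquivariantMap G d₀.obj.torsor.P X)
        (ψ : N → Torsor.Hom d₀.obj.torsor (d₀.obj.torsor.twist conjC2))
        (h : ∀ d, (ψ d).iso.hom ≫ (m d).1 = (m d).1), Continuous m ∧ Continuous ψ ∧
        ∀ d : N, d.1.obj = ofMap d₀.obj.torsor (m d) ∧ Arrow.mk (d.1.φ conjC2).hom =
          Arrow.mk (ofHom (Q := d₀.obj.torsor.twist conjC2) (ψ d) (m d) (m d) (h d)) := by
  have hc := HFix.continuous_iff.1 (continuous_id (X := HFix (galoisAction G X)))
  obtain ⟨N₁, hN₁, h₁, m, hm, e₁⟩ := exists_local_ofMap hc.1 d₀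
  obtain ⟨N₂, hN₂, h₂, P, Q, ψ, f, g, h, hψ, hf, hg, e₂⟩ := exists_local_ofHom (hc.2 conjC2) d₀
  have hP : d₀.obj.torsor = P :=
    congrArg (fun a : Arrow (Points G X specC) => a.left.torsor) (e₂ ⟨d₀, h₂⟩)
  have hQ : d₀.obj.torsor.twist conjC2 = Q :=
    congrArg (fun a : Arrow (Points G X specC) => a.right.torsor) (e₂ ⟨d₀, h₂⟩)
  subst hP hQ
  let i₁ : ↥(N₁ ∩ N₂) → N₁ := fun z => ⟨z.1, z.2.1⟩
  let i₂ : ↥(N₁ ∩ N₂) → N₂ := fun z => ⟨z.1, z.2.2⟩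
  have hi₁ : Continuous i₁ := continuous_subtype_val.subtype_mk _
  have hi₂ : Continuous i₂ := continuous_subtype_val.subtype_mk _
  have hmf : ∀ z, m (i₁ z) = f (i₂ z) := fun z => ofMap_injective _
    ((e₁ (i₁ z)).symm.trans (congrArg Comma.left (e₂ (i₂ z))))
  have hmg : ∀ z, m (i₁ z) = g (i₂ z) := fun z =>
    ofMap_injective (d₀.obj.torsor.twist conjC2)
      ((congrArg (twist conjC2).obj (e₁ (i₁ z))).symm.trans (congrArg Comma.right (e₂ (i₂ z))))
  have hfg : ∀ z, (ψ (i₂ z)).iso.hom ≫ (m (i₁ z)).1 = (m (i₁ z)).1 := by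
    intro z
    refine (congrArg (fun k => (ψ (i₂ z)).iso.hom ≫ Subtype.val k) (hmg z)).trans ?_
    rw [hmf]
    exact h _
  exact ⟨N₁ ∩ N₂, hN₁.inter hN₂, ⟨h₁, h₂⟩, fun z => m (i₁ z), fun z => ψ (i₂ z), hfg,
    hm.comp hi₁, hψ.comp hi₂, fun z => ⟨e₁ (i₁ z), (e₂ (i₂ z)).trans
      (arrow_ofHom_congr (Q := d₀.obj.torsor.twist conjC2) rfl (hmf z).symm (hmg z).symm)⟩⟩

lemma torsorIso_φ_eq {Q : Torsor G specC} {d : HFix (galoisAction G X)}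
    {m : EquivariantMap G Q.P X} (hd : d.obj = ofMap Q m) {ψ : Torsor.Hom Q (Q.twist conjC2)}
    {h : ψ.iso.hom ≫ m.1 = m.1}
    (hψ : Arrow.mk (d.φ conjC2).hom = Arrow.mk (ofHom (Q := Q.twist conjC2) ψ m m h)) :
    ∃ hQ : d.obj.torsor = Q,
      hQ ▸ torsorIso (y := (twist conjC2).obj d.obj) (d.φ conjC2).hom = ψ := by
  obtain ⟨x, φ, hc⟩ := d
  obtain rfl : x = ofMap Q m := hd
  exact ⟨rfl, ofHom_injective (Q := Q.twist conjC2)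
      (h := total_comp_map (y := (twist conjC2).obj (ofMap Q m)) (φ conjC2).hom) hψ⟩

/-- An isomorphism of torsors commuting with the involutions gives a morphism of homotopy fixed
points. -/
lemma exists_hom_of_complexify {P : Torsor G specR} {Q : Torsor G specC}
    {d : HFix (galoisAction G X)} {m : EquivariantMap G Q.P X} (hd : d.obj = ofMap Q m)
    {ψ : Torsor.Hom Q (Q.twist conjC2)} {h : ψ.iso.hom ≫ m.1 = m.1}
    (hψ : Arrow.mk (d.φ conjC2).hom = Arrow.mk (ofHom (Q := Q.twist conjC2) ψ m m h))
    {α : Torsor.Hom P.complexify Q}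
    (hα : P.conjugation ≫ α.iso.hom = α.iso.hom ≫ ψ.semilinear.hom)
    {f : EquivariantMap G P.P X} (hf : α.iso.hom ≫ m.1 = (P.complexifyMap f).1) :
    ∃ F : (complexification G X).obj (ofMap P f) ⟶ d,
      (HFix.forget _).mapArrow.obj (Arrow.mk F) = Arrow.mk (ofHom α (P.complexifyMap f) m hf) := by
  obtain ⟨hQ, hψ'⟩ := torsorIso_φ_eq hd hψ
  obtain ⟨x, φ, hc⟩ := d
  obtain rfl : x = ofMap Q m := hd
  obtain ⟨F, hF⟩ := exists_hom_eq (d := (complexification G X).obj (ofMap P f))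
    (d' := ⟨ofMap Q m, φ, hc⟩) (ofHom α (P.complexifyMap f) m hf) (by
      subst hψ'
      exact hα)
  exact ⟨F, congrArg Arrow.mk hF⟩

lemma comp_self_of_φ_eq {Q : Torsor G specC} {d : HFix (galoisAction G X)}
    {m : EquivariantMap G Q.P X} (hd : d.obj = ofMap Q m) {ψ : Torsor.Hom Q (Q.twist conjC2)}
    {h : ψ.iso.hom ≫ m.1 = m.1}
    (hψ : Arrow.mk (d.φ conjC2).hom = Arrow.mk (ofHom (Q := Q.twist conjC2) ψ m m h)) :
    ψ.semilinear.hom ≫ ψ.semilinear.hom = 𝟙 Q.P := by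
  obtain ⟨hQ, hψ'⟩ := torsorIso_φ_eq hd hψ
  subst hQ hψ'
  exact involution_comp_self d

end Points

namespace Torsor

variable {G : SchR} [GrpObj G]

lemma Hom.mul_iso_hom {S : SchR} {P : Torsor G S} (φ ψ : Hom P P) :
    (φ * ψ).iso.hom = φ.iso.hom ≫ ψ.iso.hom := rfl

variable (P : Torsor G specR)

/-- Conjugation of the automorphisms of the complexification of a torsor by complex conjugation. -/
def conjAut : Hom P.complexify P.complexify →* Hom P.complexify P.complexify :=
  MonoidHom.mk' (fun φ =>
    { iso := ⟨P.conjugation, P.conjugation, P.conjugation_comp_self, P.conjugation_comp_self⟩ ≪≫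
        φ.iso ≪≫ ⟨P.conjugation, P.conjugation, P.conjugation_comp_self, P.conjugation_comp_self⟩
      equivariant := by
        simp only [Iso.trans_hom]
        rw [reassoc_of% P.act_conjugation, reassoc_of% φ.equivariant, P.act_conjugation]
        simp
      comp_p := by
        have h := P.isComplexification_complexify.comp_q
        simp only [Iso.trans_hom, Category.assoc]
        rw [h, reassoc_of% φ.comp_p, reassoc_of% h, ← specGal_mul, conjC2_mul_self, specGal_one,
          Category.comp_id] })
    (fun φ ψ => Hom.ext (Iso.ext (by
      change P.conjugation ≫ (φ.iso.hom ≫ ψ.iso.hom) ≫ P.conjugation =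
        (P.conjugation ≫ φ.iso.hom ≫ P.conjugation) ≫ P.conjugation ≫ ψ.iso.hom ≫ P.conjugation
      simp only [Category.assoc]
      rw [reassoc_of% P.conjugation_comp_self])))

lemma conjAut_iso_hom (φ : Hom P.complexify P.complexify) :
    (P.conjAut φ).iso.hom = P.conjugation ≫ φ.iso.hom ≫ P.conjugation := rfl

lemma continuous_conjAut : Continuous P.conjAut := by
  refine continuous_torsorHom_iff.2 fun y => ?_
  simp only [conjAut_iso_hom, ComplexPoints.map_comp]
  exact (continuous_complexPointsMap _).comp (continuous_torsorHom_iff.1 continuous_id _)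

variable {P} {Q : Torsor G specC}

/-- The difference of two semilinear involutions: an involution of a torsor `Q`, transported to the
complexification of `P` along an isomorphism, and composed with complex conjugation. -/
def twistedAut (α : Hom P.complexify Q) (ψ : Hom Q (Q.twist conjC2)) :
    Hom P.complexify P.complexify where
  iso := ⟨P.conjugation, P.conjugation, P.conjugation_comp_self, P.conjugation_comp_self⟩ ≪≫
    α.iso ≪≫ ψ.semilinear ≪≫ α.iso.symm
  equivariant := by
    have hψ : act G Q.P ≫ ψ.semilinear.hom = G ◁ ψ.semilinear.hom ≫ act G Q.P := ψ.equivariant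
    have hα : act G Q.P ≫ α.iso.symm.hom = G ◁ α.iso.symm.hom ≫ act G _ := α.symm.equivariant
    simp only [Iso.trans_hom]
    rw [reassoc_of% P.act_conjugation, reassoc_of% α.equivariant, reassoc_of% hψ, hα]
    simp only [MonoidalCategory.whiskerLeft_comp, Category.assoc]
  comp_p := by
    have hψ : ψ.semilinear.hom ≫ Q.p = Q.p ≫ specGal conjC2 :=
      Points.comp_p_of_comp_twist_p ψ.comp_p
    have hα : α.iso.symm.hom ≫ P.complexify.p = Q.p := α.symm.comp_p
    simp only [Iso.trans_hom, Category.assoc]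
    rw [hα, hψ, reassoc_of% α.comp_p, reassoc_of% P.isComplexification_complexify.comp_q,
      ← specGal_mul, conjC2_mul_self, specGal_one, Category.comp_id]

lemma twistedAut_iso_hom (α : Hom P.complexify Q) (ψ : Hom Q (Q.twist conjC2)) :
    (twistedAut α ψ).iso.hom =
      P.conjugation ≫ α.iso.hom ≫ ψ.semilinear.hom ≫ α.iso.inv := rfl

lemma continuous_twistedAut {Z : Type*} [TopologicalSpace Z] (α : Hom P.complexify Q)
    {ψ : Z → Hom Q (Q.twist conjC2)} (hψ : Continuous ψ) :
    Continuous fun z => twistedAut α (ψ z) := by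
  refine continuous_torsorHom_iff.2 fun y => ?_
  simp only [twistedAut_iso_hom, ComplexPoints.map_comp]
  exact (continuous_complexPointsMap α.iso.inv).comp
    (continuous_torsorHom_iff.1 hψ ((y.map P.conjugation).map α.iso.hom))

lemma conjAut_twistedAut_mul (α : Hom P.complexify Q) {ψ : Hom Q (Q.twist conjC2)}
    (hψ : ψ.semilinear.hom ≫ ψ.semilinear.hom = 𝟙 Q.P) :
    P.conjAut (twistedAut α ψ) * twistedAut α ψ = 1 := by
  refine Hom.ext (Iso.ext ?_)
  simp only [Hom.mul_iso_hom, conjAut_iso_hom, twistedAut_iso_hom,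
    Category.assoc]
  rw [reassoc_of% P.conjugation_comp_self, reassoc_of% P.conjugation_comp_self,
    Iso.inv_hom_id_assoc, reassoc_of% hψ, Iso.hom_inv_id]
  rfl

/-- If the difference of two semilinear involutions is the coboundary of `h`, then `h` transports
one of them to the other. -/
lemma conjugation_comp_trans {α : Hom P.complexify Q} {ψ : Hom Q (Q.twist conjC2)}
    (hψ : ψ.semilinear.hom ≫ ψ.semilinear.hom = 𝟙 Q.P) {h : Hom P.complexify P.complexify}
    (hh : (P.conjAut h)⁻¹ * h = twistedAut α ψ) :
    P.conjugation ≫ (h.trans α).iso.hom = (h.trans α).iso.hom ≫ ψ.semilinear.hom := by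
  rw [inv_mul_eq_iff_eq_mul] at hh
  have e : h.iso.hom = P.conjugation ≫ h.iso.hom ≫ α.iso.hom ≫
      ψ.semilinear.hom ≫ α.iso.inv := by
    refine (congrArg (fun k => k.iso.hom) hh).trans ?_
    simp only [Hom.mul_iso_hom, conjAut_iso_hom, twistedAut_iso_hom,
      Category.assoc]
    rw [reassoc_of% P.conjugation_comp_self]
  change P.conjugation ≫ h.iso.hom ≫ α.iso.hom =
    (h.iso.hom ≫ α.iso.hom) ≫ ψ.semilinear.hom
  conv_rhs => rw [e]
  simp only [Category.assoc, Iso.inv_hom_id_assoc]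
  rw [hψ, Category.comp_id]

end Torsor

namespace Points

variable {G X : SchR} [GrpObj G] [ModObj G X]

lemma arrow_complexification_eq_ofHom {c : Points G X specR} {d : HFix (galoisAction G X)}
    (F : (complexification G X).obj c ⟶ d) {m : EquivariantMap G d.obj.torsor.P X}
    (hm : d.obj = ofMap d.obj.torsor m) :
    ∃ h : (torsorIso F.hom).iso.hom ≫ m.1 = (c.torsor.complexifyMap c.equivariantMap).1,
      (HFix.forget _).mapArrow.obj (Arrow.mk F) = Arrow.mk (ofHom (P := c.torsor.complexify)
        (torsorIso F.hom) (c.torsor.complexifyMap c.equivariantMap) m h) := by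
  obtain rfl : d.obj.equivariantMap = m := ofMap_injective d.obj.torsor hm
  exact ⟨total_comp_map F.hom, rfl⟩

/-- The local sections: near the target `d₀` of an isomorphism `α₀ : P_ℂ ≅ Q`, the involution of `Q`
and complex conjugation on `P_ℂ` differ by a cocycle near `1`; this is the coboundary of some `h`
depending continuously on the target, and `h` followed by `α₀` is an isomorphism over `ℝ`. -/
lemma isTopologicalSubmersion_target [Smooth G.hom] : IsTopologicalSubmersion
    (fun z : {z : Points G X specR × Arrow (HFix (galoisAction G X)) //
      (complexification G X).obj z.1 = z.2.left} => (z.1.2.right : HFix (galoisAction G X))) := by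
  rintro ⟨⟨c, ⟨d', d₀, F₀⟩⟩, hd'⟩
  obtain rfl : (complexification G X).obj c = d' := hd'
  change (complexification G X).obj c ⟶ d₀ at F₀
  let P := c.torsor
  let Q := d₀.obj.torsor
  let α₀ : Torsor.Hom P.complexify Q := torsorIso F₀.hom
  obtain ⟨N, hN, hd₀, m, ψ, h, hm, hψ, e⟩ := exists_local_involution d₀
  have hinv : ∀ d : N, (ψ d).semilinear.hom ≫ (ψ d).semilinear.hom = 𝟙 Q.P :=
    fun d => comp_self_of_φ_eq (e d).1 (e d).2
  have hψ₀ : (ψ ⟨d₀, hd₀⟩).semilinear.hom = involution d₀ := by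
    obtain ⟨_, hψ₀⟩ := torsorIso_φ_eq (e ⟨d₀, hd₀⟩).1 (e ⟨d₀, hd₀⟩).2
    exact congrArg (fun k : Torsor.Hom Q (Q.twist conjC2) => k.semilinear.hom) hψ₀.symm
  have hα₀ : P.conjugation ≫ α₀.iso.hom = α₀.iso.hom ≫ (ψ ⟨d₀, hd₀⟩).semilinear.hom := by
    rw [hψ₀]
    exact involution_comm F₀
  -- the two involutions agree under `α₀` at the given point, so their difference is `1` there
  have hz : Continuous fun d : N => Torsor.twistedAut α₀ (ψ d) := Torsor.continuous_twistedAut α₀ hψ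
  have hz₀ : Torsor.twistedAut α₀ (ψ ⟨d₀, hd₀⟩) = 1 := by
    refine Torsor.Hom.ext (Iso.ext ?_)
    rw [Torsor.twistedAut_iso_hom, ← reassoc_of% hα₀, reassoc_of% P.conjugation_comp_self,
      Iso.hom_inv_id]
    rfl
  obtain ⟨U, r, hU, h1, hr, hr₁, hrU⟩ :=
    (Torsor.hasLocalSqrt_hom P.complexify).exists_coboundary P.continuous_conjAut
  let V : Set (HFix (galoisAction G X)) :=
    Subtype.val '' ((fun d : N => Torsor.twistedAut α₀ (ψ d)) ⁻¹' U)
  have hV : IsOpen V := hN.isOpenMap_subtype_val _ (hU.preimage hz)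
  have hVN : V ⊆ N := by
    rintro _ ⟨d, -, rfl⟩
    exact d.2
  let i : V → N := fun v => ⟨v.1, hVN v.2⟩
  have hi : Continuous i := continuous_subtype_val.subtype_mk _
  have hiU : ∀ v, Torsor.twistedAut α₀ (ψ (i v)) ∈ U := by
    rintro ⟨_, d, hd, rfl⟩
    exact hd
  have hd₀V : d₀ ∈ V := ⟨⟨d₀, hd₀⟩, by rw [Set.mem_preimage, hz₀]; exact h1, rfl⟩
  -- correct `α₀` by the coboundary so that it commutes with the involutions
  let α : V → Torsor.Hom P.complexify Q := fun v =>
    (r (Torsor.twistedAut α₀ (ψ (i v)))).trans α₀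
  have hαc : Continuous α := Torsor.Hom.continuous_trans
    (hr.comp_continuous (hz.comp hi) hiU) continuous_const
  have hα : ∀ v, P.conjugation ≫ (α v).iso.hom = (α v).iso.hom ≫ (ψ (i v)).semilinear.hom :=
    fun v => Torsor.conjugation_comp_trans (hinv _)
      (hrU _ (hiU v) (Torsor.conjAut_twistedAut_mul α₀ (hinv _)))
  have hαd₀ : α ⟨d₀, hd₀V⟩ = α₀ := by
    change (r (Torsor.twistedAut α₀ (ψ ⟨d₀, hd₀⟩))).trans α₀ = α₀
    rw [hz₀, hr₁]
    exact Torsor.Hom.ext (Iso.ext (Category.id_comp _))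
  let g : V → EquivariantMap G P.complexify.P X := fun v =>
    ⟨(α v).iso.hom ≫ (m (i v)).1, by
      rw [reassoc_of% (α v).equivariant, (m (i v)).2, ← whiskerLeft_comp_assoc]⟩
  have hg : ∀ v, P.conjugation ≫ (g v).1 = (g v).1 := fun v => by
    change P.conjugation ≫ (α v).iso.hom ≫ (m (i v)).1 = (α v).iso.hom ≫ (m (i v)).1
    rw [reassoc_of% hα v]
    exact congrArg ((α v).iso.hom ≫ ·) (h (i v))
  -- the map to `X`, pulled back along the corrected isomorphism, is defined over `ℝ`
  choose f hf using fun v => Torsor.exists_complexifyMap_eq (hg v)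
  have hfα : ∀ v, (α v).iso.hom ≫ (m (i v)).1 = (P.complexifyMap (f v)).1 := fun v =>
    (congrArg Subtype.val (hf v)).symm
  have hfc : Continuous f := by
    rw [← Torsor.continuous_complexifyMap_iff]
    refine continuous_equivariantMap_iff.2 fun y => ?_
    simp only [← hfα, ComplexPoints.map_comp]
    exact Torsor.Hom.continuous_comp hαc (hm.comp hi) y
  choose F hF using fun v => exists_hom_of_complexify (e (i v)).1 (e (i v)).2 (hα v) (hfα v)
  obtain ⟨hF₀, hF₀'⟩ := arrow_complexification_eq_ofHom F₀ (e ⟨d₀, hd₀⟩).1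
  have hfd₀ : f ⟨d₀, hd₀V⟩ = c.equivariantMap := P.complexifyMap_injective (Subtype.ext (by
    rw [← hfα, ← hF₀, hαd₀]
    rfl))
  refine ⟨V, hd₀V, fun v => ⟨(ofMap P (f v), Arrow.mk (F v)), rfl⟩, hV, ?_, fun _ => rfl, ?_⟩
  · refine ((continuous_ofMap hfc).prodMk (HFix.continuous_arrow_iff.2
      ⟨continuous_complexification_obj.comp (continuous_ofMap hfc), continuous_subtype_val,
        ?_⟩)).subtype_mk _
    exact (continuous_ofHom hαc (Torsor.continuous_complexifyMap_iff.2 hfc) (hm.comp hi)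
      hfα).congr fun v => (hF v).symm
  · have hc : ofMap P (f ⟨d₀, hd₀V⟩) = c := congrArg (ofMap P) hfd₀
    refine Subtype.ext (Prod.ext hc
      (HFix.arrow_ext (congrArg (complexification G X).obj hc) rfl ?_))
    exact (hF ⟨d₀, hd₀V⟩).trans ((arrow_ofHom_congr hαd₀ (congrArg _ hfd₀) rfl).trans hF₀'.symm)

theorem isTopologicalEquivalence_complexification [IsAffineHom G.hom] [Smooth G.hom] :
    IsTopologicalEquivalence (complexification G X) where
  continuous_obj := continuous_complexification_obj
  continuous_map := continuous_complexification_map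
  isEquivalence := isEquivalence_complexification
  isHomeomorph := isHomeomorph_complexification
  surjective d := ⟨⟨((complexification G X).objPreimage d,
    Arrow.mk ((complexification G X).objObjPreimageIso d).hom), rfl⟩, rfl⟩
  isSubmersion := isTopologicalSubmersion_target

end Points

end

end RealStack

theorem mainTheorem4 (G : RealStack.SchR) [GrpObj G] [IsAffineHom G.hom] [Smooth G.hom]
    (X : RealStack.SchR) [ModObj G X] [Smooth X.hom] :
    RealStack.IsTopologicalGroupoid (RealStack.Points G X RealStack.specR) ∧
    RealStack.IsTopologicalGroupoid (RealStack.Points G X RealStack.specC) ∧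
    (RealStack.Points.galoisAction G X).IsContinuous ∧
    RealStack.IsTopologicalGroupoid (RealStack.HFix (RealStack.Points.galoisAction G X)) ∧
    RealStack.IsTopologicalEquivalence (RealStack.Points.complexification G X) := 
  ⟨RealStack.Points.isTopologicalGroupoid, RealStack.Points.isTopologicalGroupoid,
    RealStack.Points.isContinuous_galoisAction,
    RealStack.HFix.isTopologicalGroupoid RealStack.Points.isTopologicalGroupoid,
    RealStack.Points.isTopologicalEquivalence_complexification⟩
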